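/- Let $\mu_\sigma,\mu_\varepsilon$ be positive Radon (that is, finite Borel) measures on $[0,1]$ with $\mu_\sigma\neq 0$, satisfying the thermodynamical restriction (T) the signed measure $\mu_\varepsilon\times\mu_\sigma-\mu_\sigma\times\mu_\varepsilon$ is non-negative on the triangle $\{(\alpha,\beta)\in[0,1]^2:\alpha>\beta\}$. For $\operatorname{Re}s>0$ put $\Phi_\sigma(s)=\int_{[0,1]}s^\alpha\,d\mu_\sigma(\alpha)$ and $\Phi_\varepsilon(s)=\int_{[0,1]}s^\alpha\,d\mu_\varepsilon(\alpha)$ (principal branch). Let $\mathcal S'_+(\mathbb R)$ be the space of tempered distributions on $\mathbb R$ vanishing on $(-\infty,0)$, with Laplace transform $\mathcal L u(s)=\langle u(t),e^{-st}\rangle$, and let $\mathcal S'(\mathbb R\times\mathbb R_+)$ be the space of tempered distributions on $\mathbb R^2$ (variables $(x,t)$) vanishing on $\mathbb R\times(-\infty,0)$. Then: 1. There is a unique $L\in\mathcal S'_+(\mathbb R)$ with $\mathcal L L(s)=\Phi_\varepsilon(s)/\Phi_\sigma(s)$ for all $s$ with $\operatorname{Re}s>0$; that is, the inverse Laplace transform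 $L=\mathcal L^{-1}(\Phi_\varepsilon/\Phi_\sigma)$ exists. 2. For this $L$ and for all $u_0,v_0\in\mathcal S'(\mathbb R)$, the Cauchy problem for the distributed-order fractional wave equation $$\partial_t^2u=L*_t\partial_x^2u,\qquad u(x,0)=u_0(x),\quad \partial_tu(x,0)=v_0(x),$$ has a unique solution $u\in\mathcal S'(\mathbb R\times\mathbb R_+)$. Here, as usual for distributional solutions, the initial data enter as sources at $t=0$: $u$ is a solution if $$\partial_t^2u-L*_t\partial_x^2u=u_0(x)\otimes\delta'(t)+v_0(x)\otimes\delta(t)\qquad\text{in }\mathcal S'(\mathbb R^2),$$ where $\langle L*_tw,\varphi\rangle=\langle L(\tau)\otimes w(x,t),\varphi(x,t+\tau)\rangle$. -/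

import Mathlib

open MeasureTheory Distribution
open scoped SchwartzMap LineDeriv

noncomputable section

namespace ViscoWave

section Tensor

variable {V : Type*} [NormedAddCommGroup V] [NormedSpace ℝ V]

lemma lineDeriv_comm (v w : V) (f : 𝓢(V, ℂ)) :
    (∂_{v} (∂_{w} f) : 𝓢(V, ℂ)) = ∂_{w} (∂_{v} f) := by
  have key : ∀ (a b : V) (x : V), (∂_{a} (∂_{b} f) : 𝓢(V, ℂ)) x = fderiv ℝ (fderiv ℝ f) x a b := by
    intro a b x
    have hd : DifferentiableAt ℝ (fderiv ℝ f) x :=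
      (((f.smooth 2).fderiv_right (m := 1) (by norm_num)).differentiable (by norm_num)) x
    have h1 : ((∂_{b} f : 𝓢(V, ℂ)) : V → ℂ) = fun y ↦ fderiv ℝ f y b := by
      ext y; exact SchwartzMap.lineDerivOp_apply_eq_fderiv b f y
    rw [SchwartzMap.lineDerivOp_apply_eq_fderiv, h1, fderiv_clm_apply hd (by fun_prop)]
    simp
  ext x
  rw [key, key]
  have hs : IsSymmSndFDerivAt ℝ f x :=
    ((f.smooth 2).contDiffAt (x := x)).isSymmSndFDerivAt (by simp)
  exact hs.eq v w

lemma iteratedLineDeriv_comm {n : ℕ} (m : Fin n → V) (w : V) (f : 𝓢(V, ℂ)) :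
    (∂^{m} (∂_{w} f) : 𝓢(V, ℂ)) = ∂_{w} (∂^{m} f) := by
  induction n with
  | zero => rfl
  | succ n ih =>
    rw [LineDeriv.iteratedLineDerivOp_succ_left, ih, lineDeriv_comm,
      ← LineDeriv.iteratedLineDerivOp_succ_left]

lemma iteratedLineDeriv_translate {n : ℕ} (m : Fin n → V) (a : V) (f : 𝓢(V, ℂ)) :
    (∂^{m} (f.compSubConstCLM ℂ a) : 𝓢(V, ℂ)) = (∂^{m} f : 𝓢(V, ℂ)).compSubConstCLM ℂ a := by
  induction n with
  | zero => rfl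
  | succ n ih =>
    rw [LineDeriv.iteratedLineDerivOp_succ_left, ih, LineDeriv.iteratedLineDerivOp_succ_left]
    ext x
    rw [SchwartzMap.lineDerivOp_apply_eq_fderiv, SchwartzMap.compSubConstCLM_apply,
      SchwartzMap.lineDerivOp_apply_eq_fderiv, ← fderiv_comp_sub]
    rfl

/-- The second order Taylor estimate for a translation, in one Schwartz seminorm. -/
lemma translate_seminorm_le (e : V) (he : ‖e‖ ≤ 1) (f : 𝓢(V, ℂ)) (k n : ℕ) :
    ∃ M : ℝ, ∀ h : ℝ, |h| ≤ 1 →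
      SchwartzMap.seminorm ℂ k n
        (f.compSubConstCLM ℂ (-(h • e)) - f - h • (∂_{e} f : 𝓢(V, ℂ))) ≤ M * h ^ 2 := by
  set S : ℝ := 2 ^ k * ((Finset.Iic (k, n + 2)).sup
    (fun m ↦ SchwartzMap.seminorm ℂ m.1 m.2)) f with hS
  have hS0 : 0 ≤ S := by positivity
  refine ⟨2 ^ k * S, fun h hh ↦ ?_⟩
  refine SchwartzMap.seminorm_le_bound ℂ k n _ (by positivity) fun z ↦ ?_
  have hz : 0 < (1 + ‖z‖) ^ k := by positivity
  suffices H : ‖iteratedFDeriv ℝ n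
      (f.compSubConstCLM ℂ (-(h • e)) - f - h • (∂_{e} f : 𝓢(V, ℂ)) : 𝓢(V, ℂ)) z‖ ≤
      2 ^ k * S / (1 + ‖z‖) ^ k * h ^ 2 by
    calc _ ≤ (1 + ‖z‖) ^ k * (2 ^ k * S / (1 + ‖z‖) ^ k * h ^ 2) := by
          gcongr; linarith
      _ = _ := by field_simp
  refine ContinuousMultilinearMap.opNorm_le_bound (by positivity) fun m ↦ ?_
  rw [← SchwartzMap.iteratedLineDerivOp_eq_iteratedFDeriv]
  set ψ : 𝓢(V, ℂ) := ∂^{m} f with hψ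
  have hexp : (∂^{m} (f.compSubConstCLM ℂ (-(h • e)) - f - h • (∂_{e} f : 𝓢(V, ℂ))) : 𝓢(V, ℂ)) =
      ψ.compSubConstCLM ℂ (-(h • e)) - ψ - h • (∂_{e} ψ : 𝓢(V, ℂ)) := by
    rw [hψ, ← iteratedLineDeriv_translate, ← iteratedLineDeriv_comm, sub_eq_add_neg,
      sub_eq_add_neg, LineDeriv.iteratedLineDerivOp_add, LineDeriv.iteratedLineDerivOp_add,
      LineDeriv.iteratedLineDerivOp_neg, LineDeriv.iteratedLineDerivOp_neg,
      LineDeriv.iteratedLineDerivOp_smul]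
    simp [sub_eq_add_neg]
  rw [hexp]
  set K : ℝ := 2 ^ k * S / (1 + ‖z‖) ^ k * ∏ i, ‖m i‖ with hK
  have hK0 : 0 ≤ K := by positivity
  have hline : ∀ (g : 𝓢(V, ℂ)) (t : ℝ),
      HasDerivAt (fun t : ℝ ↦ g (z + t • e)) ((∂_{e} g : 𝓢(V, ℂ)) (z + t • e)) t := by
    intro g t
    have h1 : HasDerivAt (fun t : ℝ ↦ z + t • e) e t := by
      simpa using ((hasDerivAt_id t).smul_const e).const_add z
    exact (g.hasFDerivAt (z + t • e)).comp_hasDerivAt t h1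
  have hbd : ∀ t ∈ Set.uIcc 0 h, ‖(∂_{e} (∂_{e} ψ) : 𝓢(V, ℂ)) (z + t • e)‖ ≤ K := by
    intro t ht
    have ht1 : |t| ≤ 1 := by
      have := Set.abs_sub_left_of_mem_uIcc ht
      simp at this; linarith
    have e1 : (∂_{e} (∂_{e} ψ) : 𝓢(V, ℂ)) (z + t • e) =
        iteratedFDeriv ℝ (n + 2) f (z + t • e) (Fin.cons e (Fin.cons e m)) := by
      rw [← SchwartzMap.iteratedLineDerivOp_eq_iteratedFDeriv,
        LineDeriv.iteratedLineDerivOp_succ_left, LineDeriv.iteratedLineDerivOp_succ_left]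
      simp [hψ, Fin.tail_cons]
    rw [e1]
    have hle := SchwartzMap.one_add_le_sup_seminorm_apply (𝕜 := ℂ) (m := (k, n + 2)) (k := k)
      (n := n + 2) le_rfl le_rfl f (z + t • e)
    rw [← hS] at hle
    have hzz : (1 + ‖z‖) ^ k ≤ 2 ^ k * (1 + ‖z + t • e‖) ^ k := by
      rw [← mul_pow]
      gcongr
      have h2 : ‖z‖ ≤ ‖z + t • e‖ + ‖t • e‖ := by
        simpa using norm_sub_le (z + t • e) (t • e)
      have h3 : ‖t • e‖ ≤ 1 := by
        rw [norm_smul, Real.norm_eq_abs]; nlinarith [norm_nonneg e, abs_nonneg t]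
      linarith [norm_nonneg (z + t • e)]
    have hD : ‖iteratedFDeriv ℝ (n + 2) f (z + t • e)‖ ≤ 2 ^ k * S / (1 + ‖z‖) ^ k := by
      rw [le_div_iff₀ hz]
      calc _ ≤ ‖iteratedFDeriv ℝ (n + 2) f (z + t • e)‖ * (2 ^ k * (1 + ‖z + t • e‖) ^ k) := by
            gcongr
        _ = 2 ^ k * ((1 + ‖z + t • e‖) ^ k * ‖iteratedFDeriv ℝ (n + 2) f (z + t • e)‖) := by ring
        _ ≤ _ := by gcongr
    refine (ContinuousMultilinearMap.le_opNorm _ _).trans ?_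
    rw [hK]
    gcongr
    rw [Fin.prod_univ_succ, Fin.prod_univ_succ]
    simp only [Fin.cons_zero, Fin.cons_succ]
    have hp : 0 ≤ ∏ i, ‖m i‖ := by positivity
    calc ‖e‖ * (‖e‖ * ∏ i, ‖m i‖) ≤ 1 * (1 * ∏ i, ‖m i‖) := by gcongr
      _ = _ := by ring
  have hconv : Convex ℝ (Set.uIcc 0 h) := convex_uIcc 0 h
  have h0 : (0 : ℝ) ∈ Set.uIcc 0 h := Set.left_mem_uIcc
  have hh' : h ∈ Set.uIcc 0 h := Set.right_mem_uIcc
  have step1 : ∀ t ∈ Set.uIcc 0 h,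
      ‖(∂_{e} ψ : 𝓢(V, ℂ)) (z + t • e) - (∂_{e} ψ : 𝓢(V, ℂ)) z‖ ≤ K * |h| := by
    intro t ht
    have := hconv.norm_image_sub_le_of_norm_hasDerivWithin_le
      (fun x _ ↦ (hline (∂_{e} ψ) x).hasDerivWithinAt) hbd h0 ht
    simp only [zero_smul, add_zero, sub_zero, Real.norm_eq_abs] at this
    refine this.trans ?_
    have := Set.abs_sub_left_of_mem_uIcc ht
    simp only [sub_zero] at this
    gcongr
  have step2 := hconv.norm_image_sub_le_of_norm_hasDerivWithin_le
    (f := fun t : ℝ ↦ ψ (z + t • e) - t • (∂_{e} ψ : 𝓢(V, ℂ)) z)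
    (f' := fun t ↦ (∂_{e} ψ : 𝓢(V, ℂ)) (z + t • e) - (∂_{e} ψ : 𝓢(V, ℂ)) z)
    (fun x _ ↦ by
      have := (hline ψ x).sub ((hasDerivAt_id x).smul_const ((∂_{e} ψ : 𝓢(V, ℂ)) z))
      simp only [id, one_smul] at this
      exact this.hasDerivWithinAt) step1 h0 hh'
  simp only [zero_smul, add_zero, sub_zero, Real.norm_eq_abs] at step2
  have e2 : (ψ.compSubConstCLM ℂ (-(h • e)) - ψ - h • (∂_{e} ψ : 𝓢(V, ℂ))) z =
      ψ (z + h • e) - h • (∂_{e} ψ : 𝓢(V, ℂ)) z - ψ z := by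
    simp [sub_eq_add_neg]; ring
  rw [e2]
  refine step2.trans (le_of_eq ?_)
  rw [hK, ← sq_abs h]; ring

/-- Translation is differentiable in the Schwartz space. -/
lemma hasDerivAt_translate (T : 𝓢(V, ℂ) →L[ℂ] ℂ) (e : V) (he : ‖e‖ ≤ 1) (f : 𝓢(V, ℂ)) :
    HasDerivAt (fun h : ℝ ↦ T (f.compSubConstCLM ℂ (-(h • e)))) (T (∂_{e} f)) 0 := by
  have hq : Continuous ((normSeminorm ℂ ℂ).comp (T : 𝓢(V, ℂ) →ₗ[ℂ] ℂ)) := by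
    exact continuous_norm.comp T.continuous
  obtain ⟨s, C, -, hC⟩ := Seminorm.bound_of_continuous (schwartz_withSeminorms ℂ V ℂ) _ hq
  choose M hM using fun p : ℕ × ℕ ↦ translate_seminorm_le e he f p.1 p.2
  set B : ℝ := ∑ p ∈ s, |M p|
  have hB : 0 ≤ B := Finset.sum_nonneg fun _ _ ↦ abs_nonneg _
  rw [hasDerivAt_iff_isLittleO_nhds_zero]
  have hO : (fun h : ℝ ↦ T (f.compSubConstCLM ℂ (-((0 + h) • e))) -
      T (f.compSubConstCLM ℂ (-((0 : ℝ) • e))) - h • T (∂_{e} f)) =O[nhds 0] fun h ↦ h ^ 2 := by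
    refine Asymptotics.IsBigO.of_bound (C * B) ?_
    filter_upwards [Metric.closedBall_mem_nhds (0 : ℝ) one_pos] with h hh
    have hh1 : |h| ≤ 1 := by simpa using hh
    have e1 : T (f.compSubConstCLM ℂ (-((0 + h) • e))) -
      T (f.compSubConstCLM ℂ (-((0 : ℝ) • e))) - h • T (∂_{e} f) =
      T (f.compSubConstCLM ℂ (-(h • e)) - f - h • (∂_{e} f : 𝓢(V, ℂ))) := by
      rw [map_sub, map_sub, ContinuousLinearMap.map_smul_of_tower]
      simp
    rw [e1]
    refine (hC _).trans ?_
    rw [smul_apply, NNReal.smul_def, smul_eq_mul, mul_assoc]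
    gcongr
    refine Seminorm.finset_sup_apply_le (by positivity) fun p hp ↦ ?_
    refine (hM p h hh1).trans ?_
    rw [Real.norm_eq_abs, abs_of_nonneg (sq_nonneg h)]
    gcongr
    exact (le_abs_self _).trans
      (Finset.single_le_sum (f := fun p ↦ |M p|) (fun _ _ ↦ abs_nonneg _) hp)
  refine hO.trans_isLittleO ?_
  simpa using (Asymptotics.isLittleO_pow_pow (𝕜 := ℝ) (show 1 < 2 by norm_num))

variable {E : Type*} [NormedAddCommGroup E] [NormedSpace ℝ E]

/-- Freezing the first variable of a Schwartz function: `φ ↦ φ (x, ·)`. -/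
def slice (x : ℝ) : 𝓢(ℝ × E, ℂ) →L[ℂ] 𝓢(E, ℂ) :=
  SchwartzMap.compCLMOfAntilipschitz ℂ (g := fun y : E ↦ (x, y)) (K := 1)
    (by
      have h : (fun y : E ↦ (x, y)) =
          (fun y ↦ ContinuousLinearMap.inr ℝ ℝ E y + ContinuousLinearMap.inl ℝ ℝ E x) := by
        ext y <;> simp
      rw [h]; fun_prop)
    (AntilipschitzWith.of_le_mul_dist fun y z ↦ by simp [Prod.dist_eq])

@[simp] lemma slice_apply (x : ℝ) (φ : 𝓢(ℝ × E, ℂ)) (y : E) : slice x φ y = φ (x, y) := rfl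

lemma slice_bound (φ : 𝓢(ℝ × E, ℂ)) (x : ℝ) (j k n : ℕ) :
    ‖x‖ ^ j * SchwartzMap.seminorm ℂ k n (slice x φ) ≤ SchwartzMap.seminorm ℂ (j + k) n φ := by
  rcases eq_or_ne (‖x‖ ^ j) 0 with h0 | h0
  · rw [h0, zero_mul]; positivity
  have hpos : 0 < ‖x‖ ^ j := lt_of_le_of_ne (by positivity) (Ne.symm h0)
  rw [← le_div_iff₀' hpos]
  refine SchwartzMap.seminorm_le_bound ℂ k n _ (by positivity) fun y ↦ ?_
  rw [le_div_iff₀' hpos]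
  have hD : ‖iteratedFDeriv ℝ n (slice x φ) y‖ ≤ ‖iteratedFDeriv ℝ n φ (x, y)‖ := by
    have hf : (slice x φ : E → ℂ) =
        (fun p : ℝ × E ↦ φ (p + (x, 0))) ∘ ContinuousLinearMap.inr ℝ ℝ E := by
      ext y; simp
    have hc : ContDiff ℝ (n : ℕ∞) (fun p : ℝ × E ↦ φ (p + (x, 0))) :=
      (φ.smooth n).comp (contDiff_id.add contDiff_const)
    rw [hf, ContinuousLinearMap.iteratedFDeriv_comp_right (i := n) _ hc y le_rfl,
      iteratedFDeriv_comp_add_right]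
    refine (ContinuousMultilinearMap.norm_compContinuousLinearMap_le _ _).trans ?_
    have h1 : ‖ContinuousLinearMap.inr ℝ ℝ E‖ ≤ 1 := ContinuousLinearMap.norm_inr_le_one ℝ ℝ E
    have h2 : ∏ _i : Fin n, ‖ContinuousLinearMap.inr ℝ ℝ E‖ ≤ 1 :=
      Finset.prod_le_one (fun _ _ ↦ norm_nonneg _) fun _ _ ↦ h1
    have h3 : (ContinuousLinearMap.inr ℝ ℝ E) y + (x, 0) = (x, y) := by simp
    rw [h3]
    exact mul_le_of_le_one_right (norm_nonneg _) h2
  have hx : ‖x‖ ≤ ‖(x, y)‖ := le_max_left _ _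
  have hy : ‖y‖ ≤ ‖(x, y)‖ := le_max_right _ _
  calc ‖x‖ ^ j * (‖y‖ ^ k * ‖iteratedFDeriv ℝ n (slice x φ) y‖)
      ≤ ‖(x, y)‖ ^ j * (‖(x, y)‖ ^ k * ‖iteratedFDeriv ℝ n φ (x, y)‖) := by gcongr
    _ = ‖(x, y)‖ ^ (j + k) * ‖iteratedFDeriv ℝ n φ (x, y)‖ := by ring
    _ ≤ _ := SchwartzMap.le_seminorm ℂ (j + k) n φ (x, y)

lemma hasDerivAt_slice (T : 𝓢(E, ℂ) →L[ℂ] ℂ) (φ : 𝓢(ℝ × E, ℂ)) (x : ℝ) :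
    HasDerivAt (fun x ↦ T (slice x φ)) (T (slice x (∂_{((1 : ℝ), (0 : E))} φ))) x := by
  have h := hasDerivAt_translate (T ∘L slice x) ((1 : ℝ), (0 : E)) (by simp [Prod.norm_def]) φ
  have h1 : HasDerivAt (fun x' : ℝ ↦ x' - x) 1 x := (hasDerivAt_id x).sub_const x
  have h2 := HasDerivAt.scomp_of_eq x h h1 (by simp)
  simp only [one_smul] at h2
  have h3 : (fun x' ↦ T (slice x' φ)) = (fun h : ℝ ↦ (T ∘L slice x)
      (φ.compSubConstCLM ℂ (-(h • ((1 : ℝ), (0 : E)))))) ∘ fun x' ↦ x' - x := by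
    ext x'
    simp only [Function.comp_apply, ContinuousLinearMap.comp_apply]
    congr 1
    ext y
    simp
  rw [h3]
  exact h2

lemma iteratedDeriv_slice (T : 𝓢(E, ℂ) →L[ℂ] ℂ) (n : ℕ) (φ : 𝓢(ℝ × E, ℂ)) :
    iteratedDeriv n (fun x ↦ T (slice x φ)) =
      fun x ↦ T (slice x (∂^{fun _ : Fin n ↦ ((1 : ℝ), (0 : E))} φ)) := by
  induction n with
  | zero => simp
  | succ n ih =>
    rw [iteratedDeriv_succ, ih]
    ext x
    exact (hasDerivAt_slice T _ x).deriv

/-- The map `φ ↦ (x ↦ T (φ (x, ·)))`, continuous on Schwartz functions. -/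
def partialPairingCLM (T : 𝓢(E, ℂ) →L[ℂ] ℂ) : 𝓢(ℝ × E, ℂ) →L[ℂ] 𝓢(ℝ, ℂ) :=
  SchwartzMap.mkCLM (fun φ x ↦ T (slice x φ)) (fun φ ψ x ↦ by simp) (fun a φ x ↦ by simp)
    (fun φ ↦ by
      refine contDiff_of_differentiable_iteratedDeriv fun n _ ↦ ?_
      rw [iteratedDeriv_slice]
      exact fun x ↦ (hasDerivAt_slice T _ x).differentiableAt) <| by
  rintro ⟨j, n⟩
  have hq : Continuous ((normSeminorm ℂ ℂ).comp (T : 𝓢(E, ℂ) →ₗ[ℂ] ℂ)) :=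
    continuous_norm.comp T.continuous
  obtain ⟨s, C, -, hC⟩ := Seminorm.bound_of_continuous (schwartz_withSeminorms ℂ E ℂ) _ hq
  let D : 𝓢(ℝ × E, ℂ) →L[ℂ] 𝓢(ℝ × E, ℂ) :=
    LineDeriv.iteratedLineDerivOpCLM ℂ 𝓢(ℝ × E, ℂ) (fun _ : Fin n ↦ ((1 : ℝ), (0 : E)))
  let q : Seminorm ℂ 𝓢(ℝ × E, ℂ) :=
    (∑ p ∈ s, SchwartzMap.seminorm ℂ (j + p.1) p.2).comp (D : 𝓢(ℝ × E, ℂ) →ₗ[ℂ] 𝓢(ℝ × E, ℂ))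
  have hqa : ∀ φ, q φ = ∑ p ∈ s, SchwartzMap.seminorm ℂ (j + p.1) p.2 (D φ) := fun φ ↦ by
    simp [q, Seminorm.comp_apply]
  have hqc : Continuous q := by
    have : (q : 𝓢(ℝ × E, ℂ) → ℝ) =
        fun φ ↦ ∑ p ∈ s, SchwartzMap.seminorm ℂ (j + p.1) p.2 (D φ) := funext hqa
    rw [this]
    refine continuous_finsetSum _ fun p _ ↦ ?_
    exact ((schwartz_withSeminorms ℂ (ℝ × E) ℂ).continuous_seminorm (j + p.1, p.2)).comp
      D.continuous
  obtain ⟨s', C', -, hC'⟩ :=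
    Seminorm.bound_of_continuous (schwartz_withSeminorms ℂ (ℝ × E) ℂ) q hqc
  refine ⟨s', C * C', by positivity, fun φ x ↦ ?_⟩
  rw [norm_iteratedFDeriv_eq_norm_iteratedDeriv, iteratedDeriv_slice]
  have h1 : ‖T (slice x (D φ))‖ ≤ C * ∑ p ∈ s, SchwartzMap.seminorm ℂ p.1 p.2 (slice x (D φ)) := by
    refine (hC _).trans ?_
    rw [smul_apply, NNReal.smul_def, smul_eq_mul]
    gcongr
    refine Seminorm.finset_sup_apply_le (Finset.sum_nonneg fun _ _ ↦ apply_nonneg _ _)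
      fun p hp ↦ ?_
    exact Finset.single_le_sum
      (f := fun p : ℕ × ℕ ↦ SchwartzMap.seminorm ℂ p.1 p.2 (slice x (D φ)))
      (fun _ _ ↦ apply_nonneg _ _) hp
  have h2 : q φ ≤ C' * (s'.sup (schwartzSeminormFamily ℂ (ℝ × E) ℂ)) φ := by
    have := hC' φ
    rwa [smul_apply, NNReal.smul_def, smul_eq_mul] at this
  calc ‖x‖ ^ j * ‖T (slice x (D φ))‖
      ≤ ‖x‖ ^ j * (C * ∑ p ∈ s, SchwartzMap.seminorm ℂ p.1 p.2 (slice x (D φ))) := by gcongr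
    _ = C * ∑ p ∈ s, ‖x‖ ^ j * SchwartzMap.seminorm ℂ p.1 p.2 (slice x (D φ)) := by
        rw [← Finset.mul_sum]; ring
    _ ≤ C * q φ := by
        rw [hqa]
        gcongr with p hp
        exact slice_bound _ _ _ _ _
    _ ≤ C * (C' * (s'.sup (schwartzSeminormFamily ℂ (ℝ × E) ℂ)) φ) := by gcongr
    _ = _ := by ring

/-- The map `φ ↦ (x ↦ ⟨T(y), φ(x, y)⟩)` for a tempered distribution `T`. -/
def partialPairing (T : 𝓢'(E, ℂ)) : 𝓢(ℝ × E, ℂ) →L[ℂ] 𝓢(ℝ, ℂ) := partialPairingCLM T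

lemma partialPairing_apply (T : 𝓢'(E, ℂ)) (φ : 𝓢(ℝ × E, ℂ)) (x : ℝ) :
    partialPairing T φ x = T (slice x φ) := rfl

/-- The tensor product `S ⊗ T` of tempered distributions,
`⟨S ⊗ T, φ⟩ = ⟨S(x), ⟨T(y), φ(x, y)⟩⟩`. -/
def tensorProduct (S : 𝓢'(ℝ, ℂ)) (T : 𝓢'(E, ℂ)) : 𝓢'(ℝ × E, ℂ) :=
  PointwiseConvergenceCLM.precomp ℂ (partialPairing T) S

lemma tensorProduct_apply (S : 𝓢'(ℝ, ℂ)) (T : 𝓢'(E, ℂ)) (φ : 𝓢(ℝ × E, ℂ)) :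
    tensorProduct S T φ = S (partialPairing T φ) := rfl

end Tensor

section Cutoff

/-- A smooth cutoff: `χ t = 0` for `t ≤ -2` and `χ t = 1` for `t ≥ -1`. -/
def cutoff (t : ℝ) : ℝ := Real.smoothTransition (t + 2)

lemma cutoff_eq_zero {t : ℝ} (ht : t ≤ -2) : cutoff t = 0 :=
  Real.smoothTransition.zero_of_nonpos (by linarith)

lemma cutoff_eq_one {t : ℝ} (ht : -1 ≤ t) : cutoff t = 1 :=
  Real.smoothTransition.one_of_one_le (by linarith)

lemma contDiff_cutoff {n : ℕ∞} : ContDiff ℝ n cutoff :=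
  Real.smoothTransition.contDiff.comp (contDiff_id.add contDiff_const)

@[fun_prop] lemma hasTemperateGrowth_cutoff : cutoff.HasTemperateGrowth := by
  have hc : ContDiff ℝ (⊤ : ℕ∞) cutoff := contDiff_cutoff
  refine .of_fderiv (k := 0) (C := 1) (HasCompactSupport.hasTemperateGrowth ?_ ?_)
    (hc.differentiable (by simp)) fun t ↦ ?_
  · refine HasCompactSupport.of_support_subset_isCompact (isCompact_Icc (a := (-2 : ℝ)) (b := -1))
      fun t ht ↦ ?_
    by_contra hcon
    apply ht
    rw [Set.mem_Icc, not_and_or, not_le, not_le] at hcon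
    rcases hcon with h | h
    · have : cutoff =ᶠ[nhds t] fun _ ↦ 0 := by
        filter_upwards [Iio_mem_nhds h] with r hr using cutoff_eq_zero hr.le
      rw [this.fderiv_eq]; simp
    · have : cutoff =ᶠ[nhds t] fun _ ↦ 1 := by
        filter_upwards [Ioi_mem_nhds h] with r hr using cutoff_eq_one hr.le
      rw [this.fderiv_eq]; simp
  · exact hc.fderiv_right (by simp)
  · simp only [pow_zero, mul_one, Real.norm_eq_abs, cutoff]
    rw [abs_of_nonneg (Real.smoothTransition.nonneg _)]
    exact Real.smoothTransition.le_one _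

end Cutoff

section Laplace

/-- The Schwartz function `t ↦ χ(t) e^{-st}`, which equals `e^{-st}` for `t ≥ -1`. -/
def expTest (s : ℂ) (hs : 0 < s.re) : 𝓢(ℝ, ℂ) where
  toFun t := (cutoff t : ℂ) * Complex.exp (-s * t)
  smooth' := by
    have h1 : ContDiff ℝ (⊤ : ℕ∞) (fun t : ℝ ↦ (cutoff t : ℂ)) :=
      Complex.ofRealCLM.contDiff.comp contDiff_cutoff
    have h2 : ContDiff ℝ (⊤ : ℕ∞) (fun t : ℝ ↦ Complex.exp (-s * t)) :=
      (contDiff_const.mul Complex.ofRealCLM.contDiff).cexp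
    exact h1.mul h2
  decay' k n := by
    set f : ℝ → ℂ := fun t ↦ (cutoff t : ℂ) * Complex.exp (-s * t) with hf
    have hfc : ContDiff ℝ (⊤ : ℕ∞) f := by
      have h1 : ContDiff ℝ (⊤ : ℕ∞) (fun t : ℝ ↦ (cutoff t : ℂ)) :=
        Complex.ofRealCLM.contDiff.comp contDiff_cutoff
      exact h1.mul ((contDiff_const.mul Complex.ofRealCLM.contDiff).cexp)
    simp only [norm_iteratedFDeriv_eq_norm_iteratedDeriv]
    have hcont : Continuous fun t ↦ ‖t‖ ^ k * ‖iteratedDeriv n f t‖ :=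
      (continuous_norm.pow k).mul (hfc.continuous_iteratedDeriv n (by exact_mod_cast le_top)).norm
    obtain ⟨C, hC⟩ := (isCompact_Icc (a := (-3 : ℝ)) (b := 0)).exists_bound_of_continuousOn
      hcont.continuousOn
    refine ⟨max C (‖s‖ ^ n * (k.factorial / s.re ^ k)), fun t ↦ ?_⟩
    rcases lt_or_ge t (-2) with ht | ht
    · have : f =ᶠ[nhds t] fun _ ↦ 0 := by
        filter_upwards [Iio_mem_nhds ht] with r hr
        simp [hf, cutoff_eq_zero (le_of_lt hr)]
      rw [this.iteratedDeriv_eq]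
      simp only [iteratedDeriv_const]
      refine le_max_of_le_right ?_
      have : (0 : ℝ) ≤ ‖s‖ ^ n * (k.factorial / s.re ^ k) := by positivity
      split_ifs <;> simpa using this
    rcases le_or_gt t 0 with h0 | h0
    · refine le_max_of_le_left ((le_abs_self _).trans ?_)
      simpa using hC t ⟨by linarith, h0⟩
    · refine le_max_of_le_right ?_
      have : f =ᶠ[nhds t] fun t : ℝ ↦ Complex.exp (-s * t) := by
        filter_upwards [Ioi_mem_nhds h0] with r hr
        have : (0 : ℝ) < r := hr
        simp [hf, cutoff_eq_one (by linarith : -1 ≤ r)]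
      have hexp : ∀ n : ℕ, iteratedDeriv n (fun t : ℝ ↦ Complex.exp (-s * t)) =
          fun t : ℝ ↦ (-s) ^ n * Complex.exp (-s * t) := by
        intro n
        induction n with
        | zero => simp
        | succ n ih =>
          rw [iteratedDeriv_succ, ih]
          ext r
          have h1 : HasDerivAt (fun r : ℝ ↦ -s * (r : ℂ)) (-s) r := by
            simpa using (Complex.ofRealCLM.hasDerivAt (x := r)).const_mul (-s)
          rw [((h1.cexp).const_mul ((-s) ^ n)).deriv]
          ring
      rw [this.iteratedDeriv_eq, hexp, norm_mul, norm_pow, norm_neg, Complex.norm_exp]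
      have hre : (-s * (t : ℂ)).re = -(s.re * t) := by simp
      rw [hre, Real.norm_eq_abs, abs_of_pos h0]
      have hst : 0 < s.re * t := mul_pos hs h0
      have hpow := Real.pow_div_factorial_le_exp (s.re * t) hst.le k
      have h3 : t ^ k * Real.exp (-(s.re * t)) ≤ k.factorial / s.re ^ k := by
        rw [Real.exp_neg, ← div_eq_mul_inv, div_le_div_iff₀ (Real.exp_pos _) (by positivity)]
        rw [div_le_iff₀ (by positivity), mul_pow] at hpow
        linarith
      calc t ^ k * (‖s‖ ^ n * Real.exp (-(s.re * t)))
          = ‖s‖ ^ n * (t ^ k * Real.exp (-(s.re * t))) := by ring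
        _ ≤ _ := by gcongr

lemma expTest_apply (s : ℂ) (hs : 0 < s.re) (t : ℝ) :
    expTest s hs t = (cutoff t : ℂ) * Complex.exp (-s * t) := rfl

/-- The Laplace transform `⟨u(t), e^{-st}⟩`, `Re s > 0`, of a tempered distribution `u` that
vanishes on `(-∞, 0)`; the cutoff only changes `e^{-st}` away from the support of `u`. -/
def laplaceTransform (u : 𝓢'(ℝ, ℂ)) (s : ℂ) (hs : 0 < s.re) : ℂ := u (expTest s hs)

/-- `u` is the inverse Laplace transform, in the space of tempered distributions on `ℝ` vanishing
on `(-∞, 0)`, of the function `F` on the half plane `Re s > 0`. -/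
structure IsInverseLaplace (F : ℂ → ℂ) (u : 𝓢'(ℝ, ℂ)) : Prop where
  vanishes : IsVanishingOn u (Set.Iio (0 : ℝ))
  laplace_eq : ∀ (s : ℂ) (hs : 0 < s.re), laplaceTransform u s hs = F s

end Laplace

section Convolution

/-- An auxiliary change of variable: `fold t = t` for `t ≥ -2` and `fold t = -t` for `t ≤ -3`. -/
def fold (t : ℝ) : ℝ := (2 * cutoff (t + 1) - 1) * t

lemma fold_eq {t : ℝ} (ht : -2 ≤ t) : fold t = t := by
  rw [fold, cutoff_eq_one (by linarith)]; ring

lemma abs_le_fold (t : ℝ) : |t| ≤ fold t + 6 := by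
  rcases le_total (-2) t with h | h
  · rw [fold_eq h]; rcases abs_cases t with h' | h' <;> linarith
  rcases le_total t (-3) with h' | h'
  · rw [fold, cutoff_eq_zero (by linarith), abs_of_nonpos (by linarith)]; linarith
  · have h0 : 0 ≤ cutoff (t + 1) := Real.smoothTransition.nonneg _
    have h1 : cutoff (t + 1) ≤ 1 := Real.smoothTransition.le_one _
    rw [fold, abs_of_nonpos (by linarith)]
    nlinarith

@[fun_prop] lemma hasTemperateGrowth_fold : fold.HasTemperateGrowth := by
  have h : (fun t : ℝ ↦ cutoff (t + 1)).HasTemperateGrowth :=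
    hasTemperateGrowth_cutoff.comp (by fun_prop)
  unfold fold
  fun_prop

lemma hasTemperateGrowth_shear :
    (fun p : ℝ × (ℝ × ℝ) ↦ (p.2.1, fold p.2.2 + fold p.1)).HasTemperateGrowth := by
  have h1 : (fun p : ℝ × (ℝ × ℝ) ↦ fold p.2.2).HasTemperateGrowth :=
    hasTemperateGrowth_fold.comp
      (ContinuousLinearMap.snd ℝ ℝ ℝ ∘L ContinuousLinearMap.snd ℝ ℝ (ℝ × ℝ)).hasTemperateGrowth
  have h2 : (fun p : ℝ × (ℝ × ℝ) ↦ fold p.1).HasTemperateGrowth :=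
    hasTemperateGrowth_fold.comp (ContinuousLinearMap.fst ℝ ℝ (ℝ × ℝ)).hasTemperateGrowth
  have h3 := (ContinuousLinearMap.inl ℝ ℝ ℝ ∘L ContinuousLinearMap.fst ℝ ℝ ℝ ∘L
    ContinuousLinearMap.snd ℝ ℝ (ℝ × ℝ)).hasTemperateGrowth
  have h4 := (ContinuousLinearMap.inr ℝ ℝ ℝ).hasTemperateGrowth.comp (h1.add h2)
  convert h3.add h4 using 1
  ext p <;> simp

lemma hasTemperateGrowth_cutoff_mul :
    (fun p : ℝ × (ℝ × ℝ) ↦ (cutoff p.1 : ℂ) * (cutoff p.2.2 : ℂ)).HasTemperateGrowth := by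
  have h0 := Function.HasTemperateGrowth.comp Complex.ofRealCLM.hasTemperateGrowth
    hasTemperateGrowth_cutoff
  have h1 : (fun p : ℝ × (ℝ × ℝ) ↦ (cutoff p.1 : ℂ)).HasTemperateGrowth :=
    h0.comp (ContinuousLinearMap.fst ℝ ℝ (ℝ × ℝ)).hasTemperateGrowth
  have h2 : (fun p : ℝ × (ℝ × ℝ) ↦ (cutoff p.2.2 : ℂ)).HasTemperateGrowth :=
    h0.comp
      (ContinuousLinearMap.snd ℝ ℝ ℝ ∘L ContinuousLinearMap.snd ℝ ℝ (ℝ × ℝ)).hasTemperateGrowth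
  exact h1.mul h2

/-- The map sending `φ(x, t)` to the Schwartz function `χ(τ) χ(t) φ(x, t + τ)` of `(τ, (x, t))`
(see `convTest_apply`). -/
def convTest : 𝓢(ℝ × ℝ, ℂ) →L[ℂ] 𝓢(ℝ × (ℝ × ℝ), ℂ) :=
  SchwartzMap.smulLeftCLM ℂ
      (fun p : ℝ × (ℝ × ℝ) ↦ (cutoff p.1 : ℂ) * (cutoff p.2.2 : ℂ)) ∘L
    SchwartzMap.compCLM ℂ (g := fun p : ℝ × (ℝ × ℝ) ↦ (p.2.1, fold p.2.2 + fold p.1))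
      hasTemperateGrowth_shear
      ⟨1, 12, fun p ↦ by
        have h1 := abs_le_fold p.1
        have h2 := abs_le_fold p.2.2
        have h3 : |p.2.1| ≤ ‖(p.2.1, fold p.2.2 + fold p.1)‖ := le_max_left _ _
        have h4 : fold p.2.2 + fold p.1 ≤ ‖(p.2.1, fold p.2.2 + fold p.1)‖ :=
          (le_abs_self _).trans (le_max_right _ _)
        rw [pow_one]
        have h5 := abs_nonneg p.1
        have h6 := abs_nonneg p.2.2
        have h7 := norm_nonneg (p.2.1, fold p.2.2 + fold p.1)
        refine max_le ?_ (max_le ?_ ?_) <;> rw [Real.norm_eq_abs] <;> linarith⟩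

lemma convTest_apply (φ : 𝓢(ℝ × ℝ, ℂ)) (τ x t : ℝ) :
    convTest φ (τ, (x, t)) = (cutoff τ : ℂ) * (cutoff t : ℂ) * φ (x, t + τ) := by
  rw [convTest, ContinuousLinearMap.comp_apply,
    SchwartzMap.smulLeftCLM_apply_apply hasTemperateGrowth_cutoff_mul, SchwartzMap.compCLM_apply]
  simp only [Function.comp_apply, smul_eq_mul]
  rcases le_total τ (-2) with h1 | h1
  · simp [cutoff_eq_zero h1]
  rcases le_total t (-2) with h2 | h2
  · simp [cutoff_eq_zero h2]
  rw [fold_eq h1, fold_eq h2]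

/-- The convolution in time `L ∗ₜ w` of `L ∈ 𝓢'(ℝ)` and `w ∈ 𝓢'(ℝ²)` that vanish for negative
times: `⟨L ∗ₜ w, φ⟩ = ⟨L(τ) ⊗ w(x, t), φ(x, t + τ)⟩`. The cutoffs in `convTest` only change the
test function away from the support of `L ⊗ w`. -/
def timeConv (L : 𝓢'(ℝ, ℂ)) (w : 𝓢'(ℝ × ℝ, ℂ)) : 𝓢'(ℝ × ℝ, ℂ) :=
  PointwiseConvergenceCLM.precomp ℂ convTest (tensorProduct L w)

lemma timeConv_apply (L : 𝓢'(ℝ, ℂ)) (w : 𝓢'(ℝ × ℝ, ℂ)) (φ : 𝓢(ℝ × ℝ, ℂ)) :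
    timeConv L w φ = L (partialPairing w (convTest φ)) := rfl

end Convolution

section Model

/-- `Φ(s) = ∫ s^α dμ(α)` for a measure on `[0, 1]`, with the principal branch of the power. -/
def Phi (μ : Measure unitInterval) (s : ℂ) : ℂ := ∫ α, s ^ ((α : ℝ) : ℂ) ∂μ

/-- The triangle `{(α, β) ∈ [0, 1]² : α > β}`. -/
def triangle : Set (unitInterval × unitInterval) := {p | p.2 < p.1}

/-- The thermodynamical restriction: the signed measure `μ_ε × μ_σ - μ_σ × μ_ε` is non-negative
on the triangle. -/
def ThermodynamicalRestriction (μσ με : Measure unitInterval)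
    [IsFiniteMeasure μσ] [IsFiniteMeasure με] : Prop :=
  0 ≤[triangle] ((με.prod μσ).toSignedMeasure - (μσ.prod με).toSignedMeasure)

/-- `u ∈ 𝓢'(ℝ × ℝ₊)` solves the Cauchy problem `∂ₜ² u = L ∗ₜ ∂ₓ² u`, `u(x, 0) = u₀(x)`,
`∂ₜ u(x, 0) = v₀(x)` in the sense of distributions: points of `ℝ × ℝ` are `(x, t)`, `u` vanishes
for `t < 0`, and `∂ₜ² u - L ∗ₜ ∂ₓ² u = u₀(x) δ'(t) + v₀(x) δ(t)` on `ℝ²`. -/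
structure IsCauchySolution (L : 𝓢'(ℝ, ℂ)) (u₀ v₀ : 𝓢'(ℝ, ℂ)) (u : 𝓢'(ℝ × ℝ, ℂ)) : Prop where
  vanishes : IsVanishingOn u {p : ℝ × ℝ | p.2 < 0}
  equation :
    (∂_{((0 : ℝ), (1 : ℝ))} (∂_{((0 : ℝ), (1 : ℝ))} u) : 𝓢'(ℝ × ℝ, ℂ)) -
        timeConv L (∂_{((1 : ℝ), (0 : ℝ))} (∂_{((1 : ℝ), (0 : ℝ))} u)) =
      tensorProduct u₀ (TemperedDistribution.derivCLM ℂ (TemperedDistribution.delta 0)) +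
        tensorProduct v₀ (TemperedDistribution.delta 0)

end Model

end ViscoWave

end

/-! Test the equation on products `ψ(x) e^{-st}`, that is, take the Laplace transform in time. With
`b(s) = Φ_ε(s) / (s Φ_σ(s))` it becomes `s² û - s b(s) ∂ₓ² û = s u₀ + v₀` for every `s` in the right
half plane (`isCauchySolution_iff`), and a Fourier transform in `x` turns the operator on the left
into multiplication by `s (s + 4π²ξ² b(s))`. The solution should therefore have the symbols `1 / (s
+ 4π²ξ² b)` acting on `u₀` and `s⁻¹ / (s + 4π²ξ² b)` acting on `v₀`.

The physics enters through `Re b ≥ 0` (`ThermodynamicalRestriction.re_nonneg`). In polar coordinates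
`Re (Φ_ε · conj Φ_σ · conj s)` is the integral of `r^(α+β+1) cos((α-β-1)θ)` against `μ_ε × μ_σ`,
with `|θ| < π/2`. On the triangle the kernel is nonnegative, and its sum with its reflection is a
multiple of `cos((α-β)θ) cos θ ≥ 0`; condition (T) is what allows the triangle and its reflection to
be compared. Hence `|s + 4π²ξ² b(s)| ≥ Re s`, uniformly in `ξ`.

The analytic engine is `exists_isInverseLaplace`: a holomorphic function on the half plane bounded
by `C (1 + 1/Re s)^M` is the Laplace transform of a tempered distribution on the half line, with
seminorm bounds depending only on `M` and linear in `C`. It applies to `b`, because `Φ_σ` has no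
cancellation on the half plane (`le_norm_Phi`), and `L` is the derivative of the original of `b`. It
applies to the symbols uniformly in `ξ`. Differentiation in `ξ` stays inside the family `F₀ bⁿ / (s
+ 4π²ξ² b)ⁿ⁺¹`, so the symbols define continuous operators on Schwartz test functions
(`exists_resolventOperator`), and the solution is obtained by composing `u₀` and `v₀` with them.

Uniqueness is by duality. The operator for `v₀` gives, for each `ψ` and `s`, a Schwartz function `θ`
with `s² θ - s b θ'' = ψ`; testing the equation on `θ(x) e^{-st}` gives the value of `u` on `ψ(x)
e^{-st}`. Such values determine a tempered distribution that vanishes for `t < 0`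
(`eq_zero_of_tensorFun_expTest`), which rests on the injectivity of the Laplace transform and the
density of tensor products. -/

noncomputable section

namespace ViscoWave

/-! ### Integrating a Schwartz function over its first variable -/

section PartialIntegral

universe u

variable {E F : Type u} [NormedAddCommGroup E] [NormedSpace ℝ E]
  [NormedAddCommGroup F] [NormedSpace ℝ F]

lemma schwartz_norm_le_inv_one_add_sq (Φ : 𝓢(ℝ × E, F)) :
    ∃ C : ℝ, ∀ (x : ℝ) (y : E), ‖Φ (x, y)‖ ≤ C * (1 + x ^ 2)⁻¹ := by
  refine ⟨SchwartzMap.seminorm ℝ 0 0 Φ + SchwartzMap.seminorm ℝ 2 0 Φ, fun x y ↦ ?_⟩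
  rw [← div_eq_mul_inv, le_div_iff₀ (by positivity)]
  have h0 := SchwartzMap.le_seminorm ℝ 0 0 Φ (x, y)
  have h2 := SchwartzMap.le_seminorm ℝ 2 0 Φ (x, y)
  simp only [pow_zero, one_mul, norm_iteratedFDeriv_zero] at h0 h2
  have hx : x ^ 2 ≤ ‖(x, y)‖ ^ 2 := by
    rw [← sq_abs x]; gcongr; exact le_max_left _ _
  nlinarith [norm_nonneg (Φ (x, y))]

lemma integrable_schwartz_fst (Φ : 𝓢(ℝ × E, F)) (y : E) :
    Integrable (fun x : ℝ ↦ Φ (x, y)) := by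
  obtain ⟨C, hC⟩ := schwartz_norm_le_inv_one_add_sq Φ
  refine (integrable_inv_one_add_sq.const_mul C).mono' ?_ (.of_forall fun x ↦ hC x y)
  exact (Φ.continuous.comp (by fun_prop)).aestronglyMeasurable

/-- The derivative of a Schwartz function on `ℝ × E` in the second variable. -/
def fderivSnd (Φ : 𝓢(ℝ × E, F)) : 𝓢(ℝ × E, E →L[ℝ] F) :=
  (SchwartzMap.fderivCLM ℝ (ℝ × E) F Φ).postcompCLM
    ((ContinuousLinearMap.compL ℝ E (ℝ × E) F).flip (ContinuousLinearMap.inr ℝ ℝ E))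

lemma hasFDerivAt_schwartz_snd (Φ : 𝓢(ℝ × E, F)) (x : ℝ) (y : E) :
    HasFDerivAt (fun y ↦ Φ (x, y)) (fderivSnd Φ (x, y)) y := by
  have h : HasFDerivAt (fun y : E ↦ (x, y)) (ContinuousLinearMap.inr ℝ ℝ E) y :=
    hasFDerivAt_prodMk_right x y
  exact (Φ.hasFDerivAt (x, y)).comp y h

lemma hasFDerivAt_integral_schwartz (Φ : 𝓢(ℝ × E, F)) (y : E) :
    HasFDerivAt (fun y ↦ ∫ x : ℝ, Φ (x, y)) (∫ x : ℝ, fderivSnd Φ (x, y)) y := by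
  obtain ⟨C, hC⟩ := schwartz_norm_le_inv_one_add_sq (fderivSnd Φ)
  exact hasFDerivAt_integral_of_dominated_of_fderiv_le (s := Set.univ) Filter.univ_mem
    (.of_forall fun y ↦ (integrable_schwartz_fst Φ y).aestronglyMeasurable)
    (integrable_schwartz_fst Φ y) (integrable_schwartz_fst (fderivSnd Φ) y).aestronglyMeasurable
    (.of_forall fun x y _ ↦ hC x y) (integrable_inv_one_add_sq.const_mul C)
    (.of_forall fun x y _ ↦ hasFDerivAt_schwartz_snd Φ x y)

/-- Differentiating under the integral replaces `Φ` by `fderivSnd Φ`, whose values lie in `E →L[ℝ]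
F`. The induction therefore varies `F`, and `E` and `F` share a universe to allow this. -/
lemma contDiff_integral_schwartz (n : ℕ) (Φ : 𝓢(ℝ × E, F)) :
    ContDiff ℝ n (fun y ↦ ∫ x : ℝ, Φ (x, y)) := by
  induction n generalizing F with
  | zero =>
    exact contDiff_zero.2 (continuous_iff_continuousAt.2
      fun y ↦ (hasFDerivAt_integral_schwartz Φ y).continuousAt)
  | succ n ih =>
    rw [Nat.cast_add, Nat.cast_one, contDiff_succ_iff_fderiv]
    refine ⟨fun y ↦ (hasFDerivAt_integral_schwartz Φ y).differentiableAt, by simp, ?_⟩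
    convert ih (fderivSnd Φ) using 1
    ext1 y
    exact (hasFDerivAt_integral_schwartz Φ y).fderiv

lemma iteratedFDeriv_integral_schwartz (n : ℕ) (Φ : 𝓢(ℝ × E, F)) (y : E) :
    iteratedFDeriv ℝ n (fun y ↦ ∫ x : ℝ, Φ (x, y)) y =
      ∫ x : ℝ, iteratedFDeriv ℝ n (fun y ↦ Φ (x, y)) y := by
  induction n generalizing F with
  | zero =>
    simp only [iteratedFDeriv_zero_eq_comp, Function.comp_apply]
    exact (ContinuousLinearEquiv.integral_comp_comm
      (continuousMultilinearCurryFin0 ℝ E F).symm.toContinuousLinearEquiv _).symm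
  | succ n ih =>
    simp only [iteratedFDeriv_succ_eq_comp_right, Function.comp_apply]
    have h1 : (fun y ↦ fderiv ℝ (fun y ↦ ∫ x : ℝ, Φ (x, y)) y) =
        fun y ↦ ∫ x : ℝ, fderivSnd Φ (x, y) :=
      funext fun y ↦ (hasFDerivAt_integral_schwartz Φ y).fderiv
    have h2 : ∀ x, (fun y ↦ fderiv ℝ (fun y ↦ Φ (x, y)) y) = fun y ↦ fderivSnd Φ (x, y) :=
      fun x ↦ funext fun y ↦ (hasFDerivAt_schwartz_snd Φ x y).fderiv
    simp only [h1, h2]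
    rw [ih]
    let L : (ContinuousMultilinearMap ℝ (fun _ : Fin n ↦ E) (E →L[ℝ] F)) ≃L[ℝ]
        (ContinuousMultilinearMap ℝ (fun _ : Fin (n + 1) ↦ E) F) :=
      (continuousMultilinearCurryRightEquiv' ℝ n E F).symm.toContinuousLinearEquiv
    exact (ContinuousLinearEquiv.integral_comp_comm (𝕜 := ℝ)
      (E := ContinuousMultilinearMap ℝ (fun _ : Fin n ↦ E) (E →L[ℝ] F))
      (F := ContinuousMultilinearMap ℝ (fun _ : Fin (n + 1) ↦ E) F) (μ := volume) L
      fun x : ℝ ↦ iteratedFDeriv ℝ n (fun y ↦ fderivSnd Φ (x, y)) y).symm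

end PartialIntegral

/-! ### Tempered distributions commute with parameter integrals -/

section Fubini

variable {E : Type} [NormedAddCommGroup E] [NormedSpace ℝ E]

/-- The sum of the cases `j = 0` and `j = 2` of `slice_bound`. It gives decay in `x` that is
integrable, with total integral `π`. -/
lemma seminorm_slice_le (φ : 𝓢(ℝ × E, ℂ)) (x : ℝ) (k n : ℕ) :
    SchwartzMap.seminorm ℂ k n (slice x φ) ≤
      (SchwartzMap.seminorm ℂ k n φ + SchwartzMap.seminorm ℂ (2 + k) n φ) * (1 + x ^ 2)⁻¹ := by
  rw [← div_eq_mul_inv, le_div_iff₀ (by positivity)]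
  have h0 := slice_bound φ x 0 k n
  have h2 := slice_bound φ x 2 k n
  rw [pow_zero, one_mul, zero_add] at h0
  rw [Real.norm_eq_abs, sq_abs] at h2
  linarith

/-- The Schwartz function `y ↦ ∫ φ(x, y) dx`. -/
def integralFst (φ : 𝓢(ℝ × E, ℂ)) : 𝓢(E, ℂ) where
  toFun y := ∫ x : ℝ, φ (x, y)
  smooth' := contDiff_infty.2 fun n ↦ contDiff_integral_schwartz n φ
  decay' k n := by
    refine ⟨(SchwartzMap.seminorm ℂ k n φ + SchwartzMap.seminorm ℂ (2 + k) n φ) * Real.pi,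
      fun y ↦ ?_⟩
    rw [iteratedFDeriv_integral_schwartz, ← integral_univ_inv_one_add_sq, ← integral_const_mul,
      ← abs_of_nonneg (show 0 ≤ ‖y‖ ^ k by positivity), ← Real.norm_eq_abs, ← norm_smul,
      ← integral_smul]
    refine norm_integral_le_of_norm_le (integrable_inv_one_add_sq.const_mul _)
      (.of_forall fun x ↦ ?_)
    rw [norm_smul, norm_pow, norm_norm]
    exact (SchwartzMap.le_seminorm ℂ k n (slice x φ) y).trans (seminorm_slice_le φ x k n)

lemma integralFst_apply (φ : 𝓢(ℝ × E, ℂ)) (y : E) : integralFst φ y = ∫ x : ℝ, φ (x, y) := rfl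

/-- Moving `x` amounts to translating `φ` in its first variable before slicing at a fixed point, and
translations are continuous at `0` by the Taylor estimate `translate_seminorm_le`. -/
lemma continuous_slice (φ : 𝓢(ℝ × E, ℂ)) : Continuous fun x : ℝ ↦ slice x φ := by
  have key : Filter.Tendsto (fun h : ℝ ↦ φ.compSubConstCLM ℂ (-(h • ((1 : ℝ), (0 : E)))))
      (nhds 0) (nhds φ) := by
    rw [(schwartz_withSeminorms ℂ (ℝ × E) ℂ).tendsto_nhds]
    rintro ⟨k, n⟩ ε hε
    obtain ⟨M, hM⟩ := translate_seminorm_le ((1 : ℝ), (0 : E)) (by simp [Prod.norm_def]) φ k n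
    set N := SchwartzMap.seminorm ℂ k n (∂_{((1 : ℝ), (0 : E))} φ)
    have hlim : Filter.Tendsto (fun h : ℝ ↦ M * h ^ 2 + |h| * N) (nhds 0) (nhds 0) := by
      have : Continuous fun h : ℝ ↦ M * h ^ 2 + |h| * N := by fun_prop
      simpa using this.tendsto 0
    filter_upwards [hlim.eventually (gt_mem_nhds hε),
      Metric.closedBall_mem_nhds (0 : ℝ) one_pos] with h hh h1
    refine lt_of_le_of_lt ?_ hh
    have e : φ.compSubConstCLM ℂ (-(h • ((1 : ℝ), (0 : E)))) - φ =
        (φ.compSubConstCLM ℂ (-(h • ((1 : ℝ), (0 : E)))) - φ -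
          h • (∂_{((1 : ℝ), (0 : E))} φ : 𝓢(ℝ × E, ℂ))) +
          (h : ℂ) • (∂_{((1 : ℝ), (0 : E))} φ : 𝓢(ℝ × E, ℂ)) := by
      ext y; simp
    rw [SchwartzMap.schwartzSeminormFamily_apply, e]
    refine (map_add_le_add _ _ _).trans (add_le_add (hM h (by simpa using h1)) ?_)
    rw [map_smul_eq_mul, Complex.norm_real, Real.norm_eq_abs]
  rw [continuous_iff_continuousAt]
  intro x
  have h1 : Filter.Tendsto (fun x' : ℝ ↦ x' - x) (nhds x) (nhds 0) := by
    have : Continuous fun x' : ℝ ↦ x' - x := by fun_prop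
    simpa using this.tendsto x
  have h2 := ((slice x : 𝓢(ℝ × E, ℂ) →L[ℂ] 𝓢(E, ℂ)).continuous.tendsto φ).comp (key.comp h1)
  refine h2.congr fun x' ↦ ?_
  ext y
  simp

/-- A linear form on a vector space `S`, bounded by finitely many seminorms that are sup norms of
function-valued linear maps `D i`, commutes with an integral in `S` that is defined pointwise. -/
theorem apply_eq_integral_of_seminorms {S X ι : Type*} [AddCommGroup S] [Module ℂ S]
    [TopologicalSpace X] [Fintype ι] {M : ι → Type*} [∀ i, NormedAddCommGroup (M i)]
    [∀ i, NormedSpace ℂ (M i)] [∀ i, CompleteSpace (M i)] (D : ∀ i, S →ₗ[ℂ] (X → M i))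
    (p : ι → S → ℝ) (hp : ∀ i φ, 0 ≤ p i φ) (hD : ∀ i φ, Continuous (D i φ))
    (hle : ∀ i φ y, ‖D i φ y‖ ≤ p i φ)
    (hge : ∀ i φ A, 0 ≤ A → (∀ y, ‖D i φ y‖ ≤ A) → p i φ ≤ A) (T : S →ₗ[ℂ] ℂ) (C : ℝ)
    (hT : ∀ φ A, 0 ≤ A → (∀ i, p i φ ≤ A) → ‖T φ‖ ≤ C * A) (g : ℝ → S)
    (hg : ∀ i x, Filter.Tendsto (fun x' ↦ p i (g x' - g x)) (nhds x) (nhds 0)) (B : ι → ℝ)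
    (hB : ∀ i x, p i (g x) ≤ B i * (1 + x ^ 2)⁻¹) (Φ : S)
    (hΦ : ∀ i y, D i Φ y = ∫ x : ℝ, D i (g x) y) : T Φ = ∫ x : ℝ, T (g x) := by
  -- The space `S` carries no norm, so the integral is taken in a finite product of Banach spaces of
  -- bounded continuous functions. The bound `hJ` makes `T` factor through the range of `J`.
  let J : S →ₗ[ℂ] ((i : ι) → BoundedContinuousFunction X (M i)) :=
    { toFun := fun φ i ↦ BoundedContinuousFunction.ofNormedAddCommGroup (D i φ) (hD i φ) (p i φ)
        (hle i φ)
      map_add' := fun φ ψ ↦ by funext i; ext1 y; simp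
      map_smul' := fun c φ ↦ by funext i; ext1 y; simp }
  have hJa : ∀ φ i y, J φ i y = D i φ y := fun _ _ _ ↦ rfl
  have hJle : ∀ φ i, ‖J φ i‖ ≤ p i φ := fun φ i ↦
    (BoundedContinuousFunction.norm_le (hp i φ)).2 (hle i φ)
  have hJ : ∀ φ, ‖T φ‖ ≤ C * ‖J φ‖ := fun φ ↦ hT φ _ (norm_nonneg _) fun i ↦
    hge i φ _ (norm_nonneg _) fun y ↦
      ((J φ i).norm_coe_le_norm y).trans (norm_le_pi_norm (J φ) i)
  have hker : LinearMap.ker J ≤ LinearMap.ker T := by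
    intro φ hφ
    have := hJ φ
    rw [LinearMap.mem_ker.1 hφ, norm_zero, mul_zero, norm_le_zero_iff] at this
    exact this
  let ℓ₀ : LinearMap.range J →ₗ[ℂ] ℂ :=
    ((LinearMap.ker J).liftQ T hker) ∘ₗ J.quotKerEquivRange.symm.toLinearMap
  have hℓ₀ : ∀ φ, ℓ₀ ⟨J φ, φ, rfl⟩ = T φ := fun φ ↦ by
    have : J.quotKerEquivRange.symm ⟨J φ, φ, rfl⟩ = (LinearMap.ker J).mkQ φ := by
      rw [LinearEquiv.symm_apply_eq]; rfl
    simp [ℓ₀, this]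
  -- Hahn-Banach: the integral of `J (g x)` is formed in the full product space, so the functional
  -- must be defined beyond the range of `J`.
  obtain ⟨ℓ, hℓ, -⟩ := exists_extension_norm_eq (LinearMap.range J)
    (ℓ₀.mkContinuous C (by
      rintro ⟨-, φ, rfl⟩
      rw [hℓ₀]
      exact hJ φ))
  have hTℓ : ∀ φ, T φ = ℓ (J φ) := fun φ ↦ by
    have := hℓ ⟨J φ, φ, rfl⟩
    rw [this]
    exact (hℓ₀ φ).symm
  have hcont : Continuous fun x : ℝ ↦ J (g x) := by
    refine continuous_pi fun i ↦ continuous_iff_continuousAt.2 fun x ↦ ?_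
    refine tendsto_iff_norm_sub_tendsto_zero.2 ?_
    refine squeeze_zero (fun _ ↦ norm_nonneg _) (fun x' ↦ ?_) (hg i x)
    have := hJle (g x' - g x) i
    rwa [map_sub] at this
  have hB0 : ∀ i, 0 ≤ B i := fun i ↦ by simpa using (hp i _).trans (hB i 0)
  have hbound : ∀ x : ℝ, ‖J (g x)‖ ≤ (∑ i, B i) * (1 + x ^ 2)⁻¹ := fun x ↦ by
    have : 0 ≤ ∑ i, B i := Finset.sum_nonneg fun i _ ↦ hB0 i
    refine (pi_norm_le_iff_of_nonneg (by positivity)).2 fun i ↦ ?_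
    refine (hJle _ _).trans ((hB i x).trans ?_)
    gcongr
    exact Finset.single_le_sum (fun i _ ↦ hB0 i) (Finset.mem_univ i)
  have hint : Integrable fun x : ℝ ↦ J (g x) :=
    (integrable_inv_one_add_sq.const_mul _).mono' hcont.aestronglyMeasurable (.of_forall hbound)
  have hJint : J Φ = ∫ x : ℝ, J (g x) := by
    funext i
    ext1 y
    -- Point evaluations are continuous and separate points, so the Bochner integral is identified
    -- with the pointwise one.
    let ev := (BoundedContinuousFunction.evalCLM ℂ y (β := M i)) ∘L
      (ContinuousLinearMap.proj (R := ℂ) (φ := fun i ↦ BoundedContinuousFunction X (M i)) i)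
    change _ = ev (∫ x : ℝ, J (g x))
    rw [← ev.integral_comp_comm hint]
    exact hΦ i y
  rw [hTℓ, hJint, ← ℓ.integral_comp_comm hint]
  simp only [hTℓ]

/-- The weighted derivative `y ↦ ‖y‖ ^ k • Dⁿφ(y)` of a Schwartz function. -/
def weightedDeriv (k n : ℕ) : 𝓢(E, ℂ) →ₗ[ℂ] (E → ContinuousMultilinearMap ℝ (fun _ : Fin n ↦ E) ℂ)
    where
  toFun φ y := ‖y‖ ^ k • iteratedFDeriv ℝ n φ y
  map_add' φ ψ := by
    funext y
    have : iteratedFDeriv ℝ n (φ + ψ : 𝓢(E, ℂ)) y =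
        iteratedFDeriv ℝ n φ y + iteratedFDeriv ℝ n ψ y :=
      iteratedFDeriv_add_apply (φ.smooth n).contDiffAt (ψ.smooth n).contDiffAt
    rw [this, smul_add]
    rfl
  map_smul' c φ := by
    funext y
    have : iteratedFDeriv ℝ n (c • φ : 𝓢(E, ℂ)) y = c • iteratedFDeriv ℝ n φ y :=
      iteratedFDeriv_const_smul_apply (φ.smooth n).contDiffAt
    rw [this, smul_comm]
    rfl

lemma weightedDeriv_apply (k n : ℕ) (φ : 𝓢(E, ℂ)) (y : E) :
    weightedDeriv k n φ y = ‖y‖ ^ k • iteratedFDeriv ℝ n φ y := rfl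

lemma norm_weightedDeriv (k n : ℕ) (φ : 𝓢(E, ℂ)) (y : E) :
    ‖weightedDeriv k n φ y‖ = ‖y‖ ^ k * ‖iteratedFDeriv ℝ n φ y‖ := by
  rw [weightedDeriv_apply, norm_smul, norm_pow, norm_norm]

/-- A tempered distribution commutes with the integral of a Schwartz function in a parameter. -/
theorem apply_integralFst (T : 𝓢(E, ℂ) →L[ℂ] ℂ) (φ : 𝓢(ℝ × E, ℂ)) :
    T (integralFst φ) = ∫ x : ℝ, T (slice x φ) := by
  have hq : Continuous ((normSeminorm ℂ ℂ).comp (T : 𝓢(E, ℂ) →ₗ[ℂ] ℂ)) :=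
    continuous_norm.comp T.continuous
  obtain ⟨s, C, -, hC⟩ := Seminorm.bound_of_continuous (schwartz_withSeminorms ℂ E ℂ) _ hq
  refine apply_eq_integral_of_seminorms (ι := s) (fun i ↦ weightedDeriv i.1.1 i.1.2)
    (fun i φ ↦ SchwartzMap.seminorm ℂ i.1.1 i.1.2 φ) (fun _ _ ↦ by positivity)
    (fun i φ ↦ (continuous_norm.pow _).smul ((φ.smooth _).continuous_iteratedFDeriv le_rfl))
    (fun i φ y ↦ ?_) (fun i φ A hA h ↦ ?_) (T : 𝓢(E, ℂ) →ₗ[ℂ] ℂ) C (fun φ A hA h ↦ ?_)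
    (fun x ↦ slice x φ) (fun i x ↦ ?_) _ (fun i x ↦ seminorm_slice_le φ x _ _) _ (fun i y ↦ ?_)
  · rw [norm_weightedDeriv]
    exact SchwartzMap.le_seminorm ℂ _ _ φ y
  · refine SchwartzMap.seminorm_le_bound ℂ _ _ φ hA fun y ↦ ?_
    rw [← norm_weightedDeriv]
    exact h y
  · refine (hC φ).trans ?_
    rw [smul_apply, NNReal.smul_def, smul_eq_mul]
    gcongr
    exact Seminorm.finset_sup_apply_le hA fun p hp ↦ h ⟨p, hp⟩
  · have h := (continuous_slice φ).tendsto x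
    rw [(schwartz_withSeminorms ℂ E ℂ).tendsto_nhds] at h
    refine Metric.tendsto_nhds.2 fun ε hε ↦ ?_
    filter_upwards [h i.1 ε hε] with x' hx'
    rw [Real.dist_0_eq_abs, abs_of_nonneg (by positivity)]
    exact hx'
  · simp only [weightedDeriv_apply]
    rw [integral_smul]
    exact congrArg _ (iteratedFDeriv_integral_schwartz i.1.2 φ y)

end Fubini

/-! ### Tensor products of Schwartz functions -/

section TensorFunction

variable {E : Type} [NormedAddCommGroup E] [NormedSpace ℝ E]

lemma norm_iteratedFDeriv_comp_fst_le (ψ : 𝓢(ℝ, ℂ)) (n : ℕ) (p : ℝ × E) :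
    ‖iteratedFDeriv ℝ n (fun p : ℝ × E ↦ ψ p.1) p‖ ≤ ‖iteratedFDeriv ℝ n ψ p.1‖ := by
  have h := (ContinuousLinearMap.fst ℝ ℝ E).iteratedFDeriv_comp_right (ψ.smooth n) p
    (i := n) le_rfl
  have h1 : ∏ _i : Fin n, ‖ContinuousLinearMap.fst ℝ ℝ E‖ ≤ 1 :=
    Finset.prod_le_one (fun _ _ ↦ norm_nonneg _) fun _ _ ↦ ContinuousLinearMap.norm_fst_le ..
  change ‖iteratedFDeriv ℝ n (ψ ∘ ContinuousLinearMap.fst ℝ ℝ E) p‖ ≤ _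
  rw [h]
  exact (ContinuousMultilinearMap.norm_compContinuousLinearMap_le _ _).trans
    (mul_le_of_le_one_right (norm_nonneg _) h1)

lemma norm_iteratedFDeriv_comp_snd_le (θ : 𝓢(E, ℂ)) (n : ℕ) (p : ℝ × E) :
    ‖iteratedFDeriv ℝ n (fun p : ℝ × E ↦ θ p.2) p‖ ≤ ‖iteratedFDeriv ℝ n θ p.2‖ := by
  have h := (ContinuousLinearMap.snd ℝ ℝ E).iteratedFDeriv_comp_right (θ.smooth n) p
    (i := n) le_rfl
  have h1 : ∏ _i : Fin n, ‖ContinuousLinearMap.snd ℝ ℝ E‖ ≤ 1 :=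
    Finset.prod_le_one (fun _ _ ↦ norm_nonneg _) fun _ _ ↦ ContinuousLinearMap.norm_snd_le ..
  change ‖iteratedFDeriv ℝ n (θ ∘ ContinuousLinearMap.snd ℝ ℝ E) p‖ ≤ _
  rw [h]
  exact (ContinuousMultilinearMap.norm_compContinuousLinearMap_le _ _).trans
    (mul_le_of_le_one_right (norm_nonneg _) h1)

/-- The tensor product `(x, y) ↦ ψ x * θ y` of Schwartz functions. -/
def tensorFun (ψ : 𝓢(ℝ, ℂ)) : 𝓢(E, ℂ) →L[ℂ] 𝓢(ℝ × E, ℂ) :=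
  SchwartzMap.mkCLM (fun θ p ↦ ψ p.1 * θ p.2) (fun θ₁ θ₂ p ↦ by simp [mul_add])
    (fun a θ p ↦ by simp [mul_left_comm])
    (fun θ ↦ (ψ.smooth'.comp contDiff_fst).mul (θ.smooth'.comp contDiff_snd)) <| by
  rintro ⟨k, n⟩
  refine ⟨Finset.Iic (k, n), ∑ i ∈ Finset.range (n + 1), (n.choose i : ℝ) *
    (SchwartzMap.seminorm ℂ k i ψ + SchwartzMap.seminorm ℂ 0 i ψ), by positivity, fun θ p ↦ ?_⟩
  have h1 : ContDiff ℝ n (fun p : ℝ × E ↦ ψ p.1) := (ψ.smooth n).comp contDiff_fst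
  have h2 : ContDiff ℝ n (fun p : ℝ × E ↦ θ p.2) := (θ.smooth n).comp contDiff_snd
  have hsem : ∀ j i, j ≤ k → i ≤ n → SchwartzMap.seminorm ℂ j i θ ≤
      ((Finset.Iic (k, n)).sup (schwartzSeminormFamily ℂ E ℂ)) θ := fun j i hj hi ↦ by
    have : (j, i) ∈ Finset.Iic (k, n) := Finset.mem_Iic.2 ⟨hj, hi⟩
    exact Finset.le_sup (f := schwartzSeminormFamily ℂ E ℂ) this θ
  set S := ((Finset.Iic (k, n)).sup (schwartzSeminormFamily ℂ E ℂ)) θ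
  have hk : ‖p‖ ^ k ≤ ‖p.1‖ ^ k + ‖p.2‖ ^ k := by
    rcases max_choice ‖p.1‖ ‖p.2‖ with h | h <;> rw [Prod.norm_def, h]
    · exact le_add_of_nonneg_right (by positivity)
    · exact le_add_of_nonneg_left (by positivity)
  calc ‖p‖ ^ k * ‖iteratedFDeriv ℝ n (fun p : ℝ × E ↦ ψ p.1 * θ p.2) p‖
      ≤ (‖p.1‖ ^ k + ‖p.2‖ ^ k) * ∑ i ∈ Finset.range (n + 1), (n.choose i : ℝ) *
          ‖iteratedFDeriv ℝ i (fun p : ℝ × E ↦ ψ p.1) p‖ *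
          ‖iteratedFDeriv ℝ (n - i) (fun p : ℝ × E ↦ θ p.2) p‖ := by
        gcongr
        exact norm_iteratedFDeriv_mul_le h1 h2 p le_rfl
    _ ≤ _ := by
        rw [Finset.mul_sum, Finset.sum_mul]
        refine Finset.sum_le_sum fun i _ ↦ ?_
        have a1 := norm_iteratedFDeriv_comp_fst_le ψ i p
        have a2 := norm_iteratedFDeriv_comp_snd_le θ (n - i) p
        have b1 := SchwartzMap.le_seminorm ℂ k i ψ p.1
        have b2 := SchwartzMap.le_seminorm ℂ 0 i ψ p.1
        have c1 := (SchwartzMap.le_seminorm ℂ k (n - i) θ p.2).trans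
          (hsem k (n - i) le_rfl (Nat.sub_le _ _))
        have c2 := (SchwartzMap.le_seminorm ℂ 0 (n - i) θ p.2).trans
          (hsem 0 (n - i) (Nat.zero_le _) (Nat.sub_le _ _))
        rw [pow_zero, one_mul] at b2 c2
        calc (‖p.1‖ ^ k + ‖p.2‖ ^ k) * ((n.choose i : ℝ) *
              ‖iteratedFDeriv ℝ i (fun p : ℝ × E ↦ ψ p.1) p‖ *
              ‖iteratedFDeriv ℝ (n - i) (fun p : ℝ × E ↦ θ p.2) p‖)
            ≤ (‖p.1‖ ^ k + ‖p.2‖ ^ k) * ((n.choose i : ℝ) *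
              ‖iteratedFDeriv ℝ i ψ p.1‖ * ‖iteratedFDeriv ℝ (n - i) θ p.2‖) := by gcongr
          _ = (n.choose i : ℝ) * ((‖p.1‖ ^ k * ‖iteratedFDeriv ℝ i ψ p.1‖) *
                ‖iteratedFDeriv ℝ (n - i) θ p.2‖ + ‖iteratedFDeriv ℝ i ψ p.1‖ *
                (‖p.2‖ ^ k * ‖iteratedFDeriv ℝ (n - i) θ p.2‖)) := by ring
          _ ≤ (n.choose i : ℝ) * (SchwartzMap.seminorm ℂ k i ψ * S +
                SchwartzMap.seminorm ℂ 0 i ψ * S) := by gcongr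
          _ = _ := by ring

@[simp] lemma tensorFun_apply (ψ : 𝓢(ℝ, ℂ)) (θ : 𝓢(E, ℂ)) (p : ℝ × E) :
    tensorFun ψ θ p = ψ p.1 * θ p.2 := rfl

lemma slice_tensorFun (ψ : 𝓢(ℝ, ℂ)) (θ : 𝓢(E, ℂ)) (x : ℝ) :
    slice x (tensorFun ψ θ) = ψ x • θ := by
  ext y; simp

lemma partialPairing_tensorFun (T : 𝓢'(E, ℂ)) (ψ : 𝓢(ℝ, ℂ)) (θ : 𝓢(E, ℂ)) :
    partialPairing T (tensorFun ψ θ) = T θ • ψ := by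
  ext x
  rw [partialPairing_apply, slice_tensorFun, map_smul]
  simp [mul_comm]

lemma lineDeriv_fst_tensorFun (ψ : 𝓢(ℝ, ℂ)) (θ : 𝓢(E, ℂ)) :
    (∂_{((1 : ℝ), (0 : E))} (tensorFun ψ θ) : 𝓢(ℝ × E, ℂ)) =
      tensorFun (SchwartzMap.derivCLM ℂ ℂ ψ) θ := by
  ext ⟨x, y⟩
  rw [SchwartzMap.lineDerivOp_apply]
  have h : HasDerivAt (fun t : ℝ ↦ tensorFun ψ θ ((x, y) + t • ((1 : ℝ), (0 : E))))
      (deriv ψ x * θ y) 0 := by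
    have h1 : HasDerivAt (fun t : ℝ ↦ ψ (x + t)) (deriv ψ x) 0 := by
      have := (ψ.hasDerivAt (x + 0)).comp_const_add x 0
      simpa using this
    simpa using h1.mul_const (θ y)
  exact h.deriv

lemma lineDeriv_snd_tensorFun (ψ : 𝓢(ℝ, ℂ)) (θ : 𝓢(ℝ, ℂ)) :
    (∂_{((0 : ℝ), (1 : ℝ))} (tensorFun ψ θ) : 𝓢(ℝ × ℝ, ℂ)) =
      tensorFun ψ (SchwartzMap.derivCLM ℂ ℂ θ) := by
  ext ⟨x, y⟩
  rw [SchwartzMap.lineDerivOp_apply]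
  have h : HasDerivAt (fun t : ℝ ↦ tensorFun ψ θ ((x, y) + t • ((0 : ℝ), (1 : ℝ))))
      (ψ x * deriv θ y) 0 := by
    have h1 : HasDerivAt (fun t : ℝ ↦ θ (y + t)) (deriv θ y) 0 := by
      have := (θ.hasDerivAt (y + 0)).comp_const_add y 0
      simpa using this
    simpa using h1.const_mul (ψ x)
  exact h.deriv

end TensorFunction

/-! ### Density by mollification -/

section Mollification

variable {E : Type} [NormedAddCommGroup E] [NormedSpace ℝ E]

/-- Absorbing the translation by `h₀` into `T` reduces continuity at `h₀` to differentiability at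
`0`. -/
lemma continuous_translate (T : 𝓢(E, ℂ) →L[ℂ] ℂ) (e : E) (he : ‖e‖ ≤ 1) (f : 𝓢(E, ℂ)) :
    Continuous fun h : ℝ ↦ T (f.compSubConstCLM ℂ (h • e)) := by
  rw [continuous_iff_continuousAt]
  intro h₀
  have h1 := (hasDerivAt_translate (T ∘L SchwartzMap.compSubConstCLM ℂ (h₀ • e)) e he f).continuousAt
  have h2 : ContinuousAt (fun h : ℝ ↦ h₀ - h) h₀ := by fun_prop
  refine (ContinuousAt.comp (f := fun h : ℝ ↦ h₀ - h) (by simpa using h1) h2).congr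
    (.of_forall fun h ↦ ?_)
  simp only [Function.comp_apply]
  congr 1
  ext y
  simp only [SchwartzMap.compSubConstCLM_apply]
  congr 1
  module

/-- A continuous function of translations is determined by its mollifications. -/
lemma apply_eq_zero_of_mollification (T : 𝓢(E, ℂ) →L[ℂ] ℂ) (e : E) (he : ‖e‖ ≤ 1) (f : 𝓢(E, ℂ))
    (h : ∀ ρ : 𝓢(ℝ, ℂ), HasCompactSupport ρ →
      ∫ y : ℝ, ρ y * T (f.compSubConstCLM ℂ (y • e)) = 0) : T f = 0 := by
  have hc := continuous_translate T e he f
  have hae := ae_eq_zero_of_integral_contDiff_smul_eq_zero (μ := volume)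
    hc.locallyIntegrable fun g hg hgc ↦ by
      have h1 : HasCompactSupport (Complex.ofRealCLM ∘ g) := hgc.comp_left rfl
      have h2 : ContDiff ℝ (⊤ : ℕ∞) (Complex.ofRealCLM ∘ g) :=
        Complex.ofRealCLM.contDiff.comp hg
      have := h (h1.toSchwartzMap h2) h1
      simpa using this
  have h0 := (hc.ae_eq_iff_eq volume (continuous_const (y := (0 : ℂ)))).1 hae
  simpa using congrFun h0 0

/-- The linear change of variables `(y, v) ↦ (y, v - y • e)`. -/
def shearEquiv (e : E) : (ℝ × E) ≃L[ℝ] (ℝ × E) :=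
  ContinuousLinearEquiv.equivOfInverse
    ((ContinuousLinearMap.fst ℝ ℝ E).prod (ContinuousLinearMap.snd ℝ ℝ E -
      (ContinuousLinearMap.fst ℝ ℝ E).smulRight e))
    ((ContinuousLinearMap.fst ℝ ℝ E).prod (ContinuousLinearMap.snd ℝ ℝ E +
      (ContinuousLinearMap.fst ℝ ℝ E).smulRight e))
    (fun p ↦ by ext <;> simp) (fun p ↦ by ext <;> simp)

/-- The Schwartz function `(y, v) ↦ ρ y * f (v - y • e)`. -/
def mollifier (ρ : 𝓢(ℝ, ℂ)) (f : 𝓢(E, ℂ)) (e : E) : 𝓢(ℝ × E, ℂ) :=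
  SchwartzMap.compCLMOfContinuousLinearEquiv ℂ (shearEquiv e) (tensorFun ρ f)

lemma mollifier_apply (ρ : 𝓢(ℝ, ℂ)) (f : 𝓢(E, ℂ)) (e : E) (y : ℝ) (v : E) :
    mollifier ρ f e (y, v) = ρ y * f (v - y • e) := rfl

lemma apply_integralFst_mollifier (T : 𝓢(E, ℂ) →L[ℂ] ℂ) (ρ : 𝓢(ℝ, ℂ)) (f : 𝓢(E, ℂ)) (e : E) :
    T (integralFst (mollifier ρ f e)) = ∫ y : ℝ, ρ y * T (f.compSubConstCLM ℂ (y • e)) := by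
  rw [apply_integralFst]
  congr 1
  ext y
  rw [← smul_eq_mul, ← map_smul]
  congr 1

/-- Compactly supported functions are dense in the Schwartz space of the line. -/
lemma eq_zero_of_hasCompactSupport (T : 𝓢(ℝ, ℂ) →L[ℂ] ℂ)
    (h : ∀ ρ : 𝓢(ℝ, ℂ), HasCompactSupport ρ → T ρ = 0) : T = 0 := by
  ext f
  refine apply_eq_zero_of_mollification T 1 (by simp) f fun ρ hρ ↦ ?_
  rw [← apply_integralFst_mollifier]
  -- Convolution is commutative: after the swap, the functions fed to `T` are translates of the
  -- compactly supported `ρ`.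
  have : integralFst (mollifier ρ f 1) = integralFst (mollifier f ρ 1) := by
    ext v
    simp only [integralFst_apply, mollifier_apply, smul_eq_mul, mul_one]
    rw [← integral_sub_left_eq_self _ _ v]
    simp [mul_comm]
  rw [this, apply_integralFst_mollifier]
  refine integral_eq_zero_of_ae (.of_forall fun y ↦ ?_)
  have hc : HasCompactSupport (ρ.compSubConstCLM ℂ (y • (1 : ℝ))) :=
    hρ.comp_homeomorph (Homeomorph.subRight (y • (1 : ℝ)))
  have h0 := h _ hc
  simp only [Pi.zero_apply, h0, mul_zero]

/-- The linear change of variables `(x', (x, t)) ↦ (x - x', (x', t))`. -/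
def reflectEquiv : (ℝ × (ℝ × ℝ)) ≃L[ℝ] (ℝ × (ℝ × ℝ)) :=
  LinearEquiv.toContinuousLinearEquiv
    { toFun := fun p ↦ (p.2.1 - p.1, (p.1, p.2.2))
      invFun := fun p ↦ (p.2.1, (p.1 + p.2.1, p.2.2))
      map_add' := fun p q ↦ by ext <;> simp; ring
      map_smul' := fun c p ↦ by ext <;> simp; ring
      left_inv := fun p ↦ by ext <;> simp
      right_inv := fun p ↦ by ext <;> simp }

/-- Tensor products of Schwartz functions span a dense subspace. -/
lemma eq_zero_of_tensorFun (T : 𝓢(ℝ × ℝ, ℂ) →L[ℂ] ℂ)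
    (h : ∀ ψ θ : 𝓢(ℝ, ℂ), T (tensorFun ψ θ) = 0) : T = 0 := by
  ext f
  refine apply_eq_zero_of_mollification T ((1 : ℝ), (0 : ℝ)) (by simp [Prod.norm_def]) f
    fun ρ _ ↦ ?_
  rw [← apply_integralFst_mollifier]
  set K : 𝓢(ℝ × (ℝ × ℝ), ℂ) :=
    SchwartzMap.compCLMOfContinuousLinearEquiv ℂ reflectEquiv (tensorFun ρ f)
  have hK : ∀ x' x t : ℝ, K (x', (x, t)) = ρ (x - x') * f (x', t) := fun _ _ _ ↦ rfl
  -- Mollifying in `x` only gives an integral over `x'` of `ρ(x - x') f(x', t)`. For fixed `x'` this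
  -- is a tensor product in `(x, t)`.
  have : integralFst (mollifier ρ f ((1 : ℝ), (0 : ℝ))) = integralFst K := by
    ext ⟨x, t⟩
    simp only [integralFst_apply, mollifier_apply, hK]
    rw [← integral_sub_left_eq_self _ _ x]
    simp
  rw [this, apply_integralFst]
  refine integral_eq_zero_of_ae (.of_forall fun x' ↦ ?_)
  have : slice x' K = tensorFun (ρ.compSubConstCLM ℂ x') (slice x' f) := by
    ext ⟨x, t⟩
    simp [hK]
  simp [this, h]

end Mollification

/-! ### Distributions vanishing on a half space -/

section HalfSpace

variable {E : Type} [NormedAddCommGroup E] [NormedSpace ℝ E]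

/-- A tempered distribution that vanishes on the open half space `ℓ < 0` vanishes on every
Schwartz function that is zero on the closed half space `0 ≤ ℓ`. -/
lemma IsVanishingOn_halfSpace_apply {T : 𝓢'(E, ℂ)} {ℓ : E →L[ℝ] ℝ} {e : E} (he : ‖e‖ ≤ 1)
    (hℓ : ℓ e = 1) (hT : IsVanishingOn T {v | ℓ v < 0}) {f : 𝓢(E, ℂ)}
    (hf : ∀ v, 0 ≤ ℓ v → f v = 0) : T f = 0 := by
  have hc := continuous_translate T e he f
  -- Translating by `h • e` with `h < 0` pushes the support of `f` into `ℓ ≤ h`, strictly inside the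
  -- open half space; then `h` tends to `0` from below.
  have h0 : ∀ h : ℝ, h < 0 → T (f.compSubConstCLM ℂ (h • e)) = 0 := fun h hh ↦ by
    apply hT
    have hcl : IsClosed {v | ℓ v ≤ h} := isClosed_le ℓ.continuous continuous_const
    refine (closure_minimal (fun v hv ↦ ?_) hcl).trans fun v (hv : ℓ v ≤ h) ↦
      show ℓ v < 0 by linarith
    by_contra hcon
    have hcon' : h < ℓ v := not_le.1 hcon
    refine hv ?_
    rw [SchwartzMap.compSubConstCLM_apply]
    apply hf
    simp only [map_sub, map_smul, hℓ, smul_eq_mul, mul_one]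
    linarith
  have hlim : Filter.Tendsto (fun h : ℝ ↦ T (f.compSubConstCLM ℂ (h • e))) (nhdsWithin 0 (Set.Iio 0))
      (nhds (T f)) := by
    have := (hc.tendsto 0).mono_left (nhdsWithin_le_nhds (s := Set.Iio 0))
    simp only [zero_smul, SchwartzMap.compSubConstCLM_zero] at this
    exact this
  refine tendsto_nhds_unique hlim (tendsto_const_nhds.congr' ?_)
  filter_upwards [self_mem_nhdsWithin] with h hh using (h0 h hh).symm

/-- The difference of the test functions vanishes on the closed half line. This is the tool that
discards the cutoffs: a test function matters only through its values for `t ≥ 0`. -/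
lemma IsVanishingOn_Iio_congr {T : 𝓢'(ℝ, ℂ)} (hT : IsVanishingOn T (Set.Iio (0 : ℝ)))
    {f g : 𝓢(ℝ, ℂ)} (h : ∀ t, 0 ≤ t → f t = g t) : T f = T g := by
  rw [← sub_eq_zero, ← map_sub]
  exact IsVanishingOn_halfSpace_apply (ℓ := ContinuousLinearMap.id ℝ ℝ) (e := 1) (by simp) rfl hT
    fun t ht ↦ by simp [h t ht]

lemma IsVanishingOn_snd_congr {T : 𝓢'(ℝ × ℝ, ℂ)} (hT : IsVanishingOn T {p : ℝ × ℝ | p.2 < 0})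
    {f g : 𝓢(ℝ × ℝ, ℂ)} (h : ∀ x t, 0 ≤ t → f (x, t) = g (x, t)) : T f = T g := by
  rw [← sub_eq_zero, ← map_sub]
  exact IsVanishingOn_halfSpace_apply (ℓ := ContinuousLinearMap.snd ℝ ℝ ℝ) (e := (0, 1))
    (by simp [Prod.norm_def]) rfl hT fun p hp ↦ by
      rw [sub_apply, h p.1 p.2 hp, sub_self]

end HalfSpace

/-! ### Injectivity of the Laplace transform -/

section LaplaceUniqueness

open FourierTransform

lemma hasTemperateGrowth_exp_mul_I (c : ℝ) :
    (fun x : ℝ ↦ Complex.exp (c * Complex.I * x)).HasTemperateGrowth := by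
  refine ⟨(contDiff_const.mul Complex.ofRealCLM.contDiff).cexp, fun n ↦ ⟨0, |c| ^ n, fun x ↦ ?_⟩⟩
  have hexp : ∀ n : ℕ, iteratedDeriv n (fun t : ℝ ↦ Complex.exp (c * Complex.I * t)) =
      fun t : ℝ ↦ (c * Complex.I) ^ n * Complex.exp (c * Complex.I * t) := by
    intro n
    induction n with
    | zero => simp
    | succ n ih =>
      rw [iteratedDeriv_succ, ih]
      ext r
      have h1 : HasDerivAt (fun r : ℝ ↦ c * Complex.I * (r : ℂ)) (c * Complex.I) r := by
        simpa using (Complex.ofRealCLM.hasDerivAt (x := r)).const_mul (c * Complex.I)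
      rw [((h1.cexp).const_mul ((c * Complex.I) ^ n)).deriv]
      ring
  rw [norm_iteratedFDeriv_eq_norm_iteratedDeriv, hexp]
  simp [Complex.norm_exp]

lemma hasTemperateGrowth_exp_mul_mul_I :
    (fun p : ℝ × ℝ ↦ Complex.exp (2 * Real.pi * Complex.I * p.1 * p.2)).HasTemperateGrowth := by
  have h : (fun p : ℝ × ℝ ↦ p.1 * p.2).HasTemperateGrowth :=
    (ContinuousLinearMap.fst ℝ ℝ ℝ).hasTemperateGrowth.mul
      (ContinuousLinearMap.snd ℝ ℝ ℝ).hasTemperateGrowth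
  convert (hasTemperateGrowth_exp_mul_I (2 * Real.pi)).comp h using 1
  ext p
  simp only [Function.comp_apply]
  push_cast
  ring_nf

lemma schwartz_eq_integral_fourier (ρ : 𝓢(ℝ, ℂ)) (t : ℝ) :
    ρ t = ∫ w : ℝ, Complex.exp (2 * Real.pi * Complex.I * w * t) * (𝓕 ρ) w := by
  conv_lhs => rw [← FourierTransform.fourierInv_fourier_eq (F := 𝓢(ℝ, ℂ)) ρ, SchwartzMap.fourierInv_coe,
    Real.fourierInv_eq']
  simp only [RCLike.inner_apply, conj_trivial, smul_eq_mul]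
  congr 1
  ext w
  congr 2
  push_cast
  ring

/-- The Laplace transform is injective on the tempered distributions vanishing on `(-∞, 0)`. -/
theorem eq_zero_of_laplaceTransform {T : 𝓢'(ℝ, ℂ)} (hT : IsVanishingOn T (Set.Iio (0 : ℝ)))
    (h : ∀ (s : ℂ) (hs : 0 < s.re), laplaceTransform T s hs = 0) : T = 0 := by
  refine eq_zero_of_hasCompactSupport T fun φ hφ ↦ ?_
  -- With `ρ = e^t φ`, Fourier inversion of `ρ` writes `φ(t)` as a superposition of the exponentials
  -- `e^{-(1 - 2πiw)t}` with weights `𝓕 ρ w`. Compact support of `φ` keeps `ρ` a Schwartz function.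
  have hρc : HasCompactSupport fun t : ℝ ↦ Complex.exp t * φ t := hφ.mul_left
  have hρs : ContDiff ℝ (⊤ : ℕ∞) fun t : ℝ ↦ Complex.exp t * φ t :=
    (Complex.ofRealCLM.contDiff.cexp).mul φ.smooth'
  set ρ : 𝓢(ℝ, ℂ) := hρc.toSchwartzMap hρs with hρ
  have hρa : ∀ t, ρ t = Complex.exp t * φ t := fun _ ↦ rfl
  set Φ : 𝓢(ℝ × ℝ, ℂ) := SchwartzMap.smulLeftCLM ℂ
    (fun p : ℝ × ℝ ↦ Complex.exp (2 * Real.pi * Complex.I * p.1 * p.2))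
    (tensorFun (𝓕 ρ) (expTest 1 (by simp))) with hΦ
  have hΦa : ∀ w t : ℝ, Φ (w, t) = Complex.exp (2 * Real.pi * Complex.I * w * t) *
      ((𝓕 ρ) w * expTest 1 (by simp) t) := fun w t ↦ by
    rw [hΦ, SchwartzMap.smulLeftCLM_apply_apply hasTemperateGrowth_exp_mul_mul_I]
    rfl
  have h1 : T φ = T (integralFst Φ) := by
    refine IsVanishingOn_Iio_congr hT fun t ht ↦ ?_
    simp only [integralFst_apply, hΦa, ← mul_assoc]
    rw [integral_mul_const, ← schwartz_eq_integral_fourier, hρa, expTest_apply,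
      cutoff_eq_one (by linarith), mul_right_comm, Complex.ofReal_one, one_mul,
      ← Complex.exp_add]
    simp
  have hs : ∀ w : ℝ, 0 < (1 - 2 * Real.pi * Complex.I * w).re := fun w ↦ by simp
  have h2 : ∀ w : ℝ, slice w Φ = (𝓕 ρ) w • expTest _ (hs w) := fun w ↦ by
    ext t
    rw [slice_apply, hΦa, smul_apply, expTest_apply, expTest_apply, smul_eq_mul]
    rw [show -(1 - 2 * Real.pi * Complex.I * w) * t = 2 * Real.pi * Complex.I * w * t + -1 * t by
      ring, Complex.exp_add]
    ring
  refine h1.trans ((apply_integralFst T Φ).trans (integral_eq_zero_of_ae (.of_forall fun w ↦ ?_)))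
  change T (slice w Φ) = 0
  have h3 : T (expTest _ (hs w)) = 0 := h _ (hs w)
  rw [h2, map_smul, h3, smul_zero]

/-- Besides the uniqueness of `L`, this transfers estimates: every inverse Laplace transform of `F`
inherits the bounds of the one that is constructed by a contour integral. -/
lemma eq_of_isInverseLaplace {F : ℂ → ℂ} {T₁ T₂ : 𝓢'(ℝ, ℂ)} (h₁ : IsInverseLaplace F T₁)
    (h₂ : IsInverseLaplace F T₂) : T₁ = T₂ := by
  rw [← sub_eq_zero]
  refine eq_zero_of_laplaceTransform (fun f hf ↦ ?_) fun s hs ↦ ?_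
  · change T₁ f - T₂ f = 0
    rw [h₁.vanishes f hf, h₂.vanishes f hf, sub_zero]
  · exact sub_eq_zero.2 ((h₁.laplace_eq s hs).trans (h₂.laplace_eq s hs).symm)

/-- A tempered distribution on `ℝ²` vanishing for negative times is determined by its values on
the products of a Schwartz function of `x` with an exponential in `t`. -/
theorem eq_zero_of_tensorFun_expTest {w : 𝓢'(ℝ × ℝ, ℂ)}
    (hw : IsVanishingOn w {p : ℝ × ℝ | p.2 < 0})
    (h : ∀ (ψ : 𝓢(ℝ, ℂ)) (s : ℂ) (hs : 0 < s.re), w (tensorFun ψ (expTest s hs)) = 0) :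
    w = 0 := by
  refine eq_zero_of_tensorFun w fun ψ θ ↦ ?_
  -- Freezing `ψ` leaves a distribution in time alone, with zero Laplace transform.
  let T : 𝓢'(ℝ, ℂ) := PointwiseConvergenceCLM.precomp ℂ (tensorFun ψ) w
  have hT : T = 0 := by
    refine eq_zero_of_laplaceTransform (fun f hf ↦ ?_) fun s hs ↦ h ψ s hs
    have h0 : w (tensorFun ψ f) = w 0 := by
      refine IsVanishingOn_snd_congr hw fun x t ht ↦ ?_
      have : f t = 0 := by
        by_contra hne
        have : t < 0 := hf (subset_tsupport _ hne)
        linarith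
      simp [this]
    change w (tensorFun ψ f) = 0
    rw [h0, map_zero]
  exact DFunLike.congr_fun hT θ

end LaplaceUniqueness

/-! ### Shifting vertical contours -/

section ContourShift

open Complex Filter Topology

/-- The integral of a holomorphic function over a vertical line does not depend on the line. -/
lemma integral_vertical_eq {G : ℂ → ℂ} (hG : DifferentiableOn ℂ G {s | 0 < s.re}) {a b K : ℝ}
    (ha : 0 < a) (hab : a ≤ b)
    (hK : ∀ s : ℂ, a ≤ s.re → s.re ≤ b → ‖G s‖ ≤ K * (1 + s.im ^ 2)⁻¹) :
    ∫ y : ℝ, G (a + y * I) = ∫ y : ℝ, G (b + y * I) := by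
  have hint : ∀ c : ℝ, a ≤ c → c ≤ b → Integrable fun y : ℝ ↦ G (c + y * I) := by
    intro c h1 h2
    refine (integrable_inv_one_add_sq.const_mul K).mono' ?_ (.of_forall fun y ↦ ?_)
    · refine Continuous.aestronglyMeasurable ?_
      refine hG.continuousOn.comp_continuous (by fun_prop) fun y ↦ ?_
      simp; linarith
    · simpa using hK (c + y * I) (by simpa using h1) (by simpa using h2)
  have hlim : ∀ c : ℝ, a ≤ c → c ≤ b → Tendsto (fun R : ℝ ↦ ∫ y in (-R)..R, G (c + y * I)) atTop
      (𝓝 (∫ y : ℝ, G (c + y * I))) := fun c h1 h2 ↦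
    intervalIntegral_tendsto_integral (hint c h1 h2) tendsto_neg_atTop_atBot tendsto_id
  -- The horizontal sides of the rectangle contribute nothing in the limit; `σ = -1` and `σ = 1` are
  -- the bottom and the top.
  have hhor : ∀ σ : ℝ, |σ| = 1 →
      Tendsto (fun R : ℝ ↦ ∫ x in a..b, G (x + (σ * R : ℝ) * I)) atTop (𝓝 0) := by
    intro σ hσ
    have h0 : Tendsto (fun R : ℝ ↦ K * (1 + R ^ 2)⁻¹ * |b - a|) atTop (𝓝 0) := by
      have : Tendsto (fun R : ℝ ↦ (1 + R ^ 2)⁻¹) atTop (𝓝 0) :=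
        tendsto_inv_atTop_zero.comp
          (tendsto_atTop_add_const_left _ _ (tendsto_pow_atTop two_ne_zero))
      simpa using (this.const_mul K).mul_const |b - a|
    refine squeeze_zero_norm (fun R ↦ ?_) h0
    refine intervalIntegral.norm_integral_le_of_norm_le_const fun x hx ↦ ?_
    rw [Set.uIoc_of_le hab] at hx
    have := hK (x + (σ * R : ℝ) * I) (by simpa using hx.1.le) (by simpa using hx.2)
    have h2 : (σ * R) ^ 2 = R ^ 2 := by rw [mul_pow, ← sq_abs σ, hσ]; ring
    simpa [-ofReal_mul, h2] using this
  have hrect : ∀ R : ℝ, ((∫ x in a..b, G (x + ((-1) * R : ℝ) * I)) -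
      (∫ x in a..b, G (x + (1 * R : ℝ) * I))) + I * (∫ y in (-R)..R, G (b + y * I)) -
      I * (∫ y in (-R)..R, G (a + y * I)) = 0 := by
    intro R
    have := integral_boundary_rect_eq_zero_of_differentiableOn G ⟨a, -R⟩ ⟨b, R⟩
      (hG.mono fun s hs ↦ ?_)
    · simpa using this
    · rw [mem_reProdIm] at hs
      have h1 := hs.1
      simp only [Set.uIcc_of_le hab] at h1
      exact ha.trans_le h1.1
  have hL := (((hhor (-1) (by simp)).sub (hhor 1 (by simp))).add
    ((hlim b hab le_rfl).const_mul I)).sub ((hlim a le_rfl hab).const_mul I)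
  simp only [hrect] at hL
  have := tendsto_nhds_unique tendsto_const_nhds hL
  rw [sub_zero, zero_add, ← mul_sub] at this
  have h3 := (mul_eq_zero.1 this.symm).resolve_left I_ne_zero
  exact (sub_eq_zero.1 h3).symm

end ContourShift

/-! ### The Bromwich integral on the half plane -/

section InverseLaplace

open Complex Filter Topology FourierTransform

/-- `F` is holomorphic on the right half plane, with `‖F s‖ ≤ C (1 + 1 / Re s) ^ M`. -/
structure IsHalfPlaneBounded (F : ℂ → ℂ) (C : ℝ) (M : ℕ) : Prop where
  differentiableOn : DifferentiableOn ℂ F {s | 0 < s.re}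
  norm_le : ∀ s : ℂ, 0 < s.re → ‖F s‖ ≤ C * (1 + 1 / s.re) ^ M

variable {F : ℂ → ℂ} {C : ℝ} {M : ℕ}

lemma IsHalfPlaneBounded.nonneg (h : IsHalfPlaneBounded F C M) : 0 ≤ C := by
  have := (norm_nonneg _).trans (h.norm_le 1 (by simp))
  simp only [one_re, div_one] at this
  exact nonneg_of_mul_nonneg_left this (by positivity)

lemma one_add_ne_zero_of_re_pos {s : ℂ} (hs : 0 < s.re) : 1 + s ≠ 0 := by
  intro h
  have := congrArg re h
  simp at this
  linarith

/-- Since `|1 + s|² ≥ 1 + (Im s)²` on the half plane, the division makes `F` absolutely integrable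
on vertical lines. The factor is restored later by a differential operator. -/
lemma IsHalfPlaneBounded.norm_div_le (h : IsHalfPlaneBounded F C M) {a : ℝ} (ha : 0 < a) {s : ℂ}
    (hs : a ≤ s.re) : ‖F s / (1 + s) ^ 2‖ ≤ C * (1 + 1 / a) ^ M * (1 + s.im ^ 2)⁻¹ := by
  have hC := h.nonneg
  have h1 : 1 + s.im ^ 2 ≤ ‖1 + s‖ ^ 2 := by
    rw [← normSq_eq_norm_sq, normSq_apply]
    simp
    nlinarith
  rw [norm_div, norm_pow, div_eq_mul_inv]
  have h2 := h.norm_le s (ha.trans_le hs)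
  have h3 : 0 < s.re := ha.trans_le hs
  have h4 : 1 / s.re ≤ 1 / a := one_div_le_one_div_of_le ha hs
  have h5 : (1 + 1 / s.re) ^ M ≤ (1 + 1 / a) ^ M := by gcongr
  have h6 : (‖1 + s‖ ^ 2)⁻¹ ≤ (1 + s.im ^ 2)⁻¹ := by gcongr
  exact mul_le_mul (h2.trans (by gcongr)) h6 (by positivity) (by positivity)

/-- The original of `F s / (1 + s) ^ 2`, an integral over the line `Re s = a`. -/
def contourOriginal (F : ℂ → ℂ) (a t : ℝ) : ℂ :=
  (2 * Real.pi : ℂ)⁻¹ * ∫ y : ℝ, exp ((a + y * I) * t) * (F (a + y * I) / (1 + (a + y * I)) ^ 2)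

lemma IsHalfPlaneBounded.differentiableOn_div (h : IsHalfPlaneBounded F C M) :
    DifferentiableOn ℂ (fun s ↦ F s / (1 + s) ^ 2) {s | 0 < s.re} :=
  h.differentiableOn.div (by fun_prop) fun _ hs ↦ pow_ne_zero _ (one_add_ne_zero_of_re_pos hs)

lemma IsHalfPlaneBounded.contourOriginal_eq (h : IsHalfPlaneBounded F C M) {a b : ℝ} (ha : 0 < a)
    (hb : 0 < b) (t : ℝ) : contourOriginal F a t = contourOriginal F b t := by
  wlog hab : a ≤ b generalizing a b
  · exact (this hb ha (le_of_not_ge hab)).symm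
  unfold contourOriginal
  congr 1
  refine integral_vertical_eq (G := fun s ↦ exp (s * t) * (F s / (1 + s) ^ 2))
    (K := Real.exp (b * |t|) * (C * (1 + 1 / a) ^ M)) (DifferentiableOn.mul (by fun_prop)
      h.differentiableOn_div) ha hab fun s h1 h2 ↦ ?_
  rw [norm_mul, mul_assoc, norm_exp]
  refine mul_le_mul ?_ (h.norm_div_le ha h1) (norm_nonneg _) (Real.exp_pos _).le
  rw [Real.exp_le_exp]
  simp only [mul_re, ofReal_re, ofReal_im, mul_zero, sub_zero]
  have h3 : 0 ≤ s.re := (ha.trans_le h1).le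
  calc s.re * t ≤ s.re * |t| := by gcongr; exact le_abs_self t
    _ ≤ b * |t| := by gcongr

lemma IsHalfPlaneBounded.norm_contourOriginal_le (h : IsHalfPlaneBounded F C M) {a : ℝ}
    (ha : 0 < a) (t : ℝ) : ‖contourOriginal F a t‖ ≤ C * (1 + 1 / a) ^ M * Real.exp (a * t) := by
  have hC := h.nonneg
  have h1 : ‖∫ y : ℝ, exp ((a + y * I) * t) * (F (a + y * I) / (1 + (a + y * I)) ^ 2)‖ ≤
      ∫ y : ℝ, Real.exp (a * t) * (C * (1 + 1 / a) ^ M) * (1 + y ^ 2)⁻¹ := by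
    refine norm_integral_le_of_norm_le (integrable_inv_one_add_sq.const_mul _)
      (.of_forall fun y ↦ ?_)
    rw [norm_mul, mul_assoc, norm_exp]
    have := h.norm_div_le ha (s := a + y * I) (by simp)
    refine mul_le_mul (le_of_eq (by simp)) (by simpa using this) (norm_nonneg _)
      (Real.exp_pos _).le
  rw [integral_const_mul, integral_univ_inv_one_add_sq] at h1
  rw [contourOriginal, norm_mul]
  have h2 : ‖(2 * Real.pi : ℂ)⁻¹‖ = (2 * Real.pi)⁻¹ := by
    rw [norm_inv, norm_mul, norm_real, Real.norm_of_nonneg Real.pi_pos.le]; simp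
  rw [h2]
  calc (2 * Real.pi)⁻¹ * _ ≤ (2 * Real.pi)⁻¹ *
        (Real.exp (a * t) * (C * (1 + 1 / a) ^ M) * Real.pi) := by gcongr
    _ = 1 / 2 * (C * (1 + 1 / a) ^ M * Real.exp (a * t)) := by
        field_simp
    _ ≤ _ := by
        have : 0 ≤ C * (1 + 1 / a) ^ M * Real.exp (a * t) := by positivity
        linarith

/-- Causality: the line is moved to `Re s = b` with `b → ∞`, where `e^{bt}` tends to `0` while `(1 +
1/b)^M ≤ 2^M`. -/
lemma IsHalfPlaneBounded.contourOriginal_eq_zero (h : IsHalfPlaneBounded F C M) {a t : ℝ}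
    (ha : 0 < a) (ht : t < 0) : contourOriginal F a t = 0 := by
  have hC := h.nonneg
  have hlim : Tendsto (fun b : ℝ ↦ C * 2 ^ M * Real.exp (b * t)) atTop (𝓝 0) := by
    have : Tendsto (fun b : ℝ ↦ Real.exp (b * t)) atTop (𝓝 0) :=
      Real.tendsto_exp_atBot.comp (tendsto_id.atTop_mul_const_of_neg ht)
    simpa using this.const_mul (C * 2 ^ M)
  have : ‖contourOriginal F a t‖ ≤ 0 := by
    refine ge_of_tendsto hlim ?_
    filter_upwards [eventually_ge_atTop 1] with b hb
    have hb0 : 0 < b := by linarith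
    rw [h.contourOriginal_eq ha hb0]
    refine (h.norm_contourOriginal_le hb0 t).trans ?_
    have : 1 + 1 / b ≤ 2 := by
      have : 1 / b ≤ 1 := by rw [div_le_one hb0]; exact hb
      linarith
    gcongr
  exact norm_le_zero_iff.1 this

/-- For `t ≥ 0` the line is chosen depending on `t`: with `a = 1/(1+t)` the exponential is at most
`e ≤ 3` and `1 + 1/a = 2 + t`. Thus blow-up of order `M` at the imaginary axis becomes growth of
order `M` in time. -/
lemma IsHalfPlaneBounded.norm_contourOriginal_le_pow (h : IsHalfPlaneBounded F C M) (t : ℝ) :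
    ‖contourOriginal F 1 t‖ ≤ C * (3 * (2 + |t|) ^ M) := by
  have hC := h.nonneg
  rcases lt_or_ge t 0 with ht | ht
  · rw [h.contourOriginal_eq_zero one_pos ht, norm_zero]
    positivity
  have ha : 0 < 1 / (1 + t) := by positivity
  rw [h.contourOriginal_eq one_pos ha]
  refine (h.norm_contourOriginal_le ha t).trans ?_
  rw [mul_assoc, abs_of_nonneg ht, mul_comm (_ ^ M)]
  have h1 : Real.exp (1 / (1 + t) * t) ≤ 3 := by
    have h0 : 1 / (1 + t) * t ≤ 1 := by
      rw [div_mul_eq_mul_div, one_mul, div_le_one (by positivity)]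
      linarith
    exact (Real.exp_le_exp.2 h0).trans (Real.exp_one_lt_d9.le.trans (by norm_num))
  have h2 : 1 + 1 / (1 / (1 + t)) = 2 + t := by rw [one_div_one_div]; ring
  rw [h2]
  gcongr

lemma continuous_fourierInv {g : ℝ → ℂ} (hg : Integrable g) : Continuous (𝓕⁻ g) := by
  have h := VectorFourier.fourierIntegral_continuous (L := -innerₗ ℝ) Real.continuous_fourierChar
    (by exact continuous_inner.neg) hg
  exact h

/-- The substitution `y = 2πw` absorbs the factor `1/(2π)`, and `e^{-at}` cancels the real part of
the exponent on the line `Re s = a`. -/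
lemma IsHalfPlaneBounded.fourierInv_eq (h : IsHalfPlaneBounded F C M) {a : ℝ} (ha : 0 < a) (t : ℝ) :
    𝓕⁻ (fun w ↦ F (a + (2 * Real.pi * w : ℝ) * I) /
      (1 + (a + (2 * Real.pi * w : ℝ) * I)) ^ 2 : ℝ → ℂ) t =
      exp (-(a * t)) * contourOriginal F 1 t := by
  rw [h.contourOriginal_eq one_pos ha, contourOriginal, Real.fourierInv_eq']
  have := Measure.integral_comp_mul_left (fun y : ℝ ↦ exp ((a + y * I) * t) *
    (F (a + y * I) / (1 + (a + y * I)) ^ 2)) (2 * Real.pi)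
  rw [abs_of_pos (by positivity)] at this
  have e : (2 * Real.pi : ℂ)⁻¹ * ∫ y : ℝ, exp ((a + y * I) * t) *
      (F (a + y * I) / (1 + (a + y * I)) ^ 2) = ((2 * Real.pi)⁻¹ : ℝ) • ∫ y : ℝ,
        exp ((a + y * I) * t) * (F (a + y * I) / (1 + (a + y * I)) ^ 2) := by
    rw [real_smul]; push_cast; ring
  rw [e, ← this, ← integral_const_mul]
  congr 1
  ext w
  rw [← mul_assoc, ← exp_add, smul_eq_mul]
  congr 2
  simp only [RCLike.inner_apply, conj_trivial]
  push_cast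
  ring

/-- Fourier inversion on the vertical line through `s`, at frequency `Im s / 2π`, recovers `F s / (1
+ s)²`. It needs `e^{-st}` times the original to be integrable, which follows by estimating the
original on the line of abscissa `Re s / 2`. -/
lemma IsHalfPlaneBounded.continuous_contourOriginal (h : IsHalfPlaneBounded F C M) :
    Continuous (contourOriginal F 1) ∧ ∀ s : ℂ, 0 < s.re →
      Integrable (fun t : ℝ ↦ exp (-s * t) * contourOriginal F 1 t) ∧
      ∫ t : ℝ, exp (-s * t) * contourOriginal F 1 t = F s / (1 + s) ^ 2 := by
  have key : ∀ a : ℝ, 0 < a → ∃ g : ℝ → ℂ, Continuous g ∧ Integrable g ∧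
      (∀ w : ℝ, g w = F (a + (2 * Real.pi * w : ℝ) * I) /
        (1 + (a + (2 * Real.pi * w : ℝ) * I)) ^ 2) ∧
      𝓕⁻ g = fun t : ℝ ↦ exp (-(a * t)) * contourOriginal F 1 t := by
    intro a ha
    refine ⟨_, ?_, ?_, fun w ↦ rfl, funext fun t ↦ h.fourierInv_eq ha t⟩
    · refine h.differentiableOn_div.continuousOn.comp_continuous
        (f := fun w : ℝ ↦ (a : ℂ) + (2 * Real.pi * w : ℝ) * I) (by fun_prop) fun w ↦ ?_
      simpa using ha
    · have hi : Integrable fun w : ℝ ↦ C * (1 + 1 / a) ^ M * (1 + (2 * Real.pi * w) ^ 2)⁻¹ :=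
        (integrable_inv_one_add_sq.comp_mul_left' (by positivity)).const_mul _
      refine hi.mono' ?_ (.of_forall fun w ↦ ?_)
      · refine Continuous.aestronglyMeasurable ?_
        refine h.differentiableOn_div.continuousOn.comp_continuous
          (f := fun w : ℝ ↦ (a : ℂ) + (2 * Real.pi * w : ℝ) * I) (by fun_prop) fun w ↦ ?_
        simpa using ha
      · have := h.norm_div_le ha (s := a + (2 * Real.pi * w : ℝ) * I) (by simp)
        simpa using this
  have hcont : Continuous (contourOriginal F 1) := by
    obtain ⟨g, -, hgi, -, hg⟩ := key 1 one_pos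
    have h1 := continuous_fourierInv hgi
    rw [hg] at h1
    have h2 : contourOriginal F 1 = fun t : ℝ ↦ exp t *
        (exp (-((1 : ℝ) * t)) * contourOriginal F 1 t) := by
      ext t
      rw [← mul_assoc, ← exp_add]
      simp
    rw [h2]
    exact (by fun_prop : Continuous fun t : ℝ ↦ exp t).mul h1
  refine ⟨hcont, fun s hs ↦ ?_⟩
  have hint : Integrable (fun t : ℝ ↦ exp (-s * t) * contourOriginal F 1 t) := by
    have hio : IntegrableOn (fun t : ℝ ↦ C * (1 + 1 / (s.re / 2)) ^ M *
        Real.exp (-(s.re / 2) * t)) (Set.Ici 0) :=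
      (integrableOn_Ici_iff_integrableOn_Ioi).2
        ((exp_neg_integrableOn_Ioi 0 (half_pos hs)).const_mul _)
    refine (hio.integrable_indicator measurableSet_Ici).mono' ?_ (.of_forall fun t ↦ ?_)
    · exact (Continuous.mul (by fun_prop) hcont).aestronglyMeasurable
    · rcases lt_or_ge t 0 with ht | ht
      · rw [h.contourOriginal_eq_zero one_pos ht, mul_zero, norm_zero]
        simp [ht]
      · rw [Set.indicator_of_mem (Set.mem_Ici.2 ht), norm_mul, norm_exp,
          h.contourOriginal_eq one_pos (half_pos hs)]
        refine (mul_le_mul_of_nonneg_left (h.norm_contourOriginal_le (half_pos hs) t)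
          (Real.exp_pos _).le).trans (le_of_eq ?_)
        rw [mul_left_comm, ← Real.exp_add]
        congr 2
        simp
        ring
  refine ⟨hint, ?_⟩
  obtain ⟨g, hgc, hgi, hgw, hg⟩ := key s.re hs
  have hfi : Integrable (𝓕⁻ g) := by
    rw [hg]
    have hn := hint.norm
    refine hint.mono ?_ (.of_forall fun t ↦ le_of_eq ?_)
    · exact (Continuous.mul (by fun_prop) hcont).aestronglyMeasurable
    · rw [norm_mul, norm_mul, norm_exp, norm_exp]
      simp
  have hfi' : Integrable (𝓕 g) := by
    have : 𝓕 g = fun t ↦ 𝓕⁻ g (-t) := by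
      ext t
      rw [Real.fourierInv_eq_fourier_neg, neg_neg]
    rw [this]
    exact hfi.comp_neg
  have hinv := congrFun (hgc.fourier_fourierInv_eq hgi hfi') (s.im / (2 * Real.pi))
  have e1 : (2 * Real.pi * (s.im / (2 * Real.pi)) : ℝ) = s.im := by field_simp
  rw [hgw, hg, e1, re_add_im, Real.fourier_eq'] at hinv
  rw [← hinv]
  congr 1
  ext t
  rw [smul_eq_mul, ← mul_assoc, ← exp_add]
  congr 2
  simp only [RCLike.inner_apply, conj_trivial]
  have e2 : (-2 * Real.pi * (s.im / (2 * Real.pi) * t) : ℝ) = -(s.im * t) := by field_simp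
  rw [e2]
  nth_rw 1 [← re_add_im s]
  push_cast
  ring

end InverseLaplace

/-! ### Existence of inverse Laplace transforms -/

section InverseLaplaceExistence

open Complex

/-- The differential operator `1 - d/dt` on Schwartz functions. -/
def oneSubDeriv : 𝓢(ℝ, ℂ) →L[ℂ] 𝓢(ℝ, ℂ) :=
  ContinuousLinearMap.id ℂ _ - SchwartzMap.derivCLM ℂ ℂ

/-- The differential operator `(1 - d/dt)²` on Schwartz functions. -/
def oneSubDerivSq : 𝓢(ℝ, ℂ) →L[ℂ] 𝓢(ℝ, ℂ) := oneSubDeriv ∘L oneSubDeriv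

lemma oneSubDeriv_apply (φ : 𝓢(ℝ, ℂ)) (t : ℝ) :
    oneSubDeriv φ t = φ t - deriv φ t := rfl

lemma oneSubDerivSq_apply_eq_zero {φ : 𝓢(ℝ, ℂ)} (hφ : tsupport φ ⊆ Set.Iio 0) {t : ℝ}
    (ht : 0 ≤ t) : oneSubDerivSq φ t = 0 := by
  have h : ∀ ψ : 𝓢(ℝ, ℂ), tsupport ψ ⊆ Set.Iio 0 → tsupport (oneSubDeriv ψ) ⊆ Set.Iio 0 := fun ψ hψ ↦ by
    have : tsupport (ψ - SchwartzMap.derivCLM ℂ ℂ ψ : 𝓢(ℝ, ℂ)) ⊆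
        tsupport ψ ∪ tsupport (SchwartzMap.derivCLM ℂ ℂ ψ) := tsupport_sub _ _
    refine this.trans (Set.union_subset hψ ((SchwartzMap.tsupport_derivCLM_subset ℂ ψ).trans hψ))
  by_contra hne
  have : t < 0 := h _ (h φ hφ) (subset_tsupport _ hne)
  linarith

/-- On `e^{-st}` the operator `1 - d/dt` is multiplication by `1 + s`. The computation runs on the
open set `t > -1`, where the cutoff is `1`, so that derivatives at `t = 0` see only the exponential.
-/
lemma oneSubDerivSq_expTest (s : ℂ) (hs : 0 < s.re) {t : ℝ} (ht : 0 ≤ t) :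
    oneSubDerivSq (expTest s hs) t = (1 + s) ^ 2 * exp (-s * t) := by
  have hd : ∀ (c : ℂ) (φ : 𝓢(ℝ, ℂ)), (∀ r : ℝ, -1 < r → φ r = c * exp (-s * r)) →
      ∀ r : ℝ, -1 < r → oneSubDeriv φ r =
        (c * (1 + s)) * exp (-s * r) := by
    intro c φ hφ r hr
    have h1 : HasDerivAt (fun r : ℝ ↦ c * exp (-s * r)) (c * (exp (-s * r) * (-s))) r := by
      have h1 : HasDerivAt (fun r : ℝ ↦ -s * (r : ℂ)) (-s) r := by
        simpa using (Complex.ofRealCLM.hasDerivAt (x := r)).const_mul (-s)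
      exact h1.cexp.const_mul c
    have h2 : (φ : ℝ → ℂ) =ᶠ[nhds r] fun r : ℝ ↦ c * exp (-s * r) := by
      filter_upwards [Ioi_mem_nhds hr] with r' hr' using hφ r' hr'
    rw [oneSubDeriv_apply, hφ r hr, h2.deriv_eq, h1.deriv]
    ring
  have h0 := hd 1 (expTest s hs) fun r hr ↦ by
    rw [expTest_apply, cutoff_eq_one hr.le]; simp
  rw [oneSubDerivSq, ContinuousLinearMap.comp_apply, hd _ _ h0 t (by linarith)]
  ring

/-- The weight has order `M + 2`: `M` powers absorb the growth of the original, and two more leave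
an integrable factor. -/
lemma one_add_abs_pow_mul_le (M : ℕ) (φ : 𝓢(ℝ, ℂ)) (t : ℝ) :
    (2 + |t|) ^ M * ‖φ t‖ ≤ 2 ^ M * (2 ^ (M + 2) * ((Finset.Iic (M + 2, 0)).sup
      (schwartzSeminormFamily ℂ ℝ ℂ)) φ) * (1 + t ^ 2)⁻¹ := by
  have h := SchwartzMap.one_add_le_sup_seminorm_apply (𝕜 := ℂ) (m := (M + 2, 0)) (k := M + 2)
    (n := 0) le_rfl le_rfl φ t
  rw [norm_iteratedFDeriv_zero, Real.norm_eq_abs] at h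
  rw [← div_eq_mul_inv, le_div_iff₀ (by positivity)]
  have h1 : 1 + t ^ 2 ≤ (1 + |t|) ^ 2 := by
    rw [← sq_abs t]; nlinarith [abs_nonneg t]
  have h2 : (2 + |t|) ^ M ≤ 2 ^ M * (1 + |t|) ^ M := by
    rw [← mul_pow]; gcongr; linarith [abs_nonneg t]
  calc (2 + |t|) ^ M * ‖φ t‖ * (1 + t ^ 2)
      ≤ 2 ^ M * (1 + |t|) ^ M * ‖φ t‖ * (1 + |t|) ^ 2 := by gcongr
    _ = 2 ^ M * ((1 + |t|) ^ (M + 2) * ‖φ t‖) := by ring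
    _ ≤ _ := mul_le_mul_of_nonneg_left h (by positivity)

/-- Functions on the half plane with polynomial bounds have inverse Laplace transforms, with a
bound that only depends on the bounds of the function. -/
theorem exists_isInverseLaplace (M : ℕ) : ∃ q : Seminorm ℂ 𝓢(ℝ, ℂ), Continuous q ∧
    ∀ (F : ℂ → ℂ) (C : ℝ), IsHalfPlaneBounded F C M →
      ∃ T : 𝓢'(ℝ, ℂ), IsInverseLaplace F T ∧ ∀ φ, ‖T φ‖ ≤ C * q φ := by
  set S : Seminorm ℂ 𝓢(ℝ, ℂ) := (Finset.Iic (M + 2, 0)).sup (schwartzSeminormFamily ℂ ℝ ℂ) with hS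
  have hSc : Continuous S := by
    rw [hS]
    exact Seminorm.continuous_finsetSup
      fun i _ ↦ (schwartz_withSeminorms ℂ ℝ ℂ).continuous_seminorm i
  -- The factor `3` comes from `norm_contourOriginal_le_pow`, the powers of two from
  -- `one_add_abs_pow_mul_le`, and `π` is the integral of `(1 + t²)⁻¹`.
  set A : ℝ := 3 * (2 ^ M * 2 ^ (M + 2)) * Real.pi with hA
  have hA0 : 0 ≤ A := by positivity
  refine ⟨(A.toNNReal • S).comp (oneSubDerivSq : 𝓢(ℝ, ℂ) →ₗ[ℂ] 𝓢(ℝ, ℂ)), ?_, fun F C h ↦ ?_⟩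
  · have : Continuous fun φ : 𝓢(ℝ, ℂ) ↦ A * S (oneSubDerivSq φ) :=
      continuous_const.mul (hSc.comp oneSubDerivSq.continuous)
    refine this.congr fun φ ↦ ?_
    simp [Seminorm.comp_apply, NNReal.smul_def, hA0]
  have hC := h.nonneg
  obtain ⟨hcont, hlap⟩ := h.continuous_contourOriginal
  set f := contourOriginal F 1
  have hb : ∀ (φ : 𝓢(ℝ, ℂ)) (t : ℝ), ‖f t * φ t‖ ≤
      C * (3 * (2 ^ M * (2 ^ (M + 2) * S φ))) * (1 + t ^ 2)⁻¹ := fun φ t ↦ by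
    rw [norm_mul]
    have h1 := h.norm_contourOriginal_le_pow t
    have h2 := one_add_abs_pow_mul_le M φ t
    calc ‖f t‖ * ‖φ t‖ ≤ C * (3 * (2 + |t|) ^ M) * ‖φ t‖ := by gcongr
      _ = C * (3 * ((2 + |t|) ^ M * ‖φ t‖)) := by ring
      _ ≤ C * (3 * (2 ^ M * (2 ^ (M + 2) * S φ) * (1 + t ^ 2)⁻¹)) := by gcongr
      _ = _ := by ring
  have hi : ∀ φ : 𝓢(ℝ, ℂ), Integrable fun t ↦ f t * φ t := fun φ ↦
    (integrable_inv_one_add_sq.const_mul _).mono'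
      (hcont.mul φ.continuous).aestronglyMeasurable (.of_forall (hb φ))
  have hbound : ∀ φ : 𝓢(ℝ, ℂ), ‖∫ t, f t * φ t‖ ≤ C * A * S φ := fun φ ↦ by
    refine (norm_integral_le_of_norm_le (integrable_inv_one_add_sq.const_mul _)
      (.of_forall (hb φ))).trans (le_of_eq ?_)
    rw [integral_const_mul, integral_univ_inv_one_add_sq, hA]
    ring
  let T₀ : 𝓢(ℝ, ℂ) →L[ℂ] ℂ := SchwartzMap.mkCLMtoNormedSpace (fun φ ↦ ∫ t, f t * φ t)
    (fun φ ψ ↦ by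
      rw [← integral_add (hi φ) (hi ψ)]
      simp [mul_add])
    (fun a φ ↦ by
      rw [RingHom.id_apply, smul_eq_mul, ← integral_const_mul]
      simp [mul_left_comm])
    ⟨Finset.Iic (M + 2, 0), C * A, by positivity, hbound⟩
  have hT₀ : ∀ φ, T₀ φ = ∫ t, f t * φ t := fun _ ↦ rfl
  -- This is `(1 + d/dt)²` of the function `f`, with the operator transposed onto the test function.
  let T : 𝓢(ℝ, ℂ) →L[ℂ] ℂ := T₀ ∘L oneSubDerivSq
  have hT : ∀ φ, T φ = ∫ t, f t * oneSubDerivSq φ t := fun _ ↦ rfl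
  refine ⟨T, ⟨fun φ hφ ↦ ?_, fun s hs ↦ ?_⟩, fun φ ↦ ?_⟩
  · refine (hT φ).trans (integral_eq_zero_of_ae (.of_forall fun t ↦ ?_))
    rcases lt_or_ge t 0 with ht | ht
    · simp [f, h.contourOriginal_eq_zero one_pos ht]
    · simp [oneSubDerivSq_apply_eq_zero hφ ht]
  · refine (hT _).trans ?_
    have e : ∀ t, f t * oneSubDerivSq (expTest s hs) t =
        (1 + s) ^ 2 * (exp (-s * t) * f t) := fun t ↦ by
      rcases lt_or_ge t 0 with ht | ht
      · simp [f, h.contourOriginal_eq_zero one_pos ht]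
      · rw [oneSubDerivSq_expTest s hs ht]; ring
    simp only [e]
    rw [integral_const_mul, (hlap s hs).2]
    field_simp [one_add_ne_zero_of_re_pos hs]
  · refine (hbound (oneSubDerivSq φ)).trans (le_of_eq ?_)
    simp [Seminorm.comp_apply, NNReal.smul_def, hA0, mul_assoc]

end InverseLaplaceExistence

/-! ### The functions `Φ` and the thermodynamical restriction -/

section Constitutive

open Complex ProbabilityTheory

variable {μ : Measure unitInterval} [IsFiniteMeasure μ] {s : ℂ}

/-- `Φ` is the moment generating function of `α` at `log s`. As `α` is bounded, that function is
entire, which gives holomorphy of `Φ`. -/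
lemma Phi_eq_complexMGF (μ : Measure unitInterval) (hs : s ≠ 0) :
    Phi μ s = complexMGF (fun α : unitInterval ↦ (α : ℝ)) μ (log s) := by
  unfold Phi complexMGF
  congr 1
  ext α
  rw [cpow_def_of_ne_zero hs]

lemma ne_zero_of_re_pos (hs : 0 < s.re) : s ≠ 0 := by
  rintro rfl
  simp at hs

lemma differentiableOn_Phi : DifferentiableOn ℂ (Phi μ) {s | 0 < s.re} := by
  have huniv : integrableExpSet (fun α : unitInterval ↦ (α : ℝ)) μ = Set.univ :=
    Set.eq_univ_of_forall fun t ↦ Continuous.integrable_of_hasCompactSupport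
      (by fun_prop) (HasCompactSupport.of_compactSpace _)
  have hd : DifferentiableOn ℂ (complexMGF (fun α : unitInterval ↦ (α : ℝ)) μ) Set.univ := by
    have := differentiableOn_complexMGF (X := fun α : unitInterval ↦ (α : ℝ)) (μ := μ)
    simpa [huniv] using this
  have hlog : DifferentiableOn ℂ log {s | 0 < s.re} := fun s hs ↦
    (differentiableAt_log (Or.inl hs)).differentiableWithinAt
  refine (hd.comp hlog fun _ _ ↦ Set.mem_univ _).congr fun s hs ↦ ?_
  exact Phi_eq_complexMGF μ (ne_zero_of_re_pos hs)

lemma integrable_cpow (hs : s ≠ 0) :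
    Integrable (fun α : unitInterval ↦ s ^ ((α : ℝ) : ℂ)) μ := by
  refine Continuous.integrable_of_hasCompactSupport ?_ (HasCompactSupport.of_compactSpace _)
  exact Continuous.const_cpow (by fun_prop) (Or.inl hs)

lemma norm_Phi_le : ‖Phi μ s‖ ≤ max 1 ‖s‖ * μ.real Set.univ := by
  unfold Phi
  refine norm_integral_le_of_norm_le_const (.of_forall fun α ↦ ?_)
  rw [norm_cpow_real]
  rcases le_total ‖s‖ 1 with h | h
  · exact (Real.rpow_le_one (norm_nonneg _) h α.2.1).trans (le_max_left _ _)
  · refine le_trans ?_ (le_max_right _ _)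
    simpa using Real.rpow_le_rpow_of_exponent_le h α.2.2

/-- On the half plane, the values `s ^ α`, `0 ≤ α ≤ 1`, lie in a sector of angle less than `π / 2`,
so there is no cancellation in `Φ`. -/
lemma le_norm_Phi (hs : 0 < s.re) : 1 / 2 * min 1 ‖s‖ * μ.real Set.univ ≤ ‖Phi μ s‖ := by
  have hs0 := ne_zero_of_re_pos hs
  have harg : |s.arg| < Real.pi / 2 := abs_arg_lt_pi_div_two_iff.2 (Or.inl hs)
  have hpos : 0 < ‖s‖ := norm_pos_iff.2 hs0
  -- This rotation centres the sector: the arguments become `(α - 1/2) arg s`, at most `π/4` in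
  -- size, so their cosines exceed `cos (π/3) = 1/2`.
  set c : ℂ := exp (-(s.arg / 2 : ℝ) * I) with hc
  have hcn : ‖c‖ = 1 := by rw [hc, ← ofReal_neg, norm_exp_ofReal_mul_I]
  have hre : ∀ α : unitInterval, (c * s ^ ((α : ℝ) : ℂ)).re =
      Real.exp (Real.log ‖s‖ * α) * Real.cos ((α - 1 / 2) * s.arg) := by
    intro α
    rw [hc, cpow_def_of_ne_zero hs0, ← exp_add, exp_re]
    congr 2
    · simp [log_re]
    · simp [log_im]; ring
  have hcos : ∀ α : unitInterval, 1 / 2 ≤ Real.cos ((α - 1 / 2) * s.arg) := by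
    intro α
    have h1 : |((α : ℝ) - 1 / 2) * s.arg| ≤ Real.pi / 4 := by
      rw [abs_mul]
      have : |(α : ℝ) - 1 / 2| ≤ 1 / 2 := abs_le.2 ⟨by linarith [α.2.1], by linarith [α.2.2]⟩
      calc _ ≤ 1 / 2 * (Real.pi / 2) := by gcongr
        _ = _ := by ring
    refine Real.cos_pi_div_three.symm.le.trans ?_
    rw [← Real.cos_abs (_ * _)]
    exact Real.cos_le_cos_of_nonneg_of_le_pi (abs_nonneg _) (by linarith [Real.pi_pos])
      (by linarith [Real.pi_pos])
  have hexp : ∀ α : unitInterval, min 1 ‖s‖ ≤ Real.exp (Real.log ‖s‖ * α) := by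
    intro α
    rw [← Real.rpow_def_of_pos hpos]
    rcases le_total ‖s‖ 1 with h | h
    · refine (min_le_right _ _).trans ?_
      simpa using Real.rpow_le_rpow_of_exponent_ge hpos h α.2.2
    · exact (min_le_left _ _).trans (Real.one_le_rpow h α.2.1)
  have hmin : 0 ≤ min 1 ‖s‖ := le_min zero_le_one hpos.le
  calc 1 / 2 * min 1 ‖s‖ * μ.real Set.univ
      = ∫ _ : unitInterval, 1 / 2 * min 1 ‖s‖ ∂μ := by
        rw [integral_const, smul_eq_mul, mul_comm]
    _ ≤ ∫ α : unitInterval, (c * s ^ ((α : ℝ) : ℂ)).re ∂μ := by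
        refine integral_mono (integrable_const _) ((integrable_cpow hs0).const_mul c).re
          fun α ↦ ?_
        rw [hre, mul_comm (1 / 2 : ℝ)]
        exact mul_le_mul (hexp α) (hcos α) (by norm_num) (Real.exp_pos _).le
    _ = (c * Phi μ s).re := by
        rw [Phi, ← integral_const_mul]
        exact integral_re ((integrable_cpow hs0).const_mul c)
    _ ≤ ‖c * Phi μ s‖ := re_le_norm _
    _ = ‖Phi μ s‖ := by rw [norm_mul, hcn, one_mul]

lemma Phi_ne_zero (hμ : μ ≠ 0) (hs : 0 < s.re) : Phi μ s ≠ 0 := by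
  have hm : 0 < μ.real Set.univ := by
    rw [measureReal_def, ENNReal.toReal_pos_iff]
    exact ⟨Measure.measure_univ_pos.2 hμ, measure_lt_top _ _⟩
  have hpos : 0 < ‖s‖ := norm_pos_iff.2 (ne_zero_of_re_pos hs)
  have := le_norm_Phi (μ := μ) hs
  refine norm_pos_iff.1 (lt_of_lt_of_le ?_ this)
  have : 0 < min 1 ‖s‖ := lt_min one_pos hpos
  positivity

/-- The function `Φ_ε(s) / (s Φ_σ(s))` satisfies polynomial bounds on the half plane. -/
lemma isHalfPlaneBounded_Phi_div (μσ με : Measure unitInterval) [IsFiniteMeasure μσ]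
    [IsFiniteMeasure με] (hσ : μσ ≠ 0) :
    IsHalfPlaneBounded (fun s ↦ Phi με s / Phi μσ s / s)
      (2 * με.real Set.univ / μσ.real Set.univ) 2 where
  differentiableOn := (differentiableOn_Phi.div differentiableOn_Phi
    fun _ hs ↦ Phi_ne_zero hσ hs).div differentiableOn_id fun _ hs ↦ ne_zero_of_re_pos hs
  norm_le s hs := by
    have hm : 0 < μσ.real Set.univ := by
      rw [measureReal_def, ENNReal.toReal_pos_iff]
      exact ⟨Measure.measure_univ_pos.2 hσ, measure_lt_top _ _⟩
    have hpos : 0 < ‖s‖ := norm_pos_iff.2 (ne_zero_of_re_pos hs)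
    have hmin : 0 < min 1 ‖s‖ := lt_min one_pos hpos
    have h1 := norm_Phi_le (μ := με) (s := s)
    have h2 := le_norm_Phi (μ := μσ) hs
    have hre : s.re ≤ ‖s‖ := re_le_norm s
    -- The left side is `1/|s|²` for `|s| ≤ 1` and `1` for `|s| ≥ 1`. Dividing by `s` is what
    -- removes the growth at infinity.
    have h3 : max 1 ‖s‖ / (min 1 ‖s‖ * ‖s‖) ≤ (1 + 1 / s.re) ^ 2 := by
      have h4 : (1 + 1 / ‖s‖) ^ 2 ≤ (1 + 1 / s.re) ^ 2 := by gcongr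
      refine le_trans ?_ h4
      rw [div_le_iff₀ (by positivity)]
      have h5 : (1 + 1 / ‖s‖) ^ 2 = (‖s‖ + 1) ^ 2 / ‖s‖ ^ 2 := by field_simp
      rw [h5]
      rcases le_total ‖s‖ 1 with h | h
      · rw [max_eq_left h, min_eq_right h, div_mul_eq_mul_div, le_div_iff₀ (by positivity)]
        nlinarith [mul_pos hpos hpos, mul_nonneg (mul_pos hpos hpos).le hpos.le]
      · rw [max_eq_right h, min_eq_left h, div_mul_eq_mul_div, le_div_iff₀ (by positivity)]
        nlinarith [mul_pos hpos hpos]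
    rw [norm_div, norm_div]
    calc ‖Phi με s‖ / ‖Phi μσ s‖ / ‖s‖
        ≤ (max 1 ‖s‖ * με.real Set.univ) / (1 / 2 * min 1 ‖s‖ * μσ.real Set.univ) / ‖s‖ := by
          gcongr
      _ = 2 * με.real Set.univ / μσ.real Set.univ * (max 1 ‖s‖ / (min 1 ‖s‖ * ‖s‖)) := by
          field_simp
      _ ≤ _ := by gcongr

lemma measurableSet_triangle : MeasurableSet triangle :=
  measurableSet_lt measurable_snd measurable_fst

lemma ThermodynamicalRestriction.restrict_le {μσ με : Measure unitInterval} [IsFiniteMeasure μσ]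
    [IsFiniteMeasure με] (hT : ThermodynamicalRestriction μσ με) :
    (μσ.prod με).restrict triangle ≤ (με.prod μσ).restrict triangle := by
  refine Measure.le_iff.2 fun A hA ↦ ?_
  have hm := hA.inter measurableSet_triangle
  rw [Measure.restrict_apply hA, Measure.restrict_apply hA]
  have := VectorMeasure.subset_le_of_restrict_le_restrict _ _ measurableSet_triangle hT
    (j := A ∩ triangle) Set.inter_subset_right
  rw [sub_apply, Measure.toSignedMeasure_apply_measurable hm,
    Measure.toSignedMeasure_apply_measurable hm, zero_apply, sub_nonneg] at this
  exact (ENNReal.toReal_le_toReal (measure_ne_top _ _) (measure_ne_top _ _)).1 this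

/-- The square is split into the triangle, its reflection and the diagonal. The reflected part is an
integral of `k ∘ swap` over the triangle against `μσ × με`. Since `k ≥ 0` on the triangle, (T)
allows the measure `με × μσ` there to be lowered to `μσ × με`; the two parts then combine to the
integral of `k + k ∘ swap`. -/
lemma ThermodynamicalRestriction.integral_nonneg {μσ με : Measure unitInterval}
    [IsFiniteMeasure μσ] [IsFiniteMeasure με] (hT : ThermodynamicalRestriction μσ με)
    {k : unitInterval × unitInterval → ℝ} (hk : Continuous k) (h1 : ∀ p ∈ triangle, 0 ≤ k p)
    (h2 : ∀ α, 0 ≤ k (α, α)) (h3 : ∀ p ∈ triangle, 0 ≤ k p + k p.swap) :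
    0 ≤ ∫ p, k p ∂(με.prod μσ) := by
  have hint : ∀ (ν : Measure (unitInterval × unitInterval)) [IsFiniteMeasure ν]
      (f : unitInterval × unitInterval → ℝ), Continuous f → Integrable f ν := fun ν _ f hf ↦
    hf.integrable_of_hasCompactSupport (HasCompactSupport.of_compactSpace _)
  have hsw : MeasurableSet (Prod.swap ⁻¹' triangle) := measurable_swap measurableSet_triangle
  have hdisj : Disjoint triangle (Prod.swap ⁻¹' triangle) := by
    rw [Set.disjoint_left]
    rintro p (hp : p.2 < p.1) (hp' : p.1 < p.2)
    exact lt_asymm hp hp'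
  rw [← integral_add_compl (measurableSet_triangle.union hsw) (hint _ k hk),
    setIntegral_union hdisj hsw (hint _ k hk).integrableOn (hint _ k hk).integrableOn]
  have hdiag : 0 ≤ ∫ p in (triangle ∪ Prod.swap ⁻¹' triangle)ᶜ, k p ∂(με.prod μσ) := by
    refine setIntegral_nonneg (measurableSet_triangle.union hsw).compl fun p hp ↦ ?_
    have hp1 : ¬ p.2 < p.1 := fun h ↦ hp (Or.inl h)
    have hp2 : ¬ p.1 < p.2 := fun h ↦ hp (Or.inr h)
    have : p = (p.1, p.1) := Prod.ext rfl (le_antisymm (not_lt.1 hp2) (not_lt.1 hp1))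
    rw [this]
    exact h2 _
  have hswap : ∫ p in Prod.swap ⁻¹' triangle, k p ∂(με.prod μσ) =
      ∫ p in triangle, k p.swap ∂(μσ.prod με) := by
    have := (Measure.measurePreserving_swap (μ := με) (ν := μσ)).setIntegral_preimage_emb
      MeasurableEquiv.prodComm.measurableEmbedding (fun p ↦ k p.swap) triangle
    simpa using this
  have hmono : ∫ p in triangle, k p ∂(μσ.prod με) ≤ ∫ p in triangle, k p ∂(με.prod μσ) := by
    refine integral_mono_measure hT.restrict_le ?_ (hint _ k hk).integrableOn
    filter_upwards [ae_restrict_mem measurableSet_triangle] with p hp using h1 p hp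
  have hsum : 0 ≤ ∫ p in triangle, k p ∂(μσ.prod με) +
      ∫ p in triangle, k p.swap ∂(μσ.prod με) := by
    rw [← integral_add (hint _ k hk).integrableOn
      (hint _ (fun p ↦ k p.swap) (hk.comp continuous_swap)).integrableOn]
    exact setIntegral_nonneg measurableSet_triangle h3
  rw [hswap]
  linarith

/-- The thermodynamical restriction makes `Φ_ε(s) / (s Φ_σ(s))` a function with nonnegative real
part on the half plane. -/
theorem ThermodynamicalRestriction.re_nonneg {μσ με : Measure unitInterval}
    [IsFiniteMeasure μσ] [IsFiniteMeasure με] (hT : ThermodynamicalRestriction μσ με)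
    (hs : 0 < s.re) : 0 ≤ (Phi με s / Phi μσ s / s).re := by
  have hs0 := ne_zero_of_re_pos hs
  have harg : |s.arg| < Real.pi / 2 := abs_arg_lt_pi_div_two_iff.2 (Or.inl hs)
  set θ := s.arg
  -- The real part of `s^α · conj (s^β) · conj s`, which integrates to `Re (Φ_ε · conj Φ_σ · conj
  -- s)`. This has the sign of `Re (Φ_ε / (Φ_σ s))`.
  set k : unitInterval × unitInterval → ℝ := fun p ↦
    Real.exp ((p.1 + p.2 + 1) * Real.log ‖s‖) * Real.cos ((p.1 - p.2 - 1) * θ) with hk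
  have hkc : Continuous k := by fun_prop
  have hcos : ∀ x : ℝ, |x| ≤ 1 → 0 ≤ Real.cos (x * θ) := fun x hx ↦ by
    have h1 : |x * θ| ≤ Real.pi / 2 := by
      rw [abs_mul]
      calc |x| * |θ| ≤ 1 * (Real.pi / 2) := by gcongr
        _ = _ := one_mul _
    exact Real.cos_nonneg_of_neg_pi_div_two_le_of_le (abs_le.1 h1).1 (abs_le.1 h1).2
  have hnn := hT.integral_nonneg hkc
    (fun p (hp : p.2 < p.1) ↦ by
      have hp' : (p.2 : ℝ) < p.1 := hp
      exact mul_nonneg (Real.exp_pos _).le (hcos _ (abs_le.2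
        ⟨by linarith, by linarith [p.1.2.2, p.2.2.1]⟩)))
    (fun α ↦ mul_nonneg (Real.exp_pos _).le (hcos _ (by simp)))
    (fun p (hp : p.2 < p.1) ↦ by
      have hp' : (p.2 : ℝ) < p.1 := hp
      -- The exponential is symmetric in the two exponents, so the addition formulas apply to the
      -- cosines; both resulting angles are at most `π/2` in size.
      have e : k p + k p.swap = Real.exp ((p.1 + p.2 + 1) * Real.log ‖s‖) *
          (2 * Real.cos ((p.1 - p.2) * θ) * Real.cos (1 * θ)) := by
        simp only [hk, Prod.fst_swap, Prod.snd_swap]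
        rw [add_comm (p.2 : ℝ) p.1, ← mul_add]
        congr 1
        rw [show ((p.1 : ℝ) - p.2 - 1) * θ = (p.1 - p.2) * θ - 1 * θ by ring,
          show ((p.2 : ℝ) - p.1 - 1) * θ = -((p.1 - p.2) * θ + 1 * θ) by ring, Real.cos_neg,
          Real.cos_sub, Real.cos_add]
        ring
      rw [e]
      have c1 := hcos (p.1 - p.2) (abs_le.2 ⟨by linarith, by linarith [p.1.2.2, p.2.2.1]⟩)
      have c2 := hcos 1 (by simp)
      positivity)
  have hprod : (Phi με s * (starRingEnd ℂ) (Phi μσ s) * (starRingEnd ℂ) s).re =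
      ∫ p, k p ∂(με.prod μσ) := by
    unfold Phi
    rw [← integral_conj, ← integral_prod_mul, ← integral_mul_const]
    have hc : Continuous fun p : unitInterval × unitInterval ↦ s ^ (((p.1 : ℝ)) : ℂ) *
        (starRingEnd ℂ) (s ^ ((p.2 : ℝ) : ℂ)) * (starRingEnd ℂ) s := by
      have h1 : Continuous fun p : unitInterval × unitInterval ↦ s ^ (((p.1 : ℝ)) : ℂ) :=
        Continuous.const_cpow (by fun_prop) (Or.inl hs0)
      have h2 : Continuous fun p : unitInterval × unitInterval ↦ s ^ (((p.2 : ℝ)) : ℂ) :=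
        Continuous.const_cpow (by fun_prop) (Or.inl hs0)
      exact (h1.mul (continuous_conj.comp h2)).mul continuous_const
    refine (integral_re (hc.integrable_of_hasCompactSupport
      (HasCompactSupport.of_compactSpace _))).symm.trans ?_
    congr 1
    ext p
    change (s ^ (((p.1 : ℝ)) : ℂ) * (starRingEnd ℂ) (s ^ ((p.2 : ℝ) : ℂ)) *
      (starRingEnd ℂ) s).re = _
    have e : s ^ (((p.1 : ℝ)) : ℂ) * (starRingEnd ℂ) (s ^ ((p.2 : ℝ) : ℂ)) * (starRingEnd ℂ) s =
        exp (log s * p.1 + (starRingEnd ℂ) (log s * p.2) + (starRingEnd ℂ) (log s)) := by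
      rw [exp_add, exp_add, exp_conj, exp_conj, exp_log hs0, cpow_def_of_ne_zero hs0,
        cpow_def_of_ne_zero hs0]
    rw [e, exp_re]
    simp only [hk]
    congr 2
    · simp [log_re]; ring
    · simp [log_im, θ]; ring
  rw [div_div, div_eq_mul_inv, inv_def, ← mul_assoc, map_mul, ← mul_assoc, re_mul_ofReal, hprod]
  exact mul_nonneg hnn (inv_nonneg.2 (normSq_nonneg _))

end Constitutive

/-! ### A criterion for operators into the Schwartz space -/

section SchwartzOperator

variable {V : Type*} [NormedAddCommGroup V] [NormedSpace ℝ V]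

/-- A family of linear operators `A n` from Schwartz functions to functions on the line that is
bounded and closed under multiplication by the variable and under differentiation takes values in
the Schwartz functions, continuously. -/
theorem exists_schwartzCLM_of_hasDerivAt (A : ℕ → 𝓢(V, ℂ) →ₗ[ℂ] (ℝ → ℂ))
    (P X : 𝓢(V, ℂ) →L[ℂ] 𝓢(V, ℂ)) (c : ℕ → ℂ)
    (hP : ∀ n Φ (ξ : ℝ), ξ * A n Φ ξ = A n (P Φ) ξ)
    (hd : ∀ n Φ (ξ : ℝ), HasDerivAt (A n Φ) (c n * A (n + 1) (P Φ) ξ + A n (X Φ) ξ) ξ)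
    (hb : ∀ n, ∃ q : Seminorm ℂ 𝓢(V, ℂ), Continuous q ∧ ∀ Φ ξ, ‖A n Φ ξ‖ ≤ q Φ) (n : ℕ) :
    ∃ B : 𝓢(V, ℂ) →L[ℂ] 𝓢(ℝ, ℂ), ∀ Φ ξ, B Φ ξ = A n Φ ξ := by
  have hderiv : ∀ n Φ, deriv (A n Φ) = fun ξ ↦ c n * A (n + 1) (P Φ) ξ + A n (X Φ) ξ :=
    fun n Φ ↦ funext fun ξ ↦ (hd n Φ ξ).deriv
  have hsmooth : ∀ (m : ℕ) n Φ, ContDiff ℝ m (A n Φ) := by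
    intro m
    induction m with
    | zero =>
      exact fun n Φ ↦ contDiff_zero.2 (continuous_iff_continuousAt.2 fun ξ ↦ (hd n Φ ξ).continuousAt)
    | succ m ih =>
      intro n Φ
      rw [Nat.cast_add, Nat.cast_one, contDiff_succ_iff_deriv]
      refine ⟨fun ξ ↦ (hd n Φ ξ).differentiableAt, by simp, ?_⟩
      rw [hderiv]
      exact (contDiff_const.mul (ih _ _)).add (ih _ _)
  -- Each factor `ξ` is absorbed by `P`, which settles `m = 0`. A derivative raises `n`, so the
  -- induction on `m` is carried out for all `k` and `n` at once.
  have hbound : ∀ (m k n : ℕ), ∃ q : Seminorm ℂ 𝓢(V, ℂ), Continuous q ∧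
      ∀ Φ ξ, ‖ξ‖ ^ k * ‖iteratedDeriv m (A n Φ) ξ‖ ≤ q Φ := by
    intro m
    induction m with
    | zero =>
      intro k n
      induction k with
      | zero => simpa using hb n
      | succ k ih =>
        obtain ⟨q, hq, h⟩ := ih
        refine ⟨q.comp (P : 𝓢(V, ℂ) →ₗ[ℂ] 𝓢(V, ℂ)), hq.comp P.continuous, fun Φ ξ ↦ ?_⟩
        have := h (P Φ) ξ
        rw [iteratedDeriv_zero, ← hP, norm_mul, Complex.norm_real] at this
        rw [iteratedDeriv_zero, pow_succ, mul_assoc]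
        exact this
    | succ m ih =>
      intro k n
      obtain ⟨q₁, hq₁, h₁⟩ := ih k (n + 1)
      obtain ⟨q₂, hq₂, h₂⟩ := ih k n
      refine ⟨‖c n‖₊ • q₁.comp (P : 𝓢(V, ℂ) →ₗ[ℂ] 𝓢(V, ℂ)) + q₂.comp (X : 𝓢(V, ℂ) →ₗ[ℂ] 𝓢(V, ℂ)),
        ?_, fun Φ ξ ↦ ?_⟩
      · exact ((hq₁.comp P.continuous).const_smul (‖c n‖₊ : ℝ)).add (hq₂.comp X.continuous)
      · have e : iteratedDeriv (m + 1) (A n Φ) ξ =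
            c n * iteratedDeriv m (A (n + 1) (P Φ)) ξ + iteratedDeriv m (A n (X Φ)) ξ := by
          rw [iteratedDeriv_succ', hderiv, iteratedDeriv_fun_add
            (contDiff_const.mul (hsmooth _ _ _)).contDiffAt (hsmooth _ _ _).contDiffAt,
            iteratedDeriv_const_mul_field]
        rw [e]
        have h3 := h₁ (P Φ) ξ
        have h4 := h₂ (X Φ) ξ
        calc _ ≤ ‖ξ‖ ^ k * (‖c n‖ * ‖iteratedDeriv m (A (n + 1) (P Φ)) ξ‖ +
              ‖iteratedDeriv m (A n (X Φ)) ξ‖) := by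
              gcongr
              exact (norm_add_le _ _).trans_eq (by rw [norm_mul])
          _ = ‖c n‖ * (‖ξ‖ ^ k * ‖iteratedDeriv m (A (n + 1) (P Φ)) ξ‖) +
              ‖ξ‖ ^ k * ‖iteratedDeriv m (A n (X Φ)) ξ‖ := by ring
          _ ≤ ‖c n‖ * q₁ (P Φ) + q₂ (X Φ) := by gcongr
  refine ⟨SchwartzMap.mkCLM (fun Φ ↦ A n Φ) (fun Φ Ψ ξ ↦ by simp) (fun a Φ ξ ↦ by simp)
    (fun Φ ↦ contDiff_infty.2 fun m ↦ hsmooth m n Φ) ?_, fun Φ ξ ↦ rfl⟩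
  rintro ⟨k, m⟩
  obtain ⟨q, hq, h⟩ := hbound m k n
  obtain ⟨s, C, -, hC⟩ := Seminorm.bound_of_continuous (schwartz_withSeminorms ℂ V ℂ) q hq
  refine ⟨s, C, C.2, fun Φ ξ ↦ ?_⟩
  rw [norm_iteratedFDeriv_eq_norm_iteratedDeriv]
  exact (h Φ ξ).trans (hC Φ)

end SchwartzOperator

/-! ### Algebra of inverse Laplace transforms and of half-plane bounds -/

section InverseLaplaceAlgebra

variable {F G : ℂ → ℂ} {S T : 𝓢'(ℝ, ℂ)}

lemma IsInverseLaplace.sub (hF : IsInverseLaplace F S) (hG : IsInverseLaplace G T) :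
    IsInverseLaplace (fun s ↦ F s - G s) (S - T) where
  vanishes f hf := by
    change S f - T f = 0
    rw [hF.vanishes f hf, hG.vanishes f hf, sub_zero]
  laplace_eq s hs := congrArg₂ (· - ·) (hF.laplace_eq s hs) (hG.laplace_eq s hs)

lemma IsInverseLaplace.const_mul (hF : IsInverseLaplace F S) (c : ℂ) :
    IsInverseLaplace (fun s ↦ c * F s) (c • S) where
  vanishes f hf := by
    change c • S f = 0
    rw [hF.vanishes f hf, smul_zero]
  laplace_eq s hs := congrArg (c * ·) (hF.laplace_eq s hs)

end InverseLaplaceAlgebra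

section HalfPlaneAlgebra

variable {F G : ℂ → ℂ} {C C' : ℝ} {M M' : ℕ}

lemma IsHalfPlaneBounded.mul (hF : IsHalfPlaneBounded F C M) (hG : IsHalfPlaneBounded G C' M') :
    IsHalfPlaneBounded (fun s ↦ F s * G s) (C * C') (M + M') where
  differentiableOn := hF.differentiableOn.mul hG.differentiableOn
  norm_le s hs := by
    have h := mul_le_mul (hF.norm_le s hs) (hG.norm_le s hs) (norm_nonneg _)
      (mul_nonneg hF.nonneg (by positivity))
    rw [norm_mul]
    exact h.trans_eq (by ring)

lemma IsHalfPlaneBounded.pow (hF : IsHalfPlaneBounded F C M) (n : ℕ) :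
    IsHalfPlaneBounded (fun s ↦ F s ^ n) (C ^ n) (M * n) where
  differentiableOn := hF.differentiableOn.pow n
  norm_le s hs := by
    rw [norm_pow, pow_mul, ← mul_pow]
    exact pow_le_pow_left₀ (norm_nonneg _) (hF.norm_le s hs) n

end HalfPlaneAlgebra

/-! ### The Fourier-Laplace symbols -/

section ResolventSymbol

variable {F₀ b : ℂ → ℂ} {C₀ Cb : ℝ} {M₀ Mb : ℕ}

/-- The denominator `s + 4π²ξ² b(s)` of the Fourier-Laplace symbol. -/
def resolventDenom (b : ℂ → ℂ) (ξ : ℝ) (s : ℂ) : ℂ := s + (4 * Real.pi ^ 2 * ξ ^ 2 : ℝ) * b s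

/-- The symbol `F₀ bⁿ / (s + 4π²ξ² b)ⁿ⁺¹`. -/
def resolventSymbol (F₀ b : ℂ → ℂ) (n : ℕ) (ξ : ℝ) (s : ℂ) : ℂ :=
  F₀ s * b s ^ n * ((resolventDenom b ξ s)⁻¹) ^ (n + 1)

/-- The use of `Re b ≥ 0`: the frequency term can only increase the real part. All bounds on the
inverse that are uniform in `ξ` come from here. -/
lemma re_le_re_resolventDenom (ξ : ℝ) {s : ℂ} (hs : 0 ≤ (b s).re) :
    s.re ≤ (resolventDenom b ξ s).re := by
  rw [resolventDenom, Complex.add_re, Complex.re_ofReal_mul]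
  have : 0 ≤ 4 * Real.pi ^ 2 * ξ ^ 2 * (b s).re := by positivity
  linarith

lemma isHalfPlaneBounded_inv_resolventDenom (hb : IsHalfPlaneBounded b Cb Mb)
    (hre : ∀ s : ℂ, 0 < s.re → 0 ≤ (b s).re) (ξ : ℝ) :
    IsHalfPlaneBounded (fun s ↦ (resolventDenom b ξ s)⁻¹) 1 1 where
  differentiableOn := by
    refine DifferentiableOn.inv ?_ fun s hs ↦
      ne_zero_of_re_pos (lt_of_lt_of_le hs (re_le_re_resolventDenom ξ (hre s hs)))
    exact differentiableOn_id.add (hb.differentiableOn.const_mul _)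
  norm_le s hs := by
    have h1 := (re_le_re_resolventDenom ξ (hre s hs)).trans (Complex.re_le_norm _)
    rw [norm_inv, one_mul, pow_one]
    have h2 := inv_anti₀ hs h1
    rw [one_div]
    linarith

/-- Neither the constant nor the exponent involves `ξ`, so the inverse Laplace transforms are
bounded uniformly in the frequency. -/
lemma isHalfPlaneBounded_resolventSymbol (hF : IsHalfPlaneBounded F₀ C₀ M₀)
    (hb : IsHalfPlaneBounded b Cb Mb) (hre : ∀ s : ℂ, 0 < s.re → 0 ≤ (b s).re) (n : ℕ) (ξ : ℝ) :
    IsHalfPlaneBounded (resolventSymbol F₀ b n ξ) (C₀ * Cb ^ n) (M₀ + Mb * n + (n + 1)) := by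
  have := (hF.mul (hb.pow n)).mul ((isHalfPlaneBounded_inv_resolventDenom hb hre ξ).pow (n + 1))
  rwa [one_pow, mul_one, one_mul] at this

/-- The power `bⁿ` in the symbol is there to make the family closed under `∂/∂ξ`, up to the factor
`ξ`. -/
lemma hasDerivAt_resolventSymbol (n : ℕ) (ξ : ℝ) {s : ℂ} (hs : 0 < s.re) (hre : 0 ≤ (b s).re) :
    HasDerivAt (fun ξ ↦ resolventSymbol F₀ b n ξ s)
      (-(n + 1) * (8 * Real.pi ^ 2 * ξ) * resolventSymbol F₀ b (n + 1) ξ s) ξ := by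
  have hne : resolventDenom b ξ s ≠ 0 :=
    ne_zero_of_re_pos (lt_of_lt_of_le hs (re_le_re_resolventDenom ξ hre))
  have h1 : HasDerivAt (fun ξ : ℝ ↦ ((4 * Real.pi ^ 2 * ξ ^ 2 : ℝ) : ℂ))
      ((8 * Real.pi ^ 2 * ξ : ℝ) : ℂ) ξ := by
    refine HasDerivAt.ofReal_comp ?_
    refine ((hasDerivAt_pow 2 ξ).const_mul (4 * Real.pi ^ 2)).congr_deriv ?_
    push_cast
    ring
  have h2 : HasDerivAt (fun ξ ↦ resolventDenom b ξ s) ((8 * Real.pi ^ 2 * ξ : ℝ) * b s) ξ :=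
    (h1.mul_const (b s)).const_add s
  have h3 := ((h2.fun_inv hne).fun_pow (n + 1)).const_mul (F₀ s * b s ^ n)
  refine h3.congr_deriv ?_
  simp only [resolventSymbol, Nat.add_sub_cancel]
  rw [div_eq_mul_inv, ← inv_pow]
  push_cast
  ring

/-- Second order Taylor estimate. -/
lemma norm_taylor_two_le {f f' f'' : ℝ → ℂ} (hf : ∀ x, HasDerivAt f (f' x) x)
    (hf' : ∀ x, HasDerivAt f' (f'' x) x) {x h K : ℝ} (hK : ∀ y, |y - x| ≤ |h| → ‖f'' y‖ ≤ K) :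
    ‖f (x + h) - f x - h * f' x‖ ≤ K * h ^ 2 := by
  have hconv : Convex ℝ (Set.uIcc x (x + h)) := convex_uIcc x (x + h)
  have hmem : ∀ y ∈ Set.uIcc x (x + h), |y - x| ≤ |h| := fun y hy ↦ by
    have := Set.abs_sub_left_of_mem_uIcc hy
    rwa [add_sub_cancel_left] at this
  have hK0 : 0 ≤ K := (norm_nonneg _).trans (hK x (by simp))
  have step1 : ∀ y ∈ Set.uIcc x (x + h), ‖f' y - f' x‖ ≤ K * |h| := fun y hy ↦ by
    have := hconv.norm_image_sub_le_of_norm_hasDerivWithin_le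
      (fun y _ ↦ (hf' y).hasDerivWithinAt) (fun y hy ↦ hK y (hmem y hy)) Set.left_mem_uIcc hy
    refine this.trans ?_
    exact mul_le_mul_of_nonneg_left (hmem y hy) hK0
  have hg : ∀ y, HasDerivAt (fun y : ℝ ↦ f y - y * f' x) (f' y - f' x) y := fun y ↦ by
    have h1 : HasDerivAt (fun y : ℝ ↦ (y : ℂ)) 1 y := Complex.ofRealCLM.hasDerivAt
    exact ((hf y).sub (h1.mul_const (f' x))).congr_deriv (by rw [one_mul])
  have step2 := hconv.norm_image_sub_le_of_norm_hasDerivWithin_le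
    (fun y _ ↦ (hg y).hasDerivWithinAt) step1 Set.left_mem_uIcc Set.right_mem_uIcc
  have e : f (x + h) - f x - h * f' x =
      f (x + h) - ((x + h : ℝ) : ℂ) * f' x - (f x - (x : ℂ) * f' x) := by
    push_cast; ring
  rw [e]
  refine step2.trans_eq ?_
  rw [add_sub_cancel_left, Real.norm_eq_abs, ← sq_abs h]
  ring

/-- Taylor's estimate is used for each fixed `s`, and the remainder is again a holomorphic function
with half-plane bounds. Its original is therefore of order `h²`, which makes the originals
differentiable in `ξ`. The constant may depend on `ξ`, since only a pointwise derivative is needed.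
-/
lemma isHalfPlaneBounded_resolventSymbol_taylor (hF : IsHalfPlaneBounded F₀ C₀ M₀)
    (hb : IsHalfPlaneBounded b Cb Mb) (hre : ∀ s : ℂ, 0 < s.re → 0 ≤ (b s).re) (n : ℕ) (ξ : ℝ) :
    ∃ (K : ℝ) (M : ℕ), ∀ h : ℝ, |h| ≤ 1 → IsHalfPlaneBounded
      (fun s ↦ resolventSymbol F₀ b n (ξ + h) s - resolventSymbol F₀ b n ξ s -
        (h * (-(n + 1) * (8 * Real.pi ^ 2 * ξ))) * resolventSymbol F₀ b (n + 1) ξ s)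
      (K * h ^ 2) M := by
  have hs := isHalfPlaneBounded_resolventSymbol hF hb hre
  -- The first `ξ`-derivative brings out `-c ξ` and the next one `-c' ξ`. The second derivative thus
  -- involves the symbols of orders `n + 1` and `n + 2`, and `M₂` serves for both.
  set c : ℝ := (n + 1) * (8 * Real.pi ^ 2) with hc
  set c' : ℝ := (n + 2) * (8 * Real.pi ^ 2) with hc'
  set M₁ : ℕ := M₀ + Mb * (n + 1) + (n + 1 + 1) with hM₁
  set M₂ : ℕ := M₀ + Mb * (n + 2) + (n + 2 + 1) with hM₂
  have hM : M₁ ≤ M₂ := by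
    have : Mb * (n + 1) ≤ Mb * (n + 2) := Nat.mul_le_mul_left _ (by omega)
    omega
  have hC₀ := hF.nonneg
  have hCb := hb.nonneg
  refine ⟨c * (C₀ * Cb ^ (n + 1)) + c * c' * (|ξ| + 1) ^ 2 * (C₀ * Cb ^ (n + 2)), M₂, fun h hh ↦
    ⟨((hs n _).differentiableOn.sub (hs n _).differentiableOn).sub
      ((hs (n + 1) _).differentiableOn.const_mul _), fun s hsre ↦ ?_⟩⟩
  have hd := fun n ξ ↦ hasDerivAt_resolventSymbol (F₀ := F₀) n ξ hsre (hre s hsre)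
  have hd2 : ∀ x : ℝ, HasDerivAt
      (fun ξ : ℝ ↦ (-(n + 1) * (8 * Real.pi ^ 2 * ξ)) * resolventSymbol F₀ b (n + 1) ξ s)
      (-c * resolventSymbol F₀ b (n + 1) x s + c * c' * x ^ 2 * resolventSymbol F₀ b (n + 2) x s)
      x := fun x ↦ by
    have h1 : HasDerivAt (fun y : ℝ ↦ (y : ℂ)) 1 x := Complex.ofRealCLM.hasDerivAt
    have h2 := ((h1.const_mul (8 * (Real.pi : ℂ) ^ 2)).const_mul (-((n : ℂ) + 1))).mul (hd (n + 1) x)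
    refine h2.congr_deriv ?_
    simp only [hc, hc']
    push_cast
    ring
  have hX : 1 ≤ 1 + 1 / s.re := by
    have : 0 < 1 / s.re := by positivity
    linarith
  have key := norm_taylor_two_le (hd n) hd2 (x := ξ) (h := h)
    (K := (c * (C₀ * Cb ^ (n + 1)) + c * c' * (|ξ| + 1) ^ 2 * (C₀ * Cb ^ (n + 2))) *
      (1 + 1 / s.re) ^ M₂) fun y hy ↦ by
    have hy' : |y| ≤ |ξ| + 1 := by
      have := abs_sub_abs_le_abs_sub y ξ
      linarith
    have hc0 : 0 ≤ c := by positivity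
    have hc0' : 0 ≤ c' := by positivity
    have b1 := (hs (n + 1) y).norm_le s hsre
    have b2 := (hs (n + 2) y).norm_le s hsre
    refine (norm_add_le _ _).trans ?_
    simp only [norm_mul, norm_neg, norm_pow, Complex.norm_real, Real.norm_eq_abs,
      abs_of_nonneg hc0, abs_of_nonneg hc0']
    calc _ ≤ c * (C₀ * Cb ^ (n + 1) * (1 + 1 / s.re) ^ M₁) +
          c * c' * (|ξ| + 1) ^ 2 * (C₀ * Cb ^ (n + 2) * (1 + 1 / s.re) ^ M₂) := by gcongr
      _ ≤ c * (C₀ * Cb ^ (n + 1) * (1 + 1 / s.re) ^ M₂) +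
          c * c' * (|ξ| + 1) ^ 2 * (C₀ * Cb ^ (n + 2) * (1 + 1 / s.re) ^ M₂) := by gcongr
      _ = _ := by ring
  calc _ = _ := by congr 1; ring
    _ ≤ _ := key
    _ = _ := by ring

/-- The inverse Laplace transforms of the symbols, with uniform bounds and a Taylor estimate in the
frequency variable. -/
theorem exists_isInverseLaplace_resolventSymbol (hF : IsHalfPlaneBounded F₀ C₀ M₀)
    (hb : IsHalfPlaneBounded b Cb Mb) (hre : ∀ s : ℂ, 0 < s.re → 0 ≤ (b s).re) :
    ∃ D : ℕ → ℝ → 𝓢'(ℝ, ℂ), (∀ n ξ, IsInverseLaplace (resolventSymbol F₀ b n ξ) (D n ξ)) ∧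
      (∀ n, ∃ q : Seminorm ℂ 𝓢(ℝ, ℂ), Continuous q ∧ ∃ C, 0 ≤ C ∧ ∀ ξ φ, ‖D n ξ φ‖ ≤ C * q φ) ∧
      ∀ n ξ, ∃ q : Seminorm ℂ 𝓢(ℝ, ℂ), Continuous q ∧ ∃ K, ∀ h : ℝ, |h| ≤ 1 →
        0 ≤ K * h ^ 2 ∧ ∀ φ,
        ‖(D n (ξ + h) - D n ξ - (h * (-(n + 1) * (8 * Real.pi ^ 2 * ξ) : ℂ)) • D (n + 1) ξ) φ‖ ≤
          K * h ^ 2 * q φ := by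
  have hs := isHalfPlaneBounded_resolventSymbol hF hb hre
  have hex : ∀ n ξ, ∃ T, IsInverseLaplace (resolventSymbol F₀ b n ξ) T := fun n ξ ↦ by
    obtain ⟨q, -, hq⟩ := exists_isInverseLaplace (M₀ + Mb * n + (n + 1))
    obtain ⟨T, hT, -⟩ := hq _ _ (hs n ξ)
    exact ⟨T, hT⟩
  choose D hD using hex
  refine ⟨D, hD, fun n ↦ ?_, fun n ξ ↦ ?_⟩
  · obtain ⟨q, hqc, hq⟩ := exists_isInverseLaplace (M₀ + Mb * n + (n + 1))
    refine ⟨q, hqc, _, (hs n 0).nonneg, fun ξ φ ↦ ?_⟩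
    -- The chosen `D n ξ` carries no estimate; uniqueness identifies it with `T`, which is bounded
    -- by the same `q` for every `ξ`.
    obtain ⟨T, hT, hTb⟩ := hq _ _ (hs n ξ)
    rw [eq_of_isInverseLaplace (hD n ξ) hT]
    exact hTb φ
  · obtain ⟨K, M, hK⟩ := isHalfPlaneBounded_resolventSymbol_taylor hF hb hre n ξ
    obtain ⟨q, hqc, hq⟩ := exists_isInverseLaplace M
    refine ⟨q, hqc, K, fun h hh ↦ ⟨(hK h hh).nonneg, fun φ ↦ ?_⟩⟩
    obtain ⟨T, hT, hTb⟩ := hq _ _ (hK h hh)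
    rw [eq_of_isInverseLaplace (((hD n (ξ + h)).sub (hD n ξ)).sub ((hD (n + 1) ξ).const_mul _)) hT]
    exact hTb φ

end ResolventSymbol

/-! ### Pairing in time followed by the Fourier transform in space -/

section FourierPairing

open FourierTransform

lemma fourier_apply_sub (f g : 𝓢(ℝ, ℂ)) (ξ : ℝ) : 𝓕 (f - g) ξ = 𝓕 f ξ - 𝓕 g ξ := by
  have := map_sub (fourierCLM ℂ 𝓢(ℝ, ℂ)) f g
  simp only [fourierCLM_apply] at this
  rw [this, sub_apply]

lemma fourier_apply_smul (c : ℂ) (f : 𝓢(ℝ, ℂ)) (ξ : ℝ) : 𝓕 (c • f) ξ = c * 𝓕 f ξ := by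
  have := map_smul (fourierCLM ℂ 𝓢(ℝ, ℂ)) c f
  simp only [fourierCLM_apply] at this
  rw [this, smul_apply, smul_eq_mul]

lemma fourier_apply_add (f g : 𝓢(ℝ, ℂ)) (ξ : ℝ) : 𝓕 (f + g) ξ = 𝓕 f ξ + 𝓕 g ξ := by
  have := map_add (fourierCLM ℂ 𝓢(ℝ, ℂ)) f g
  simp only [fourierCLM_apply] at this
  rw [this, add_apply]

lemma fourier_apply_deriv (f : 𝓢(ℝ, ℂ)) (ξ : ℝ) :
    𝓕 (SchwartzMap.derivCLM ℂ ℂ f) ξ = 2 * Real.pi * Complex.I * ξ * 𝓕 f ξ := by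
  have := congrFun (Real.fourier_deriv f.integrable f.differentiable
    (SchwartzMap.derivCLM ℂ ℂ f).integrable) ξ
  exact this

/-- The function `ξ ↦ ∫ e^{-2πixξ} ⟨T(t), Φ(x, t)⟩ dx`. -/
def fourierPairing (T : 𝓢'(ℝ, ℂ)) (Φ : 𝓢(ℝ × ℝ, ℂ)) : 𝓢(ℝ, ℂ) := 𝓕 (partialPairing T Φ)

/-- The operator `(2πi)⁻¹ ∂ₓ`. -/
def momentumCLM : 𝓢(ℝ × ℝ, ℂ) →L[ℂ] 𝓢(ℝ × ℝ, ℂ) :=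
  (2 * Real.pi * Complex.I : ℂ)⁻¹ • LineDeriv.lineDerivOpCLM ℂ 𝓢(ℝ × ℝ, ℂ) ((1 : ℝ), (0 : ℝ))

/-- Multiplication by `-2πix`. -/
def positionCLM : 𝓢(ℝ × ℝ, ℂ) →L[ℂ] 𝓢(ℝ × ℝ, ℂ) :=
  SchwartzMap.smulLeftCLM ℂ fun p : ℝ × ℝ ↦ (-2 * Real.pi * Complex.I : ℂ) * (p.1 : ℂ)

lemma positionCLM_apply (Φ : 𝓢(ℝ × ℝ, ℂ)) (x t : ℝ) :
    positionCLM Φ (x, t) = -2 * Real.pi * Complex.I * x * Φ (x, t) := by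
  have h : (fun p : ℝ × ℝ ↦ (-2 * Real.pi * Complex.I : ℂ) * (p.1 : ℂ)).HasTemperateGrowth :=
    (Function.HasTemperateGrowth.const _).mul
      (Complex.ofRealCLM ∘L ContinuousLinearMap.fst ℝ ℝ ℝ).hasTemperateGrowth
  rw [positionCLM, SchwartzMap.smulLeftCLM_apply_apply h, smul_eq_mul]

lemma partialPairing_lineDeriv_fst (T : 𝓢'(ℝ, ℂ)) (Φ : 𝓢(ℝ × ℝ, ℂ)) :
    partialPairing T (∂_{((1 : ℝ), (0 : ℝ))} Φ) =
      SchwartzMap.derivCLM ℂ ℂ (partialPairing T Φ) := by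
  ext x
  exact (hasDerivAt_slice T Φ x).deriv.symm

lemma partialPairing_positionCLM (T : 𝓢'(ℝ, ℂ)) (Φ : 𝓢(ℝ × ℝ, ℂ)) (x : ℝ) :
    partialPairing T (positionCLM Φ) x =
      (-2 * Real.pi * Complex.I * x) • partialPairing T Φ x := by
  rw [partialPairing_apply, partialPairing_apply, ← map_smul]
  congr 1
  ext t
  exact positionCLM_apply Φ x t

/-- A factor `ξ` can be moved onto the test function as a derivative in `x`; the next lemma does the
same for `∂/∂ξ` with multiplication by `x`. They provide the operators `P` and `X` of
`exists_schwartzCLM_of_hasDerivAt`. -/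
lemma mul_fourierPairing (T : 𝓢'(ℝ, ℂ)) (Φ : 𝓢(ℝ × ℝ, ℂ)) (ξ : ℝ) :
    ξ * fourierPairing T Φ ξ = fourierPairing T (momentumCLM Φ) ξ := by
  have h : partialPairing T (momentumCLM Φ) = (2 * Real.pi * Complex.I : ℂ)⁻¹ •
      SchwartzMap.derivCLM ℂ ℂ (partialPairing T Φ) := by
    rw [← partialPairing_lineDeriv_fst, ← map_smul]
    rfl
  rw [fourierPairing, fourierPairing, h, fourier_apply_smul, fourier_apply_deriv]
  have := Complex.two_pi_I_ne_zero
  field_simp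

lemma hasDerivAt_fourierPairing (T : 𝓢'(ℝ, ℂ)) (Φ : 𝓢(ℝ × ℝ, ℂ)) (ξ : ℝ) :
    HasDerivAt (fourierPairing T Φ) (fourierPairing T (positionCLM Φ) ξ) ξ := by
  set f := partialPairing T Φ with hf
  have hX : ∀ x, partialPairing T (positionCLM Φ) x = (-2 * Real.pi * Complex.I * x) • f x :=
    partialPairing_positionCLM T Φ
  have hint : Integrable (fun x : ℝ ↦ x • f x) := by
    have := ((partialPairing T (positionCLM Φ)).integrable (μ := volume)).const_mul
      (-2 * Real.pi * Complex.I : ℂ)⁻¹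
    refine this.congr (.of_forall fun x ↦ ?_)
    have h2 : (-2 * Real.pi * Complex.I : ℂ) ≠ 0 := by
      have := Complex.two_pi_I_ne_zero
      simp only [neg_mul, ne_eq, neg_eq_zero]
      exact this
    simp only [hX, smul_eq_mul, Complex.real_smul]
    rw [mul_assoc _ (x : ℂ), inv_mul_cancel_left₀ h2]
  have h := Real.hasDerivAt_fourier f.integrable hint ξ
  have e : (fun x : ℝ ↦ (-2 * Real.pi * Complex.I * x) • f x) =
      partialPairing T (positionCLM Φ) := funext fun x ↦ (hX x).symm
  rw [e] at h
  exact h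

lemma fourierPairing_add_right (T : 𝓢'(ℝ, ℂ)) (Φ Ψ : 𝓢(ℝ × ℝ, ℂ)) (ξ : ℝ) :
    fourierPairing T (Φ + Ψ) ξ = fourierPairing T Φ ξ + fourierPairing T Ψ ξ := by
  rw [fourierPairing, map_add, fourier_apply_add]
  rfl

lemma fourierPairing_smul_right (T : 𝓢'(ℝ, ℂ)) (c : ℂ) (Φ : 𝓢(ℝ × ℝ, ℂ)) (ξ : ℝ) :
    fourierPairing T (c • Φ) ξ = c * fourierPairing T Φ ξ := by
  rw [fourierPairing, map_smul, fourier_apply_smul]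
  rfl

lemma fourierPairing_sub_left (S T : 𝓢'(ℝ, ℂ)) (Φ : 𝓢(ℝ × ℝ, ℂ)) (ξ : ℝ) :
    fourierPairing (S - T) Φ ξ = fourierPairing S Φ ξ - fourierPairing T Φ ξ := by
  have : partialPairing (S - T) Φ = partialPairing S Φ - partialPairing T Φ := by
    ext x; rfl
  rw [fourierPairing, this, fourier_apply_sub]
  rfl

lemma fourierPairing_smul_left (c : ℂ) (T : 𝓢'(ℝ, ℂ)) (Φ : 𝓢(ℝ × ℝ, ℂ)) (ξ : ℝ) :
    fourierPairing (c • T) Φ ξ = c * fourierPairing T Φ ξ := by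
  have : partialPairing (c • T) Φ = c • partialPairing T Φ := by
    ext x; rfl
  rw [fourierPairing, this, fourier_apply_smul]
  rfl

lemma fourierPairing_tensorFun (T : 𝓢'(ℝ, ℂ)) (ψ θ : 𝓢(ℝ, ℂ)) (ξ : ℝ) :
    fourierPairing T (tensorFun ψ θ) ξ = T θ * 𝓕 ψ ξ := by
  rw [fourierPairing, partialPairing_tensorFun, fourier_apply_smul]

/-- Bounds for a distribution bound the pairing uniformly in the frequency. -/
lemma exists_norm_fourierPairing_le {q : Seminorm ℂ 𝓢(ℝ, ℂ)} (hq : Continuous q) :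
    ∃ p : Seminorm ℂ 𝓢(ℝ × ℝ, ℂ), Continuous p ∧ ∀ (T : 𝓢'(ℝ, ℂ)) (C : ℝ), 0 ≤ C →
      (∀ φ, ‖T φ‖ ≤ C * q φ) → ∀ Φ ξ, ‖fourierPairing T Φ ξ‖ ≤ C * p Φ := by
  obtain ⟨s, K, -, hK⟩ := Seminorm.bound_of_continuous (schwartz_withSeminorms ℂ ℝ ℂ) q hq
  set p : Seminorm ℂ 𝓢(ℝ × ℝ, ℂ) := ∑ i ∈ s,
    (SchwartzMap.seminorm ℂ i.1 i.2 + SchwartzMap.seminorm ℂ (2 + i.1) i.2) with hp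
  have hpa : ∀ Φ, p Φ = ∑ i ∈ s, (SchwartzMap.seminorm ℂ i.1 i.2 Φ +
      SchwartzMap.seminorm ℂ (2 + i.1) i.2 Φ) := fun Φ ↦ by
    simp [hp]
  have hpc : Continuous p := by
    rw [show (p : 𝓢(ℝ × ℝ, ℂ) → ℝ) = _ from funext hpa]
    refine continuous_finsetSum _ fun i _ ↦ ?_
    exact ((schwartz_withSeminorms ℂ (ℝ × ℝ) ℂ).continuous_seminorm i).add
      ((schwartz_withSeminorms ℂ (ℝ × ℝ) ℂ).continuous_seminorm (2 + i.1, i.2))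
  set A : NNReal := K * ⟨Real.pi, Real.pi_pos.le⟩ with hA
  refine ⟨A • p, hpc.const_smul (A : ℝ), fun T C hC hT Φ ξ ↦ ?_⟩
  have hslice : ∀ x : ℝ, ‖partialPairing T Φ x‖ ≤ C * (K * p Φ) * (1 + x ^ 2)⁻¹ := fun x ↦ by
    rw [partialPairing_apply]
    refine (hT _).trans ?_
    rw [mul_assoc]
    gcongr
    refine (hK _).trans ?_
    rw [smul_apply, NNReal.smul_def, smul_eq_mul, mul_assoc]
    gcongr
    refine Seminorm.finset_sup_apply_le (by positivity) fun i hi ↦ ?_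
    refine (seminorm_slice_le Φ x i.1 i.2).trans ?_
    gcongr
    rw [hpa]
    exact Finset.single_le_sum (f := fun i : ℕ × ℕ ↦ SchwartzMap.seminorm ℂ i.1 i.2 Φ +
      SchwartzMap.seminorm ℂ (2 + i.1) i.2 Φ) (fun _ _ ↦ by positivity) hi
  have h1 : ‖fourierPairing T Φ ξ‖ ≤ ∫ x, ‖partialPairing T Φ x‖ := by
    rw [fourierPairing, SchwartzMap.fourier_coe]
    exact VectorFourier.norm_fourierIntegral_le_integral_norm ..
  refine h1.trans ((integral_mono (partialPairing T Φ).integrable.norm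
    (integrable_inv_one_add_sq.const_mul _) hslice).trans_eq ?_)
  rw [integral_const_mul, integral_univ_inv_one_add_sq, smul_apply, NNReal.smul_def, smul_eq_mul, hA]
  change _ = C * (K * Real.pi * p Φ)
  ring

lemma hasDerivAt_zero_of_norm_le_sq {f : ℝ → ℂ} {K : ℝ} (hf : ∀ h : ℝ, |h| ≤ 1 → ‖f h‖ ≤ K * h ^ 2) :
    HasDerivAt f 0 0 := by
  have h0 : f 0 = 0 := by simpa using hf 0 (by simp)
  rw [hasDerivAt_iff_isLittleO_nhds_zero]
  have hO : (fun h : ℝ ↦ f (0 + h) - f 0 - h • (0 : ℂ)) =O[nhds 0] fun h ↦ h ^ 2 := by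
    refine Asymptotics.IsBigO.of_bound K ?_
    filter_upwards [Metric.closedBall_mem_nhds (0 : ℝ) one_pos] with h hh
    simpa [h0] using hf h (by simpa using hh)
  refine hO.trans_isLittleO ?_
  simpa using (Asymptotics.isLittleO_pow_pow (𝕜 := ℝ) (show 1 < 2 by norm_num))

end FourierPairing

/-! ### The resolvent as an operator on test functions -/

section ResolventOperator

open FourierTransform

variable {F₀ b : ℂ → ℂ} {C₀ Cb : ℝ} {M₀ Mb : ℕ}

/-- The operator with Fourier-Laplace symbol `F₀ / (s + 4π²ξ² b)`. -/
theorem exists_resolventOperator (hF : IsHalfPlaneBounded F₀ C₀ M₀)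
    (hb : IsHalfPlaneBounded b Cb Mb) (hre : ∀ s : ℂ, 0 < s.re → 0 ≤ (b s).re) :
    ∃ A : 𝓢(ℝ × ℝ, ℂ) →L[ℂ] 𝓢(ℝ, ℂ),
      (∀ (ψ : 𝓢(ℝ, ℂ)) (s : ℂ) (hs : 0 < s.re) (ξ : ℝ),
        A (tensorFun ψ (expTest s hs)) ξ = F₀ s / resolventDenom b ξ s * 𝓕 ψ ξ) ∧
      ∀ Φ : 𝓢(ℝ × ℝ, ℂ), (∀ x t, 0 ≤ t → Φ (x, t) = 0) → A Φ = 0 := by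
  obtain ⟨D, hD, hbd, htay⟩ := exists_isInverseLaplace_resolventSymbol hF hb hre
  let A : ℕ → 𝓢(ℝ × ℝ, ℂ) →ₗ[ℂ] (ℝ → ℂ) := fun n ↦
    { toFun := fun Φ ξ ↦ fourierPairing (D n ξ) Φ ξ
      map_add' := fun Φ Ψ ↦ funext fun ξ ↦ fourierPairing_add_right _ _ _ _
      map_smul' := fun c Φ ↦ funext fun ξ ↦ fourierPairing_smul_right _ _ _ _ }
  have hA : ∀ n Φ ξ, A n Φ ξ = fourierPairing (D n ξ) Φ ξ := fun _ _ _ ↦ rfl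
  have hder : ∀ n Φ (ξ : ℝ), HasDerivAt (A n Φ)
      (-(n + 1) * (8 * Real.pi ^ 2) * A (n + 1) (momentumCLM Φ) ξ + A n (positionCLM Φ) ξ) ξ := by
    intro n Φ ξ
    set c : ℂ := -(n + 1) * (8 * Real.pi ^ 2 * ξ) with hc
    obtain ⟨q, hq, K, hK⟩ := htay n ξ
    obtain ⟨p, -, hp⟩ := exists_norm_fourierPairing_le hq
    have hsh : HasDerivAt (fun h : ℝ ↦ ξ + h) 1 0 := (hasDerivAt_id 0).const_add ξ
    have hsc : ∀ T, HasDerivAt (fun h : ℝ ↦ fourierPairing T Φ (ξ + h))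
        (fourierPairing T (positionCLM Φ) ξ) 0 := fun T ↦ by
      have := HasDerivAt.scomp_of_eq (0 : ℝ) (hasDerivAt_fourierPairing T Φ ξ) hsh (by simp)
      rwa [one_smul] at this
    -- The frequency enters twice, in the distribution and in the Fourier variable. `D n (ξ + h)` is
    -- split into a quadratic remainder, the linear term `h c D (n + 1) ξ` and the constant term `D
    -- n ξ`, so that in each piece the distribution can be handled separately.
    have h1 : HasDerivAt (fun h : ℝ ↦ fourierPairing (D n (ξ + h) - D n ξ - (h * c) • D (n + 1) ξ) Φ
        (ξ + h)) 0 0 := by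
      refine hasDerivAt_zero_of_norm_le_sq (K := K * p Φ) fun h hh ↦ ?_
      refine (hp _ _ (hK h hh).1 (hK h hh).2 Φ (ξ + h)).trans_eq (by ring)
    have h2 : HasDerivAt (fun h : ℝ ↦ (h : ℂ) * c * fourierPairing (D (n + 1) ξ) Φ (ξ + h))
        (c * fourierPairing (D (n + 1) ξ) Φ ξ) 0 := by
      have := ((Complex.ofRealCLM.hasDerivAt (x := (0 : ℝ))).mul_const c).mul (hsc (D (n + 1) ξ))
      refine this.congr_deriv ?_
      simp
    have h4 := (h1.add h2).add (hsc (D n ξ))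
    have h5 : HasDerivAt (fun h : ℝ ↦ A n Φ (ξ + h))
        (c * fourierPairing (D (n + 1) ξ) Φ ξ + fourierPairing (D n ξ) (positionCLM Φ) ξ) 0 := by
      refine (h4.congr_deriv (by rw [zero_add])).congr_of_eventuallyEq (.of_forall fun h ↦ ?_)
      simp only [hA, Pi.add_apply, fourierPairing_sub_left, fourierPairing_smul_left]
      ring
    have h6 := HasDerivAt.scomp_of_eq ξ h5 ((hasDerivAt_id ξ).sub_const ξ) (by simp)
    rw [one_smul] at h6
    refine (h6.congr_of_eventuallyEq (.of_forall fun η ↦ ?_)).congr_deriv ?_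
    · simp
    -- The factor `ξ` in `c` is moved into `momentumCLM Φ`, leaving a coefficient independent of `ξ`
    -- as the criterion requires.
    · rw [hA, hA, ← mul_fourierPairing, hc]
      ring
  have hbound : ∀ n, ∃ p : Seminorm ℂ 𝓢(ℝ × ℝ, ℂ), Continuous p ∧ ∀ Φ ξ, ‖A n Φ ξ‖ ≤ p Φ := by
    intro n
    obtain ⟨q, hq, C, hC, hqC⟩ := hbd n
    obtain ⟨p, hpc, hp⟩ := exists_norm_fourierPairing_le hq
    refine ⟨C.toNNReal • p, hpc.const_smul (C.toNNReal : ℝ), fun Φ ξ ↦ ?_⟩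
    rw [smul_apply, NNReal.smul_def, smul_eq_mul, Real.coe_toNNReal C hC]
    exact hp _ C hC (hqC ξ) Φ ξ
  obtain ⟨B, hB⟩ := exists_schwartzCLM_of_hasDerivAt A momentumCLM positionCLM _
    (fun n Φ ξ ↦ mul_fourierPairing _ _ _) hder hbound 0
  refine ⟨B, fun ψ s hs ξ ↦ ?_, fun Φ hΦ ↦ ?_⟩
  · rw [hB, hA, fourierPairing_tensorFun]
    have h := (hD 0 ξ).laplace_eq s hs
    rw [laplaceTransform] at h
    rw [h, resolventSymbol]
    simp [div_eq_mul_inv]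
  · ext ξ
    rw [hB, hA, fourierPairing]
    have : partialPairing (D 0 ξ) Φ = 0 := by
      ext x
      rw [partialPairing_apply]
      have := IsVanishingOn_Iio_congr (hD 0 ξ).vanishes (f := slice x Φ) (g := 0)
        fun t ht ↦ by simp [hΦ x t ht]
      rw [this, map_zero]
      rfl
    rw [this]
    simp

end ResolventOperator

/-! ### Exponential test functions -/

section ExponentialTests

lemma expTest_apply_of_nonneg {s : ℂ} (hs : 0 < s.re) {t : ℝ} (ht : 0 ≤ t) :
    expTest s hs t = Complex.exp (-s * t) := by
  rw [expTest_apply, cutoff_eq_one (by linarith), Complex.ofReal_one, one_mul]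

lemma hasDerivAt_expTest {s : ℂ} (hs : 0 < s.re) {t : ℝ} (ht : -1 < t) :
    HasDerivAt (expTest s hs) (-s * expTest s hs t) t := by
  have h1 : HasDerivAt (fun r : ℝ ↦ -s * (r : ℂ)) (-s) t := by
    simpa using (Complex.ofRealCLM.hasDerivAt (x := t)).const_mul (-s)
  have he : ∀ r : ℝ, -1 < r → expTest s hs r = Complex.exp (-s * r) := fun r hr ↦ by
    rw [expTest_apply, cutoff_eq_one hr.le, Complex.ofReal_one, one_mul]
  rw [he t ht, mul_comm]
  refine h1.cexp.congr_of_eventuallyEq ?_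
  filter_upwards [Ioi_mem_nhds ht] with r hr using he r hr

lemma derivCLM_expTest {s : ℂ} (hs : 0 < s.re) {t : ℝ} (ht : -1 < t) :
    SchwartzMap.derivCLM ℂ ℂ (expTest s hs) t = -s * expTest s hs t :=
  (hasDerivAt_expTest hs ht).deriv

lemma derivCLM_derivCLM_expTest {s : ℂ} (hs : 0 < s.re) {t : ℝ} (ht : -1 < t) :
    SchwartzMap.derivCLM ℂ ℂ (SchwartzMap.derivCLM ℂ ℂ (expTest s hs)) t =
      s ^ 2 * expTest s hs t := by
  have h : HasDerivAt (SchwartzMap.derivCLM ℂ ℂ (expTest s hs)) (-s * (-s * expTest s hs t)) t := by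
    refine ((hasDerivAt_expTest hs ht).const_mul (-s)).congr_of_eventuallyEq ?_
    filter_upwards [Ioi_mem_nhds ht] with r hr using derivCLM_expTest hs hr
  exact h.deriv.trans (by ring)

lemma expTest_zero {s : ℂ} (hs : 0 < s.re) : expTest s hs 0 = 1 := by
  rw [expTest_apply_of_nonneg hs le_rfl]; simp

/-- This yields `L` from the original of `Φ_ε / (s Φ_σ)`, as well as the Laplace transform of `δ'`.
The cutoff is locally `1` at `t = 0`, so no boundary term appears. -/
lemma IsInverseLaplace.derivCLM {F : ℂ → ℂ} {T : 𝓢'(ℝ, ℂ)} (hT : IsInverseLaplace F T) :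
    IsInverseLaplace (fun s ↦ s * F s) (TemperedDistribution.derivCLM ℂ T) where
  vanishes f hf := by
    rw [TemperedDistribution.derivCLM_apply_apply, map_neg, hT.vanishes _
      ((SchwartzMap.tsupport_derivCLM_subset ℂ f).trans hf), neg_zero]
  laplace_eq s hs := by
    rw [laplaceTransform, TemperedDistribution.derivCLM_apply_apply]
    have h : T (-SchwartzMap.derivCLM ℂ ℂ (expTest s hs)) = T (s • expTest s hs) :=
      IsVanishingOn_Iio_congr hT.vanishes fun t ht ↦ by
        rw [neg_apply, derivCLM_expTest hs (by linarith), smul_apply, smul_eq_mul]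
        ring
    rw [h, map_smul]
    exact congrArg (s * ·) (hT.laplace_eq s hs)

end ExponentialTests

/-! ### The Cauchy problem after the Laplace transform -/

section Equation

variable {L u₀ v₀ : 𝓢'(ℝ, ℂ)} {u w : 𝓢'(ℝ × ℝ, ℂ)}

/-- The second derivative on Schwartz functions. -/
def derivSq : 𝓢(ℝ, ℂ) →L[ℂ] 𝓢(ℝ, ℂ) :=
  SchwartzMap.derivCLM ℂ ℂ ∘L SchwartzMap.derivCLM ℂ ℂ

lemma apply_eq_zero_of_tsupport_subset {φ : 𝓢(ℝ × ℝ, ℂ)} (hφ : tsupport φ ⊆ {p : ℝ × ℝ | p.2 < 0})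
    (x : ℝ) {t : ℝ} (ht : 0 ≤ t) : φ (x, t) = 0 :=
  image_eq_zero_of_notMem_tsupport fun h ↦ not_lt.2 ht (hφ h)

lemma isVanishingOn_timeConv (hL : IsVanishingOn L (Set.Iio (0 : ℝ)))
    (hw : IsVanishingOn w {p : ℝ × ℝ | p.2 < 0}) :
    IsVanishingOn (timeConv L w) {p : ℝ × ℝ | p.2 < 0} := fun φ hφ ↦ by
  rw [timeConv_apply]
  refine (IsVanishingOn_Iio_congr hL (g := 0) fun τ hτ ↦ ?_).trans (map_zero L)
  rw [partialPairing_apply]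
  refine (IsVanishingOn_snd_congr hw (g := 0) fun x t ht ↦ ?_).trans (map_zero w)
  rw [slice_apply, convTest_apply, apply_eq_zero_of_tsupport_subset hφ x (by positivity), mul_zero]
  rfl

/-- The exponential factors as `e^{-s(t+τ)} = e^{-st} e^{-sτ}`, and all cutoffs are `1` for
nonnegative times, so convolution in time becomes a product. -/
lemma timeConv_tensorFun_expTest (hL : IsVanishingOn L (Set.Iio (0 : ℝ)))
    (hw : IsVanishingOn w {p : ℝ × ℝ | p.2 < 0}) (ψ : 𝓢(ℝ, ℂ)) {s : ℂ} (hs : 0 < s.re) :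
    timeConv L w (tensorFun ψ (expTest s hs)) =
      laplaceTransform L s hs * w (tensorFun ψ (expTest s hs)) := by
  rw [timeConv_apply, laplaceTransform, mul_comm, ← smul_eq_mul, ← map_smul]
  refine IsVanishingOn_Iio_congr hL fun τ hτ ↦ ?_
  rw [partialPairing_apply, smul_apply, smul_eq_mul, mul_comm, ← smul_eq_mul, ← map_smul]
  refine IsVanishingOn_snd_congr hw fun x t ht ↦ ?_
  rw [slice_apply, convTest_apply, smul_apply, tensorFun_apply, tensorFun_apply,
    expTest_apply_of_nonneg hs ht, expTest_apply_of_nonneg hs hτ,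
    expTest_apply_of_nonneg hs (by positivity : 0 ≤ t + τ), cutoff_eq_one (by linarith),
    cutoff_eq_one (by linarith), smul_eq_mul, Complex.ofReal_add, mul_add, Complex.exp_add]
  push_cast
  ring

lemma isVanishingOn_tensorProduct {T : 𝓢'(ℝ, ℂ)} (S : 𝓢'(ℝ, ℂ))
    (hT : ∀ f : 𝓢(ℝ, ℂ), tsupport f ⊆ Set.Iio 0 → T f = 0) :
    IsVanishingOn (tensorProduct S T) {p : ℝ × ℝ | p.2 < 0} := fun φ hφ ↦ by
  rw [tensorProduct_apply]
  have : partialPairing T φ = 0 := by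
    ext x
    rw [partialPairing_apply]
    refine (IsVanishingOn_Iio_congr hT (g := 0) fun t ht ↦ ?_).trans (map_zero T)
    exact apply_eq_zero_of_tsupport_subset hφ x ht
  rw [this, map_zero]

lemma isInverseLaplace_delta :
    IsInverseLaplace (fun _ ↦ 1) (TemperedDistribution.delta (0 : ℝ)) where
  vanishes f hf := by
    rw [TemperedDistribution.delta_apply]
    exact image_eq_zero_of_notMem_tsupport fun h ↦ lt_irrefl (0 : ℝ) (hf h)
  laplace_eq s hs := expTest_zero hs

lemma lineDeriv_snd_snd_tensorFun_expTest (hu : IsVanishingOn u {p : ℝ × ℝ | p.2 < 0})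
    (ψ : 𝓢(ℝ, ℂ)) {s : ℂ} (hs : 0 < s.re) :
    (∂_{((0 : ℝ), (1 : ℝ))} (∂_{((0 : ℝ), (1 : ℝ))} u) : 𝓢'(ℝ × ℝ, ℂ)) (tensorFun ψ (expTest s hs)) =
      s ^ 2 * u (tensorFun ψ (expTest s hs)) := by
  rw [TemperedDistribution.lineDerivOp_apply_apply, TemperedDistribution.lineDerivOp_apply_apply,
    lineDeriv_snd_tensorFun, ← smul_eq_mul, ← map_smul]
  refine IsVanishingOn_snd_congr hu fun x t ht ↦ ?_
  rw [LineDeriv.lineDerivOp_neg, neg_neg, lineDeriv_snd_tensorFun, tensorFun_apply,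
    derivCLM_derivCLM_expTest hs (by linarith), smul_apply, tensorFun_apply, smul_eq_mul]
  ring

lemma lineDeriv_fst_fst_tensorFun (u : 𝓢'(ℝ × ℝ, ℂ)) (ψ θ : 𝓢(ℝ, ℂ)) :
    (∂_{((1 : ℝ), (0 : ℝ))} (∂_{((1 : ℝ), (0 : ℝ))} u) : 𝓢'(ℝ × ℝ, ℂ)) (tensorFun ψ θ) =
      u (tensorFun (derivSq ψ) θ) := by
  rw [TemperedDistribution.lineDerivOp_apply_apply, TemperedDistribution.lineDerivOp_apply_apply,
    lineDeriv_fst_tensorFun, LineDeriv.lineDerivOp_neg, neg_neg, lineDeriv_fst_tensorFun]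
  rfl

/-- The Cauchy problem in terms of the Laplace transform in time. -/
theorem isCauchySolution_iff {F : ℂ → ℂ} (hL : IsInverseLaplace F L) :
    IsCauchySolution L u₀ v₀ u ↔ IsVanishingOn u {p : ℝ × ℝ | p.2 < 0} ∧
      ∀ (ψ : 𝓢(ℝ, ℂ)) (s : ℂ) (hs : 0 < s.re),
        s ^ 2 * u (tensorFun ψ (expTest s hs)) - F s * u (tensorFun (derivSq ψ) (expTest s hs)) =
          s * u₀ ψ + v₀ ψ := by
  have hx : ∀ (_ : IsVanishingOn u {p : ℝ × ℝ | p.2 < 0}),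
      IsVanishingOn (∂_{((1 : ℝ), (0 : ℝ))} (∂_{((1 : ℝ), (0 : ℝ))} u) : 𝓢'(ℝ × ℝ, ℂ))
        {p : ℝ × ℝ | p.2 < 0} := fun hu ↦
    TemperedDistribution.IsVanishingOn.lineDerivOp (TemperedDistribution.IsVanishingOn.lineDerivOp hu _) _
  have hlhs : ∀ (_ : IsVanishingOn u {p : ℝ × ℝ | p.2 < 0}) (ψ : 𝓢(ℝ, ℂ)) (s : ℂ) (hs : 0 < s.re),
      ((∂_{((0 : ℝ), (1 : ℝ))} (∂_{((0 : ℝ), (1 : ℝ))} u) : 𝓢'(ℝ × ℝ, ℂ)) -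
        timeConv L (∂_{((1 : ℝ), (0 : ℝ))} (∂_{((1 : ℝ), (0 : ℝ))} u))) (tensorFun ψ (expTest s hs)) =
      s ^ 2 * u (tensorFun ψ (expTest s hs)) - F s * u (tensorFun (derivSq ψ) (expTest s hs)) := by
    intro hu ψ s hs
    have h1 := lineDeriv_snd_snd_tensorFun_expTest hu ψ hs
    have h2 := timeConv_tensorFun_expTest hL.vanishes
      (hx hu) ψ hs
    rw [hL.laplace_eq, lineDeriv_fst_fst_tensorFun] at h2
    exact congrArg₂ (· - ·) h1 h2
  have hrhs : ∀ (ψ : 𝓢(ℝ, ℂ)) (s : ℂ) (hs : 0 < s.re),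
      (tensorProduct u₀ (TemperedDistribution.derivCLM ℂ (TemperedDistribution.delta 0)) +
        tensorProduct v₀ (TemperedDistribution.delta 0) : 𝓢'(ℝ × ℝ, ℂ)) (tensorFun ψ (expTest s hs)) =
      s * u₀ ψ + v₀ ψ := by
    intro ψ s hs
    have h : ∀ (S T : 𝓢'(ℝ, ℂ)) (c : ℂ), laplaceTransform T s hs = c →
        tensorProduct S T (tensorFun ψ (expTest s hs)) = c * S ψ := fun S T c hc ↦ by
      rw [tensorProduct_apply, partialPairing_tensorFun, map_smul, smul_eq_mul]
      exact congrArg (· * S ψ) hc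
    have h1 := h u₀ _ _ (isInverseLaplace_delta.derivCLM.laplace_eq s hs)
    have h2 := h v₀ _ _ (isInverseLaplace_delta.laplace_eq s hs)
    rw [mul_one] at h1
    rw [one_mul] at h2
    exact congrArg₂ (· + ·) h1 h2
  refine ⟨fun h ↦ ⟨h.vanishes, fun ψ s hs ↦ ?_⟩, fun h ↦ ⟨h.1, ?_⟩⟩
  · rw [← hlhs h.vanishes, h.equation, hrhs]
  · rw [← sub_eq_zero]
    -- Both sides of the equation vanish for negative times, so it suffices to compare them on
    -- products with exponentials.
    refine eq_zero_of_tensorFun_expTest (fun φ hφ ↦ ?_) fun ψ s hs ↦ ?_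
    · have h1 := TemperedDistribution.IsVanishingOn.lineDerivOp (TemperedDistribution.IsVanishingOn.lineDerivOp h.1 ((0 : ℝ), (1 : ℝ))) ((0 : ℝ), (1 : ℝ)) φ hφ
      have h2 := isVanishingOn_timeConv hL.vanishes
        (hx h.1) φ hφ
      have h3 := isVanishingOn_tensorProduct u₀ isInverseLaplace_delta.derivCLM.vanishes φ hφ
      have h4 := isVanishingOn_tensorProduct v₀ isInverseLaplace_delta.vanishes φ hφ
      have := congrArg₂ (· - ·) (congrArg₂ (· - ·) h1 h2) (congrArg₂ (· + ·) h3 h4)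
      simp only [sub_zero, add_zero] at this
      exact this
    · have := congrArg₂ (· - ·) (hlhs h.1 ψ s hs) (hrhs ψ s hs)
      refine Eq.trans this ?_
      exact sub_eq_zero.2 (h.2 ψ s hs)

end Equation

/-! ### Existence and uniqueness of the solution -/

section Solution

open FourierTransform

variable {F₀ b : ℂ → ℂ} {C₀ Cb : ℝ} {M₀ Mb : ℕ}

lemma fourier_injective {f g : 𝓢(ℝ, ℂ)} (h : ∀ ξ, 𝓕 f ξ = 𝓕 g ξ) : f = g := by
  have : (𝓕 f : 𝓢(ℝ, ℂ)) = 𝓕 g := SchwartzMap.ext h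
  rw [← fourierInv_fourier_eq (F := 𝓢(ℝ, ℂ)) f, this, fourierInv_fourier_eq]

lemma fourier_derivSq (f : 𝓢(ℝ, ℂ)) (ξ : ℝ) :
    𝓕 (derivSq f) ξ = -(4 * Real.pi ^ 2 * ξ ^ 2) * 𝓕 f ξ := by
  change 𝓕 (SchwartzMap.derivCLM ℂ ℂ (SchwartzMap.derivCLM ℂ ℂ f)) ξ = _
  rw [fourier_apply_deriv, fourier_apply_deriv]
  linear_combination (4 * Real.pi ^ 2 * ξ ^ 2 * 𝓕 f ξ : ℂ) * Complex.I_sq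

/-- The solution operator of `s² G - s b G'' = s F₀`, for the Laplace transform in time. -/
theorem exists_solutionOperator (hF : IsHalfPlaneBounded F₀ C₀ M₀)
    (hb : IsHalfPlaneBounded b Cb Mb) (hre : ∀ s : ℂ, 0 < s.re → 0 ≤ (b s).re) :
    ∃ G : 𝓢(ℝ × ℝ, ℂ) →L[ℂ] 𝓢(ℝ, ℂ),
      (∀ (ψ : 𝓢(ℝ, ℂ)) (s : ℂ) (hs : 0 < s.re),
        s ^ 2 • G (tensorFun ψ (expTest s hs)) -
          (s * b s) • G (tensorFun (derivSq ψ) (expTest s hs)) = (s * F₀ s) • ψ ∧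
        G (tensorFun (derivSq ψ) (expTest s hs)) = derivSq (G (tensorFun ψ (expTest s hs)))) ∧
      ∀ Φ : 𝓢(ℝ × ℝ, ℂ), (∀ x t, 0 ≤ t → Φ (x, t) = 0) → G Φ = 0 := by
  obtain ⟨A, hA, hA0⟩ := exists_resolventOperator hF hb hre
  let G : 𝓢(ℝ × ℝ, ℂ) →L[ℂ] 𝓢(ℝ, ℂ) := fourierInvCLM ℂ 𝓢(ℝ, ℂ) ∘L A
  have hG : ∀ ψ (s : ℂ) (hs : 0 < s.re) ξ, 𝓕 (G (tensorFun ψ (expTest s hs))) ξ =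
      F₀ s / resolventDenom b ξ s * 𝓕 ψ ξ := fun ψ s hs ξ ↦ by
    have : (𝓕 (G (tensorFun ψ (expTest s hs))) : 𝓢(ℝ, ℂ)) = A (tensorFun ψ (expTest s hs)) :=
      fourier_fourierInv_eq _
    rw [this, hA]
  refine ⟨G, fun ψ s hs ↦ ⟨fourier_injective fun ξ ↦ ?_, fourier_injective fun ξ ↦ ?_⟩,
    fun Φ hΦ ↦ ?_⟩
  · have hne : resolventDenom b ξ s ≠ 0 :=
      ne_zero_of_re_pos (lt_of_lt_of_le hs (re_le_re_resolventDenom ξ (hre s hs)))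
    rw [fourier_apply_sub, fourier_apply_smul, fourier_apply_smul, fourier_apply_smul, hG, hG,
      fourier_derivSq]
    -- The right side is the Fourier symbol of `s² - s b ∂ₓ²`.
    have hden : s * resolventDenom b ξ s = s ^ 2 + s * b s * (4 * Real.pi ^ 2 * ξ ^ 2) := by
      rw [resolventDenom]
      push_cast
      ring
    field_simp
    linear_combination (-F₀ s * 𝓕 ψ ξ) * hden
  -- At fixed `s`, `G` is a Fourier multiplier in `x` and commutes with `∂ₓ²`; the uniqueness
  -- argument depends on this.
  · rw [hG, fourier_derivSq, fourier_derivSq, hG]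
    ring
  · change fourierInvCLM ℂ 𝓢(ℝ, ℂ) (A Φ) = 0
    rw [hA0 Φ hΦ, map_zero]

lemma isHalfPlaneBounded_one : IsHalfPlaneBounded (fun _ ↦ 1) 1 0 where
  differentiableOn := differentiableOn_const _
  norm_le s _ := by simp

lemma isHalfPlaneBounded_inv : IsHalfPlaneBounded (fun s ↦ s⁻¹) 1 1 where
  differentiableOn := differentiableOn_id.inv fun _ hs ↦ ne_zero_of_re_pos hs
  norm_le s hs := by
    rw [norm_inv, one_mul, pow_one, one_div]
    have := inv_anti₀ hs (Complex.re_le_norm s)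
    linarith

/-- Well-posedness of the Cauchy problem when `L` has Laplace transform `s b(s)` with `Re b ≥ 0`. -/
theorem existsUnique_isCauchySolution {L : 𝓢'(ℝ, ℂ)} (hL : IsInverseLaplace (fun s ↦ s * b s) L)
    (hb : IsHalfPlaneBounded b Cb Mb) (hre : ∀ s : ℂ, 0 < s.re → 0 ≤ (b s).re)
    (u₀ v₀ : 𝓢'(ℝ, ℂ)) : ∃! u : 𝓢'(ℝ × ℝ, ℂ), IsCauchySolution L u₀ v₀ u := by
  -- The sources are `s u₀` and `v₀`, and the right side produced is `s F₀`; hence `F₀ = 1` for `u₀`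
  -- and `F₀ = s⁻¹` for `v₀`.
  obtain ⟨G₁, hG₁, hG₁'⟩ := exists_solutionOperator isHalfPlaneBounded_one hb hre
  obtain ⟨G₂, hG₂, hG₂'⟩ := exists_solutionOperator isHalfPlaneBounded_inv hb hre
  have hG₂s : ∀ (ψ : 𝓢(ℝ, ℂ)) (s : ℂ) (hs : 0 < s.re),
      s ^ 2 • G₂ (tensorFun ψ (expTest s hs)) -
        (s * b s) • G₂ (tensorFun (derivSq ψ) (expTest s hs)) = ψ := fun ψ s hs ↦ by
    rw [(hG₂ ψ s hs).1, mul_inv_cancel₀ (ne_zero_of_re_pos hs), one_smul]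
  have hG₁s : ∀ (ψ : 𝓢(ℝ, ℂ)) (s : ℂ) (hs : 0 < s.re),
      s ^ 2 • G₁ (tensorFun ψ (expTest s hs)) -
        (s * b s) • G₁ (tensorFun (derivSq ψ) (expTest s hs)) = s • ψ := fun ψ s hs ↦ by
    rw [(hG₁ ψ s hs).1, mul_one]
  have hsol : IsCauchySolution L u₀ v₀
      (PointwiseConvergenceCLM.precomp ℂ G₁ u₀ + PointwiseConvergenceCLM.precomp ℂ G₂ v₀) := by
    refine (isCauchySolution_iff hL).2 ⟨fun φ hφ ↦ ?_, fun ψ s hs ↦ ?_⟩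
    · change u₀ (G₁ φ) + v₀ (G₂ φ) = 0
      have h0 : ∀ x t, 0 ≤ t → φ (x, t) = 0 := fun x t ht ↦
        apply_eq_zero_of_tsupport_subset hφ x ht
      rw [hG₁' φ h0, hG₂' φ h0, map_zero, map_zero, add_zero]
    · have h1 := congrArg u₀ (hG₁s ψ s hs)
      have h2 := congrArg v₀ (hG₂s ψ s hs)
      rw [map_sub, map_smul, map_smul, map_smul] at h1
      rw [map_sub, map_smul, map_smul] at h2
      simp only [smul_eq_mul] at h1 h2
      change s ^ 2 * (u₀ (G₁ _) + v₀ (G₂ _)) - s * b s * (u₀ (G₁ _) + v₀ (G₂ _)) = _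
      linear_combination h1 + h2
  refine ⟨_, hsol, fun u hu ↦ ?_⟩
  obtain ⟨hv₁, h₁⟩ := (isCauchySolution_iff hL).1 hu
  obtain ⟨hv₂, h₂⟩ := (isCauchySolution_iff hL).1 hsol
  set w := PointwiseConvergenceCLM.precomp ℂ G₁ u₀ + PointwiseConvergenceCLM.precomp ℂ G₂ v₀
  rw [← sub_eq_zero]
  refine eq_zero_of_tensorFun_expTest (fun φ hφ ↦ ?_) fun ψ s hs ↦ ?_
  · change u φ - w φ = 0
    rw [hv₁ φ hφ, hv₂ φ hφ, sub_zero]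
  · change u _ - w _ = 0
    -- Duality: `ψ = s² θ - s b θ''`, so the transformed equations for `u` and `w`, tested on `θ`,
    -- have as left sides their values on `ψ(x) e^{-st}`, and the right sides agree.
    set θ := G₂ (tensorFun ψ (expTest s hs)) with hθ
    have hψ : tensorFun ψ (expTest s hs) = s ^ 2 • tensorFun θ (expTest s hs) -
        (s * b s) • tensorFun (derivSq θ) (expTest s hs) := by
      have h := hG₂s ψ s hs
      rw [(hG₂ ψ s hs).2, ← hθ] at h
      ext p
      have hp := congrArg (fun f : 𝓢(ℝ, ℂ) ↦ f p.1) h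
      simp only [sub_apply, smul_apply, smul_eq_mul] at hp
      simp only [sub_apply, smul_apply, smul_eq_mul, tensorFun_apply]
      rw [← hp]
      ring
    rw [hψ, map_sub, map_sub, map_smul, map_smul, map_smul, map_smul]
    simp only [smul_eq_mul]
    linear_combination h₁ θ s hs - h₂ θ s hs

end Solution

end ViscoWave

end

/-! ### The main theorem -/

theorem mainTheorem1 (μσ με : Measure unitInterval)
    [IsFiniteMeasure μσ] [IsFiniteMeasure με] (hσ : μσ ≠ 0)
    (hT : ViscoWave.ThermodynamicalRestriction μσ με) :
    (∃! L : 𝓢'(ℝ, ℂ),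
      ViscoWave.IsInverseLaplace (fun s ↦ ViscoWave.Phi με s / ViscoWave.Phi μσ s) L) ∧
    ∀ L : 𝓢'(ℝ, ℂ),
      ViscoWave.IsInverseLaplace (fun s ↦ ViscoWave.Phi με s / ViscoWave.Phi μσ s) L →
      ∀ u₀ v₀ : 𝓢'(ℝ, ℂ), ∃! u : 𝓢'(ℝ × ℝ, ℂ), ViscoWave.IsCauchySolution L u₀ v₀ u := by
  have hb := ViscoWave.isHalfPlaneBounded_Phi_div μσ με hσ
  have hre : ∀ s : ℂ, 0 < s.re → 0 ≤ (ViscoWave.Phi με s / ViscoWave.Phi μσ s / s).re :=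
    fun s hs ↦ hT.re_nonneg hs
  have hdiv : ∀ s : ℂ, 0 < s.re → s * (ViscoWave.Phi με s / ViscoWave.Phi μσ s / s) =
      ViscoWave.Phi με s / ViscoWave.Phi μσ s :=
    fun s hs ↦ mul_div_cancel₀ _ (ViscoWave.ne_zero_of_re_pos hs)
  refine ⟨?_, fun L hL u₀ v₀ ↦ ViscoWave.existsUnique_isCauchySolution
    ⟨hL.vanishes, fun s hs ↦ (hL.laplace_eq s hs).trans (hdiv s hs).symm⟩ hb hre u₀ v₀⟩
  -- The exponent `2` is the one in `isHalfPlaneBounded_Phi_div`. The original `T` of `Φ_ε / (s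
  -- Φ_σ)` is differentiated once to give `L`.
  obtain ⟨q, -, hq⟩ := ViscoWave.exists_isInverseLaplace 2
  obtain ⟨T, hT', -⟩ := hq _ _ hb
  exact ⟨_, ⟨hT'.derivCLM.vanishes, fun s hs ↦ (hT'.derivCLM.laplace_eq s hs).trans (hdiv s hs)⟩,
    fun L hL ↦ ViscoWave.eq_of_isInverseLaplace hL
      ⟨hT'.derivCLM.vanishes, fun s hs ↦ (hT'.derivCLM.laplace_eq s hs).trans (hdiv s hs)⟩⟩
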